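/- Let $G=SL(2,\mathbb R)$ with $a=\mathrm{diag}(a,a^{-1})$ ($a>0$), $n_t=\begin{pmatrix}1&t\\0&1\end{pmatrix}$, $k_\theta=\begin{pmatrix}\cos\theta&-\sin\theta\\ \sin\theta&\cos\theta\end{pmatrix}$, $K=\{k_\theta\}$ with $dk=d\theta$, and $P_0=\{an_t\}$. For $s\in\mathbb C$ and a sign $\pm$, let $\mathcal P(s,\pm)^\infty$ be the smooth vectors of the principal series of $G$ in the noncompact picture, i.e. the functions $v(x)=F(x,1)$ on $\mathbb R$ with $F$ smooth on $\mathbb R^2\setminus\{0\}$ and $F(cy)=\chi_\pm(c)|c|^{-1-s}F(y)$ for $c\neq0$ (where $\chi_+=1$, $\chi_-=\mathrm{sgn}$), with the action $(\pi_{s,\pm}(g)F)(y)=F(g^{-1}y)$. Let $\mathcal P(s,\pm)^{-\infty}$ be the continuous dual of $\mathcal P(-s,\pm)^{\infty}$, with $\langle\pi_{s,\pm}(g)\tau,v\rangle=\langle\tau,\pi_{-s,\pm}(g^{-1})v\rangle$. Let $u\in\mathbb C$ with $u_0=\Re(u)<1$. For $v\in\mathcal P(-u,\pm)^\infty$ and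 $\xi\ne0$ put $\mathcal Fv(\xi)=\frac1{2\pi i\xi}\int_{\mathbb R}v'(x)e^{-2\pi ix\xi}\,dx$, which is $\int v(x)e^{-2\pi ix\xi}dx$ when $v$ is integrable. Let $\mathfrak p$ be a positive integer and let $\tau\in\mathcal P(u,\pm)^{-\infty}$ be periodic without constant term: there are $b_n\in\mathbb C$ with $$\tau=\sum_{n\in\mathfrak p^{-1}\mathbb Z,\,n\neq0}b_n e^{2\pi inx}\quad\text{weakly, i.e.}\quad \langle\tau,v\rangle=\sum_{n\in\mathfrak p^{-1}\mathbb Z,\,n\ne0}b_n\,\mathcal Fv(-n)\ \text{ for all }v\in\mathcal P(-u,\pm)^\infty .$$ Suppose that for some $\phi\in\mathcal P(-u,\pm)^\infty$ the function $an_t\mapsto\langle\pi_{u,\pm}(an_t)\tau,\phi\rangle$ is bounded on $P_0$ and $\mathcal F\phi$ vanishes identically neither on $(0,\infty)$ nor on $(-\infty,0)$. (1) For every $\epsilon>0$ there is a constant $C>0$ such that for all $a_1>0$ and all $v\in\mathcal P(-u,\pm)^\infty$ $$\int_0^{a_1}\int_0^{\mathfrak p}|\langle\pi_{u,\pm}(an_t)\tau,v\rangle|^2\,dt\,a^\epsilon\frac{da}a\le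 C\,a_1^\epsilon\int_{|\xi|\ge 1/(a_1^2\mathfrak p)}|\xi|^{u_0}|\mathcal Fv(\xi)|^2\,d\xi<\infty .$$ (2) Suppose moreover that $\mathcal P(u,\pm)$ is unitary, i.e. $u\in i\mathbb R$, or the sign is $+$ and $u\in(-1,1)$ is real. Define the norm of $v\in\mathcal P(-u,\pm)^\infty$ by $\|v\|^2=\int_{\mathbb R}|v(x)|^2dx$ if $u\in i\mathbb R$ and by $\|v\|^2=\int_{\mathbb R}|\xi|^{u}|\mathcal Fv(\xi)|^2d\xi$ if $u\in(-1,1)\setminus\{0\}$; it is finite. Let $\mathcal P(-u,\pm)$ be the completion. Then for every $v\in\mathcal P(-u,\pm)$ the matrix coefficients $\langle\pi_{u,\pm}(an_t)\tau,v\rangle$ and $\langle\pi_{u,\pm}(kan_t)\tau,v\rangle$ are defined as limits in $L^2_{loc}(P_0)$, respectively $L^2_{loc}(G)$, of those of any sequence of smooth vectors converging to $v$ (the limits exist and do not depend on the sequence). For every $\epsilon>0$ there is $C>0$ such that for all $a_1>0$ and all $v\in\mathcal P(-u,\pm)$ $$\int_0^{a_1}\int_0^{\mathfrak p}|\langle\pi_{u,\pm}(an_t)\tau,v\rangle|^2\,dt\,a^\epsilon\frac{da}a\le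 C\,a_1^\epsilon\|v\|^2,$$ $$\int_K\int_0^{a_1}\int_0^{\mathfrak p}|\langle\pi_{u,\pm}(kan_t)\tau,v\rangle|^2\,dt\,a^\epsilon\frac{da}a\,dk\le C\,a_1^\epsilon\|v\|^2 .$$ For smooth $v$ both inequalities hold with the actual matrix coefficients. -/

import Mathlib

open MeasureTheory Filter Set
open scoped Topology ContDiff MatrixGroups FourierTransform ENNReal

noncomputable section

namespace PrincipalSeries

/-- The sign `±` of a principal series representation. -/
inductive Parity
  | plus
  | minus

/-- The characters `χ₊ = 1` and `χ₋ = sgn` of `ℝ \ {0}`. -/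
def Parity.char : Parity → ℝ → ℂ
  | .plus, _ => 1
  | .minus, x => ((SignType.sign x : ℝ) : ℂ)

/-- The smooth vectors `𝒫(s, ±)^∞`, as the smooth functions on `ℝ² \ {0}` that are homogeneous of
degree `-1 - s` and of parity `±` (the value at the origin is normalised to be `0`). The function
in the noncompact picture is the restriction to the line `{(x, 1)}`, see `noncompact`. -/
def SmoothVectors (δ : Parity) (s : ℂ) : Submodule ℂ ((Fin 2 → ℝ) → ℂ) where
  carrier := {F | ContDiffOn ℝ ∞ F {0}ᶜ ∧ F 0 = 0 ∧
    ∀ (c : ℝ) (y : Fin 2 → ℝ), c ≠ 0 → y ≠ 0 →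
      F (c • y) = δ.char c * ((|c| : ℝ) : ℂ) ^ (-1 - s) * F y}
  add_mem' := by
    rintro F G ⟨hF, hF0, hFh⟩ ⟨hG, hG0, hGh⟩
    refine ⟨hF.add hG, by simp [hF0, hG0], fun c y hc hy => ?_⟩
    simp only [Pi.add_apply, hFh c y hc hy, hGh c y hc hy]
    ring
  zero_mem' := ⟨contDiffOn_const, rfl, by simp⟩
  smul_mem' := by
    rintro z F ⟨hF, hF0, hFh⟩
    refine ⟨contDiffOn_const.smul hF, by simp [hF0], fun c y hc hy => ?_⟩
    simp only [Pi.smul_apply, hFh c y hc hy, smul_eq_mul]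
    ring

theorem mulVec_ne_zero (g : SL(2, ℝ)) {y : Fin 2 → ℝ} (hy : y ≠ 0) :
    g.1.mulVec y ≠ 0 := by
  intro h
  apply hy
  have h2 : (g⁻¹ * g).1.mulVec y = 0 := by
    rw [Matrix.SpecialLinearGroup.coe_mul, ← Matrix.mulVec_mulVec, h, Matrix.mulVec_zero]
  simpa using h2

/-- The action of `SL(2, ℝ)` on `𝒫(s, ±)^∞`, `(π(g) F)(y) = F(g⁻¹ y)`; in the noncompact picture
this is the usual action by fractional linear transformations, see `noncompact_rep`. -/
def rep (δ : Parity) (s : ℂ) : Representation ℂ SL(2, ℝ) (SmoothVectors δ s) where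
  toFun g :=
    { toFun := fun F => ⟨fun y => F.1 (g⁻¹.1.mulVec y), by
        obtain ⟨F, hF, hF0, hFh⟩ := F
        refine ⟨?_, by simp [hF0], fun c y hc hy => ?_⟩
        · refine hF.comp (t := {0}ᶜ) ?_ (fun y hy => mulVec_ne_zero g⁻¹ hy)
          exact (LinearMap.toContinuousLinearMap (Matrix.mulVecLin g⁻¹.1)).contDiff.contDiffOn
        · simp only [Matrix.mulVec_smul]
          exact hFh c _ hc (mulVec_ne_zero g⁻¹ hy)⟩
      map_add' := fun _ _ => rfl
      map_smul' := fun _ _ => rfl }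
  map_one' := by ext F y; simp
  map_mul' g h := by
    refine LinearMap.ext fun F => Subtype.ext (funext fun y => ?_)
    change F.1 _ = F.1 (h⁻¹.1.mulVec (g⁻¹.1.mulVec y))
    rw [Matrix.mulVec_mulVec, mul_inv_rev, Matrix.SpecialLinearGroup.coe_mul]

variable {δ : Parity} {s u : ℂ}

/-- The noncompact picture: the function `x ↦ F(x, 1)` on the line. -/
def noncompact (v : SmoothVectors δ s) (x : ℝ) : ℂ := v.1 ![x, 1]

/-- The action in the noncompact picture. -/
theorem noncompact_rep (g : SL(2, ℝ)) (v : SmoothVectors δ s) (x : ℝ)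
    (hx : g.1 0 0 - g.1 1 0 * x ≠ 0) :
    noncompact (rep δ s g v) x =
      δ.char (g.1 0 0 - g.1 1 0 * x) * ((|g.1 0 0 - g.1 1 0 * x| : ℝ) : ℂ) ^ (-1 - s) *
        noncompact v ((g.1 1 1 * x - g.1 0 1) / (g.1 0 0 - g.1 1 0 * x)) := by
  have h1 : (![(g.1 1 1 * x - g.1 0 1) / (g.1 0 0 - g.1 1 0 * x), 1] : Fin 2 → ℝ) ≠ 0 := by
    intro h
    simpa using congrFun h 1
  unfold noncompact
  rw [← v.2.2.2 _ _ hx h1]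
  change v.1 (g⁻¹.1.mulVec ![x, 1]) = _
  refine congrArg v.1 (funext fun i => ?_)
  rw [Matrix.SpecialLinearGroup.coe_inv, Matrix.adjugate_fin_two]
  fin_cases i
  · simp [Matrix.mulVec, dotProduct, Fin.sum_univ_two]
    rw [mul_div_cancel₀ _ hx]
    ring
  · simp [Matrix.mulVec, dotProduct, Fin.sum_univ_two]
    ring

/-- The Fourier transform `𝓕 v(ξ) = ∫ v(x) exp(-2πixξ) dx` of a smooth vector at `ξ ≠ 0`. Since
`v` itself need not be integrable, the (conditionally convergent) integral is read through one
integration by parts, `𝓕 v(ξ) = (2πiξ)⁻¹ 𝓕(v')(ξ)`. -/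
def fourier (v : SmoothVectors δ s) (ξ : ℝ) : ℂ :=
  (2 * Real.pi * Complex.I * ξ)⁻¹ * 𝓕 (deriv (noncompact v)) ξ

theorem differentiable_noncompact (v : SmoothVectors δ s) : Differentiable ℝ (noncompact v) := by
  have h : ContDiff ℝ ∞ (noncompact v) := by
    rw [← contDiffOn_univ]
    refine v.2.1.comp (t := {0}ᶜ) (f := fun x : ℝ => (![x, 1] : Fin 2 → ℝ)) ?_ ?_
    · rw [contDiffOn_univ, contDiff_pi]
      intro i
      fin_cases i
      · exact contDiff_id
      · exact contDiff_const
    · intro x _ h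
      simpa using congrFun h 1
  exact h.differentiable (by simp)

/-- For integrable `v` this is the usual Fourier transform. -/
theorem fourier_eq (v : SmoothVectors δ s) (hv : Integrable (noncompact v))
    (hv' : Integrable (deriv (noncompact v))) {ξ : ℝ} (hξ : ξ ≠ 0) :
    fourier v ξ = 𝓕 (noncompact v) ξ := by
  unfold fourier
  rw [Real.fourier_deriv hv (differentiable_noncompact v) hv']
  have : (2 * Real.pi * Complex.I * ξ : ℂ) ≠ 0 := by
    simp [Real.pi_ne_zero, hξ]
  exact inv_mul_cancel_left₀ this _

/-- The distribution vectors `𝒫(u, ±)^{-∞}`: the continuous linear functionals on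
`𝒫(-u, ±)^∞`, for the topology of uniform convergence of all derivatives on the unit circle. -/
structure DistVectors (δ : Parity) (u : ℂ) where
  /-- The functional `v ↦ ⟨τ, v⟩`. -/
  toFun : SmoothVectors δ (-u) →ₗ[ℂ] ℂ
  continuous' : ∃ (m : ℕ) (C : ℝ), ∀ (v : SmoothVectors δ (-u)) (B : ℝ),
    (∀ k ≤ m, ∀ θ : ℝ,
      ‖iteratedDeriv k (fun x : ℝ => v.1 ![Real.cos x, Real.sin x]) θ‖ ≤ B) →
    ‖toFun v‖ ≤ C * B

/-- The matrix coefficient `⟨π_{u,±}(g) τ, v⟩ = ⟨τ, π_{-u,±}(g⁻¹) v⟩`. -/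
def matrixCoeff (τ : DistVectors δ u) (v : SmoothVectors δ (-u)) (g : SL(2, ℝ)) : ℂ :=
  τ.toFun (rep δ (-u) g⁻¹ v)

/-- `τ = ∑* b_n exp(2πinx)` over the nonzero `n ∈ 𝔭⁻¹ℤ`, weakly in `𝒫(u, ±)^{-∞}`, for some
coefficients `b_n`. Here `⟨exp(2πinx), v⟩ = 𝓕 v(-n)`, and `n` is written as `m / 𝔭`. -/
def IsPeriodicNoConst (τ : DistVectors δ u) (p : ℕ) : Prop :=
  ∃ b : ℤ → ℂ, ∀ v : SmoothVectors δ (-u),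
    HasSum (fun m : {m : ℤ // m ≠ 0} => b m * fourier v (-((m : ℤ) / (p : ℝ)))) (τ.toFun v)

/-- The element `diag(a, a⁻¹)` of `A` (used for `a > 0` only). -/
def elemA (a : ℝ) : SL(2, ℝ) :=
  if h : a ≠ 0 then ⟨!![a, 0; 0, a⁻¹], by simp [Matrix.det_fin_two, h]⟩ else 1

/-- The element `n_t` of `N`. -/
def elemN (t : ℝ) : SL(2, ℝ) := ⟨!![1, t; 0, 1], by simp [Matrix.det_fin_two]⟩

/-- The element `k_θ` of `K`. -/
def elemK (θ : ℝ) : SL(2, ℝ) :=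
  ⟨!![Real.cos θ, -Real.sin θ; Real.sin θ, Real.cos θ], by
    rw [Matrix.det_fin_two_of]
    nlinarith [Real.sin_sq_add_cos_sq θ]⟩

/-- `⟨π(a n_t) τ, v⟩` as a function of `a` and `t`. -/
def coeffAN (τ : DistVectors δ u) (v : SmoothVectors δ (-u)) (a t : ℝ) : ℂ :=
  matrixCoeff τ v (elemA a * elemN t)

/-- `⟨π(k_θ a n_t) τ, v⟩` as a function of `θ`, `a` and `t`. -/
def coeffKAN (τ : DistVectors δ u) (v : SmoothVectors δ (-u)) (θ a t : ℝ) : ℂ :=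
  matrixCoeff τ v (elemK θ * elemA a * elemN t)

/-- `∫₀^{a₁} ∫₀^𝔭 |f(a, t)|² dt a^ε da/a`. -/
def siegelIntegral (p : ℕ) (ε a₁ : ℝ) (f : ℝ → ℝ → ℂ) : ℝ≥0∞ :=
  ∫⁻ a in Ioc 0 a₁, (∫⁻ t in Ioc 0 (p : ℝ), ‖f a t‖ₑ ^ 2) * ENNReal.ofReal (a ^ ε / a)

/-- `∫_K ∫₀^{a₁} ∫₀^𝔭 |f(k, a, t)|² dt a^ε da/a dk`, with `dk = dθ`. -/
def siegelIntegralK (p : ℕ) (ε a₁ : ℝ) (f : ℝ → ℝ → ℝ → ℂ) : ℝ≥0∞ :=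
  ∫⁻ θ in Ico 0 (2 * Real.pi), siegelIntegral p ε a₁ (f θ)

/-! ### The unitary representations -/

/-- `𝒫(s, ±)` is a unitary principal series (`s ∈ iℝ`) or a complementary series
(`s` real, `0 < |s| < 1`, sign `+`). -/
def IsUnitary (δ : Parity) (s : ℂ) : Prop :=
  s.re = 0 ∨ (δ = .plus ∧ s.im = 0 ∧ s.re ∈ Ioo (-1 : ℝ) 1)

/-- The measure `|x|^{-Re s} dx` (Lebesgue measure in the unitary principal series). -/
def unitaryMeasure (s : ℂ) : Measure ℝ :=
  volume.withDensity fun x => ENNReal.ofReal (|x| ^ (-s.re))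

open Classical in
/-- The function whose norm in `L²(|x|^{-Re s} dx)` is the unitary norm of `v ∈ 𝒫(s, ±)^∞`:
the function `v` of the noncompact picture itself in the unitary principal series, its Fourier
transform in the complementary series. -/
def unitaryModel (v : SmoothVectors δ s) : ℝ → ℂ :=
  if s.re = 0 then noncompact v else fourier v

/-- The unitary norm: `‖v‖² = ∫ |v(x)|² dx` in the unitary principal series,
`‖v‖² = ∫ |ξ|^{-s} |𝓕 v(ξ)|² dξ` in the complementary series. -/
def unitaryNorm (v : SmoothVectors δ s) : ℝ≥0∞ :=
  eLpNorm (unitaryModel v) 2 (unitaryMeasure s)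

/-- The Hilbert space `𝒫(s, ±)`: the completion of `𝒫(s, ±)^∞` in the unitary norm, realised as
the closure of the smooth vectors in `L²(|x|^{-Re s} dx)`. -/
abbrev HilbertVectors (δ : Parity) (s : ℂ) : Submodule ℂ (Lp ℂ 2 (unitaryMeasure s)) :=
  (Submodule.span ℂ {h : Lp ℂ 2 (unitaryMeasure s) |
    ∃ v : SmoothVectors δ s, h =ᵐ[unitaryMeasure s] unitaryModel v}).topologicalClosure

/-- The smooth vectors `w j` converge to `h ∈ 𝒫(s, ±)` in the unitary norm. -/
def ConvergesTo (w : ℕ → SmoothVectors δ s) (h : HilbertVectors δ s) : Prop :=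
  Tendsto (fun j => eLpNorm (fun x => unitaryModel (w j) x - h.1 x) 2 (unitaryMeasure s))
    atTop (𝓝 0)

/-- `f` is the function `⟨π(a n_t) τ, h⟩` for a not necessarily smooth vector `h ∈ 𝒫(-u, ±)`, that
is, the limit in `L²_loc(AN)` of the matrix coefficients of smooth vectors converging to `h`. -/
def IsCoeffAN (τ : DistVectors δ u) (h : HilbertVectors δ (-u)) (f : ℝ → ℝ → ℂ) : Prop :=
  AEStronglyMeasurable (fun x : ℝ × ℝ => f x.1 x.2) (volume.restrict (Ioi 0 ×ˢ univ)) ∧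
  ∀ w : ℕ → SmoothVectors δ (-u), ConvergesTo w h → ∀ r R T : ℝ, 0 < r →
    Tendsto (fun j => ∫⁻ x in Icc r R ×ˢ Icc (-T) T,
      ‖coeffAN τ (w j) x.1 x.2 - f x.1 x.2‖ₑ ^ 2) atTop (𝓝 0)

/-- `f` is the function `⟨π(k_θ a n_t) τ, h⟩` for a not necessarily smooth vector
`h ∈ 𝒫(-u, ±)`, that is, the limit in `L²_loc(KAN)` of the matrix coefficients of smooth vectors
converging to `h`. -/
def IsCoeffKAN (τ : DistVectors δ u) (h : HilbertVectors δ (-u)) (f : ℝ → ℝ → ℝ → ℂ) : Prop :=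
  AEStronglyMeasurable (fun x : ℝ × ℝ × ℝ => f x.1 x.2.1 x.2.2)
    (volume.restrict (Ico 0 (2 * Real.pi) ×ˢ Ioi 0 ×ˢ univ)) ∧
  ∀ w : ℕ → SmoothVectors δ (-u), ConvergesTo w h → ∀ r R T : ℝ, 0 < r →
    Tendsto (fun j => ∫⁻ x in Ico 0 (2 * Real.pi) ×ˢ Icc r R ×ˢ Icc (-T) T,
      ‖coeffKAN τ (w j) x.1 x.2.1 x.2.2 - f x.1 x.2.1 x.2.2‖ₑ ^ 2) atTop (𝓝 0)

end PrincipalSeries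

end

open MeasureTheory Filter Set
open scoped Topology ContDiff MatrixGroups FourierTransform ENNReal

noncomputable section

namespace PrincipalSeries

/-! The element `a n_t` acts on the line by an affine map, so on the Fourier side it only dilates
and twists. With `κ` running over the frequencies `freq p m`, the matrix coefficient at `a n_t` is
the sum of `b a^(-u-1) e^{2πitκ} 𝓕v(κ/a²)`. Parseval over one period in `t`, followed by the
substitution `ξ = κ/a²` in each term, turns the Siegel integral into `∫ |ξ|^(u₀-ε/2) |𝓕v(ξ)|²
W(a₁²ξ) dξ` (`HasExpansion.siegelIntegral_eq`). Here `W` is `weight`, a sum over the frequencies of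
the same sign as its argument and at most as large. The identity holds in `[0, ∞]` and `W` depends
on `τ` and `ε`, but not on the vector.

Applied to `φ`, whose coefficient is bounded, the left side is `O(a₁^ε)`. Since `W` is monotone on
each half-line and `𝓕φ` is nonzero somewhere on each of them, `W(y) = O(|y|^(ε/2))`. Inserted for a
general `v`, this growth cancels `|ξ|^(-ε/2)` and leaves `a₁^ε ∫ |ξ|^u₀ |𝓕v|²`. The cutoff in `ξ`
appears because `W` vanishes below the least frequency `1/𝔭`. This is the first statement.

For the second, the norm must be read on the Fourier side and shown to be `K`-invariant. On the
imaginary axis this is Plancherel together with the `L²` norm on the circle. In the complementary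
series the squared norm is the bilinear `pairing` of `v` with its conjugate. For real parameters in
`(0, 1)` the Fourier transform of `|ξ|^{-σ}` makes it an integral against `|x-y|^(σ-1)`, which in
angles becomes `|sin(θ-φ)|^(σ-1)`, visibly invariant under rotation. For the remaining parameters
this kernel is not locally integrable, but with the functions on the circle held fixed the pairing
is holomorphic in `-1 < Re s < 1`, so invariance extends by the identity theorem
(`pairing_comp_sub`).

With an invariant norm, the `K`-integral costs only the factor `2π`. The bounds on boxes exhausting
the group make the coefficient maps continuous into `L²_loc`, hence extendable to the completion
(`exists_limit_of_bounded`), and the inequalities pass to the limits. -/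

/-! ### The compact picture -/

/-- The restriction of a smooth vector to the unit circle, so that `x = tan θ` is the noncompact
coordinate. -/
def circ {δ : Parity} {s : ℂ} (v : SmoothVectors δ s) (θ : ℝ) : ℂ := v.1 ![Real.sin θ, Real.cos θ]

theorem sin_cos_ne_zero (θ : ℝ) : (![Real.sin θ, Real.cos θ] : Fin 2 → ℝ) ≠ 0 := by
  intro h
  have h0 : Real.sin θ = 0 := by simpa using congrFun h 0
  have h1 : Real.cos θ = 0 := by simpa using congrFun h 1
  have := Real.sin_sq_add_cos_sq θ
  simp [h0, h1] at this

theorem contDiff_circ {δ : Parity} {s : ℂ} (v : SmoothVectors δ s) : ContDiff ℝ ∞ (circ v) := by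
  rw [← contDiffOn_univ]
  refine v.2.1.comp (t := {0}ᶜ) (f := fun θ : ℝ => (![Real.sin θ, Real.cos θ] : Fin 2 → ℝ)) ?_ ?_
  · rw [contDiffOn_univ, contDiff_pi]
    intro i
    fin_cases i
    · exact Real.contDiff_sin
    · exact Real.contDiff_cos
  · intro θ _
    exact sin_cos_ne_zero θ

theorem circ_periodic {δ : Parity} {s : ℂ} (v : SmoothVectors δ s) :
    Function.Periodic (circ v) (2 * Real.pi) := fun θ => by
  simp [circ]

theorem circ_add_pi {δ : Parity} {s : ℂ} (v : SmoothVectors δ s) (θ : ℝ) :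
    circ v (θ + Real.pi) = δ.char (-1) * circ v θ := by
  have := v.2.2.2 (-1) _ (by norm_num) (sin_cos_ne_zero θ)
  simpa [circ] using this

/-- A `C¹` function on the line which is bounded by `B` together with its derivative. -/
structure IsCircleFun (f : ℝ → ℂ) (B : ℝ) : Prop where
  contDiff : ContDiff ℝ 1 f
  bound : ∀ θ, ‖f θ‖ ≤ B
  bound_deriv : ∀ θ, ‖deriv f θ‖ ≤ B

theorem IsCircleFun.nonneg {f : ℝ → ℂ} {B : ℝ} (hf : IsCircleFun f B) : 0 ≤ B :=
  (norm_nonneg _).trans (hf.bound 0)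

theorem IsCircleFun.continuous_deriv {f : ℝ → ℂ} {B : ℝ} (hf : IsCircleFun f B) :
    Continuous (deriv f) :=
  hf.contDiff.continuous_deriv le_rfl

theorem IsCircleFun.hasDerivAt {f : ℝ → ℂ} {B : ℝ} (hf : IsCircleFun f B) (θ : ℝ) :
    HasDerivAt f (deriv f θ) θ :=
  (hf.contDiff.differentiable one_ne_zero θ).hasDerivAt

theorem exists_bound_of_periodic {f : ℝ → ℂ} (hf : Continuous f) {T : ℝ} (hT : T ≠ 0)
    (hp : Function.Periodic f T) : ∃ B, ∀ θ, ‖f θ‖ ≤ B := by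
  obtain ⟨B, hB⟩ := (hp.compact_of_continuous hT hf).isBounded.exists_norm_le
  exact ⟨B, fun θ => hB _ (mem_range_self θ)⟩

theorem exists_isCircleFun {δ : Parity} {s : ℂ} (v : SmoothVectors δ s) :
    ∃ B, IsCircleFun (circ v) B := by
  have h1 : ContDiff ℝ 1 (circ v) := (contDiff_circ v).of_le (by exact_mod_cast le_top)
  have hpi : 2 * Real.pi ≠ 0 := by positivity
  obtain ⟨B₀, h0⟩ := exists_bound_of_periodic h1.continuous hpi (circ_periodic v)
  have hper : Function.Periodic (deriv (circ v)) (2 * Real.pi) := fun θ => by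
    rw [← deriv_comp_add_const]
    congr 1
    exact funext (circ_periodic v)
  obtain ⟨B₁, hB⟩ := exists_bound_of_periodic (h1.continuous_deriv le_rfl) hpi hper
  exact ⟨max B₀ B₁, h1, fun θ => (h0 θ).trans (le_max_left _ _),
    fun θ => (hB θ).trans (le_max_right _ _)⟩

/-- The function on the line of degree `-1 - s` with given restriction to the circle. -/
def lineFun (s : ℂ) (f : ℝ → ℂ) (x : ℝ) : ℂ :=
  ((1 + x ^ 2 : ℝ) : ℂ) ^ ((-1 - s) / 2) * f (Real.arctan x)

/-- The derivative of `lineFun`. -/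
def lineDer (s : ℂ) (f : ℝ → ℂ) (x : ℝ) : ℂ :=
  ((1 + x ^ 2 : ℝ) : ℂ) ^ ((-3 - s) / 2) *
    ((-1 - s) * x * f (Real.arctan x) + deriv f (Real.arctan x))

theorem one_add_sq_pos (x : ℝ) : 0 < 1 + x ^ 2 := by positivity

theorem ofReal_one_add_sq_ne_zero (x : ℝ) : ((1 + x ^ 2 : ℝ) : ℂ) ≠ 0 :=
  Complex.ofReal_ne_zero.2 (one_add_sq_pos x).ne'

theorem ofReal_one_add_sq_mem_slitPlane (x : ℝ) : ((1 + x ^ 2 : ℝ) : ℂ) ∈ Complex.slitPlane :=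
  Complex.ofReal_mem_slitPlane.2 (one_add_sq_pos x)

theorem norm_cpow_one_add_sq (x : ℝ) (z : ℂ) :
    ‖((1 + x ^ 2 : ℝ) : ℂ) ^ z‖ = (1 + x ^ 2) ^ z.re :=
  Complex.norm_cpow_eq_rpow_re_of_pos (one_add_sq_pos x) z

/-- Homogeneity with factor `√(1 + x²)`, the length of `(x, 1)`, whose direction has angle `arctan
x`. The family `lineFun s f` lets `s` vary while the function on the circle stays fixed. -/
theorem noncompact_eq_lineFun {δ : Parity} {s : ℂ} (v : SmoothVectors δ s) (x : ℝ) :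
    noncompact v x = lineFun s (circ v) x := by
  have hpos := one_add_sq_pos x
  have hs : 0 < √(1 + x ^ 2) := Real.sqrt_pos.2 hpos
  have hv := v.2.2.2 (√(1 + x ^ 2)) _ hs.ne' (sin_cos_ne_zero (Real.arctan x))
  have he : √(1 + x ^ 2) • (![Real.sin (Real.arctan x), Real.cos (Real.arctan x)] : Fin 2 → ℝ)
      = ![x, 1] := by
    rw [Real.sin_arctan, Real.cos_arctan]
    ext i
    fin_cases i
    · simp; field_simp
    · simp; field_simp
  rw [he] at hv
  unfold noncompact lineFun circ
  rw [hv]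
  congr 1
  have hc : δ.char √(1 + x ^ 2) = 1 := by
    cases δ
    · rfl
    · simp [Parity.char, hs]
  rw [hc, one_mul, abs_of_pos hs, Real.sqrt_eq_rpow,
    ← Complex.cpow_mul_ofReal_nonneg hpos.le]
  congr 1
  push_cast
  ring

theorem hasDerivAt_lineFun {f : ℝ → ℂ} {B : ℝ} (hf : IsCircleFun f B) (s : ℂ) (x : ℝ) :
    HasDerivAt (lineFun s f) (lineDer s f x) x := by
  have h1 : HasDerivAt (fun y : ℝ => ((1 + y ^ 2 : ℝ) : ℂ)) ((2 * x : ℝ) : ℂ) x := by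
    refine HasDerivAt.ofReal_comp ?_
    simpa using ((hasDerivAt_pow 2 x).const_add 1)
  have h2 : HasDerivAt (fun y : ℝ => ((1 + y ^ 2 : ℝ) : ℂ) ^ ((-1 - s) / 2))
      ((-1 - s) / 2 * ((1 + x ^ 2 : ℝ) : ℂ) ^ ((-1 - s) / 2 - 1) * ((2 * x : ℝ) : ℂ)) x := by
    have h := ((hasDerivAt_id ((1 + x ^ 2 : ℝ) : ℂ)).cpow_const (c := (-1 - s) / 2)
      (ofReal_one_add_sq_mem_slitPlane x)).comp x h1
    rw [mul_one] at h
    exact h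
  have h3 : HasDerivAt (fun y : ℝ => f (Real.arctan y))
      ((1 / (1 + x ^ 2) : ℝ) • deriv f (Real.arctan x)) x :=
    (hf.hasDerivAt _).scomp x (Real.hasDerivAt_arctan x)
  refine (h2.mul h3).congr_deriv ?_
  have e1 : (-1 - s) / 2 = (-3 - s) / 2 + 1 := by ring
  unfold lineDer
  rw [e1, add_sub_cancel_right, Complex.cpow_add _ _ (ofReal_one_add_sq_ne_zero x),
    Complex.cpow_one, ← e1, Complex.real_smul]
  have := ofReal_one_add_sq_ne_zero x
  rw [Complex.ofReal_div, Complex.ofReal_one]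
  field_simp
  push_cast
  ring

theorem continuous_cpow_one_add_sq (z : ℂ) :
    Continuous fun x : ℝ => ((1 + x ^ 2 : ℝ) : ℂ) ^ z :=
  Continuous.cpow (by fun_prop) continuous_const ofReal_one_add_sq_mem_slitPlane

theorem IsCircleFun.continuous_lineFun {f : ℝ → ℂ} {B : ℝ} (hf : IsCircleFun f B) (s : ℂ) :
    Continuous (lineFun s f) :=
  (continuous_cpow_one_add_sq _).mul (hf.contDiff.continuous.comp Real.continuous_arctan)

theorem IsCircleFun.continuous_lineDer {f : ℝ → ℂ} {B : ℝ} (hf : IsCircleFun f B) (s : ℂ) :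
    Continuous (lineDer s f) :=
  (continuous_cpow_one_add_sq _).mul
    (((continuous_const.mul Complex.continuous_ofReal).mul
      (hf.contDiff.continuous.comp Real.continuous_arctan)).add
      (hf.continuous_deriv.comp Real.continuous_arctan))

theorem deriv_noncompact {δ : Parity} {s : ℂ} (v : SmoothVectors δ s) :
    deriv (noncompact v) = lineDer s (circ v) := by
  obtain ⟨B, hB⟩ := exists_isCircleFun v
  have : noncompact v = lineFun s (circ v) := funext (noncompact_eq_lineFun v)
  rw [this]
  exact funext fun x => (hasDerivAt_lineFun hB s x).deriv

theorem norm_lineFun_le {f : ℝ → ℂ} {B : ℝ} (hf : IsCircleFun f B) (s : ℂ) (x : ℝ) :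
    ‖lineFun s f x‖ ≤ B * (1 + x ^ 2) ^ ((-1 - s.re) / 2) := by
  unfold lineFun
  rw [norm_mul, norm_cpow_one_add_sq, mul_comm]
  have : ((-1 - s) / 2).re = (-1 - s.re) / 2 := by simp
  rw [this]
  exact mul_le_mul_of_nonneg_right (hf.bound _) (by positivity)

theorem abs_le_rpow_half (x : ℝ) : |x| ≤ (1 + x ^ 2) ^ (1 / 2 : ℝ) := by
  rw [← Real.sqrt_eq_rpow]
  exact Real.abs_le_sqrt (by linarith)

/-- The exponent uses a lower bound `σ` of `Re s` so that one majorant serves a whole neighbourhood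
of parameters; the norm of `1 + s` is the only other dependence on `s`. -/
theorem norm_lineDer_le {f : ℝ → ℂ} {B : ℝ} (hf : IsCircleFun f B) {s : ℂ} {σ : ℝ}
    (hσ : σ ≤ s.re) (x : ℝ) :
    ‖lineDer s f x‖ ≤ (‖1 + s‖ + 1) * B * (1 + x ^ 2) ^ (-(2 + σ) / 2) := by
  unfold lineDer
  have hB := hf.nonneg
  have hpos := one_add_sq_pos x
  rw [norm_mul, norm_cpow_one_add_sq]
  have e : ((-3 - s) / 2).re = (-3 - s.re) / 2 := by simp
  rw [e]
  have h1 : (1 : ℝ) ≤ (1 + x ^ 2) ^ (1 / 2 : ℝ) := Real.one_le_rpow (by nlinarith) (by norm_num)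
  have h2 : ‖(-1 - s) * x * f (Real.arctan x) + deriv f (Real.arctan x)‖ ≤
      (‖1 + s‖ + 1) * B * (1 + x ^ 2) ^ (1 / 2 : ℝ) := by
    refine (norm_add_le _ _).trans ?_
    rw [norm_mul, norm_mul, Complex.norm_real, Real.norm_eq_abs,
      show (-1 - s) = -(1 + s) by ring, norm_neg]
    have h3 : ‖1 + s‖ * |x| * ‖f (Real.arctan x)‖ ≤ ‖1 + s‖ * (1 + x ^ 2) ^ (1 / 2 : ℝ) * B := by
      gcongr
      · exact abs_le_rpow_half x
      · exact hf.bound _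
    have h4 : ‖deriv f (Real.arctan x)‖ ≤ B * (1 + x ^ 2) ^ (1 / 2 : ℝ) :=
      (hf.bound_deriv _).trans (le_mul_of_one_le_right hB h1)
    linarith
  calc (1 + x ^ 2) ^ ((-3 - s.re) / 2) * ‖(-1 - s) * x * f (Real.arctan x) + deriv f
        (Real.arctan x)‖
      ≤ (1 + x ^ 2) ^ ((-3 - σ) / 2) * ((‖1 + s‖ + 1) * B * (1 + x ^ 2) ^ (1 / 2 : ℝ)) := by
        gcongr
        nlinarith
    _ = (‖1 + s‖ + 1) * B * ((1 + x ^ 2) ^ ((-3 - σ) / 2) * (1 + x ^ 2) ^ (1 / 2 : ℝ)) := by ring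
    _ = _ := by
        rw [← Real.rpow_add hpos]
        congr 2
        ring

theorem integrable_one_add_sq_rpow {r : ℝ} (hr : 1 < r) :
    Integrable fun x : ℝ => (1 + x ^ 2) ^ (-r / 2) := by
  simpa using integrable_rpow_neg_one_add_norm_sq (E := ℝ) (μ := volume) (r := r) (by simpa
        using hr)

theorem IsCircleFun.integrable_lineDer {f : ℝ → ℂ} {B : ℝ} (hf : IsCircleFun f B) {s : ℂ}
    (hs : -1 < s.re) : Integrable (lineDer s f) :=
  ((integrable_one_add_sq_rpow (r := 2 + s.re) (by linarith)).const_mul _).mono'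
    (hf.continuous_lineDer s).aestronglyMeasurable
    (Eventually.of_forall fun x => norm_lineDer_le hf le_rfl x)

theorem IsCircleFun.integrable_lineFun {f : ℝ → ℂ} {B : ℝ} (hf : IsCircleFun f B) {s : ℂ}
    (hs : 0 < s.re) : Integrable (lineFun s f) :=
  ((integrable_one_add_sq_rpow (r := 1 + s.re) (by linarith)).const_mul B).mono'
    (hf.continuous_lineFun s).aestronglyMeasurable
    (Eventually.of_forall fun x => by
      convert norm_lineFun_le hf s x using 3
      ring)

theorem tendsto_one_add_sq_rpow {r : ℝ} (hr : r < 0) :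
    Tendsto (fun x : ℝ => (1 + x ^ 2) ^ r) (cocompact ℝ) (𝓝 0) := by
  have h1 : Tendsto (fun x : ℝ => 1 + x ^ 2) (cocompact ℝ) atTop := by
    refine tendsto_atTop_add_const_left _ _ ?_
    have := (tendsto_pow_atTop (α := ℝ) two_ne_zero).comp (tendsto_norm_cocompact_atTop (E := ℝ))
    refine this.congr fun x => by simp
  have h2 := (tendsto_rpow_neg_atTop (y := -r) (by linarith)).comp h1
  simpa [Function.comp_def] using h2

theorem tendsto_lineFun {f : ℝ → ℂ} {B : ℝ} (hf : IsCircleFun f B) {s : ℂ} (hs : -1 < s.re) :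
    Tendsto (lineFun s f) (cocompact ℝ) (𝓝 0) := by
  refine squeeze_zero_norm (norm_lineFun_le hf s) ?_
  simpa using (tendsto_one_add_sq_rpow (r := (-1 - s.re) / 2) (by linarith)).const_mul B

/-- For `Re s > -1` the function tends to `0` at both ends. The vanishing mean of the derivative is
what tames the Fourier transform at low frequency. -/
theorem integral_lineDer {f : ℝ → ℂ} {B : ℝ} (hf : IsCircleFun f B) {s : ℂ} (hs : -1 < s.re) :
    ∫ x, lineDer s f x = 0 := by
  have h := tendsto_lineFun hf hs
  rw [cocompact_eq_atBot_atTop, tendsto_sup] at h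
  rw [integral_of_hasDerivAt_of_tendsto (hasDerivAt_lineFun hf s) (hf.integrable_lineDer hs) h.1
        h.2,
    sub_zero]

/-! ### The Fourier transform -/

/-- The Fourier transform of `lineFun s f`. -/
def lineFT (s : ℂ) (f : ℝ → ℂ) (ξ : ℝ) : ℂ :=
  (2 * Real.pi * Complex.I * ξ)⁻¹ * 𝓕 (lineDer s f) ξ

theorem fourier_eq_lineFT {δ : Parity} {s : ℂ} (v : SmoothVectors δ s) :
    fourier v = lineFT s (circ v) := by
  funext ξ
  rw [fourier, deriv_noncompact, lineFT]

/-- Interpolation between the bounds `|z|` and `2`. -/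
theorem norm_exp_sub_one_le (z : ℝ) {α : ℝ} (h0 : 0 ≤ α) (h1 : α ≤ 1) :
    ‖Complex.exp (z * Complex.I) - 1‖ ≤ 2 * |z| ^ (1 - α) := by
  rcases le_total |z| 1 with h | h
  · have hz : ‖Complex.exp (z * Complex.I) - 1‖ ≤ |z| := by
      rw [mul_comm]
      exact Real.norm_exp_I_mul_ofReal_sub_one_le
    refine hz.trans ?_
    have : |z| ≤ |z| ^ (1 - α) := by
      rcases (abs_nonneg z).eq_or_lt with h' | h'
      · rw [← h']; positivity
      · conv_lhs => rw [← Real.rpow_one |z|]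
        exact Real.rpow_le_rpow_of_exponent_ge h' h (by linarith)
    have := Real.rpow_nonneg (abs_nonneg z) (1 - α)
    linarith
  · have hz : ‖Complex.exp (z * Complex.I) - 1‖ ≤ 2 := by
      refine (norm_sub_le _ _).trans ?_
      rw [Complex.norm_exp_ofReal_mul_I]
      norm_num
    have : 1 ≤ |z| ^ (1 - α) := Real.one_le_rpow h (by linarith)
    linarith

/-- The constant in the estimate of the Fourier transform. -/
def ftConst (σ α : ℝ) : ℝ := 2 * ∫ x : ℝ, (1 + x ^ 2) ^ (-(1 + α + σ) / 2)

theorem ftConst_nonneg (σ α : ℝ) : 0 ≤ ftConst σ α :=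
  mul_nonneg zero_le_two (integral_nonneg fun x => by positivity)

/-- The mean being zero, the exponential may be replaced by itself minus `1`, which is
`O(|xξ|^(1-α))`. The remaining integral in `x` converges exactly because `α > -σ`. -/
theorem norm_fourier_lineDer_le {f : ℝ → ℂ} {B : ℝ} (hf : IsCircleFun f B) {s : ℂ} {σ α : ℝ}
    (hσ : σ ≤ s.re) (hσ1 : -1 < σ) (h0 : 0 ≤ α) (h1 : α ≤ 1) (hα : -σ < α) (ξ : ℝ) :
    ‖𝓕 (lineDer s f) ξ‖ ≤ (‖1 + s‖ + 1) * B * ftConst σ α * (2 * Real.pi * |ξ|) ^ (1 - α) := by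
  have hB := hf.nonneg
  have hint := hf.integrable_lineDer (s := s) (by linarith)
  have hint2 : Integrable fun x : ℝ =>
      Complex.exp (((-2 * Real.pi * x * ξ : ℝ) : ℂ) * Complex.I) • lineDer s f x := by
    refine hint.bdd_mul (c := 1) ?_ ?_
    · exact (by fun_prop : Continuous fun x : ℝ =>
        Complex.exp (((-2 * Real.pi * x * ξ : ℝ) : ℂ) * Complex.I)).aestronglyMeasurable
    · exact Eventually.of_forall fun x => (Complex.norm_exp_ofReal_mul_I _).le
  have e : 𝓕 (lineDer s f) ξ = ∫ x : ℝ,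
      (Complex.exp (((-2 * Real.pi * x * ξ : ℝ) : ℂ) * Complex.I) - 1) * lineDer s f x := by
    rw [Real.fourier_real_eq_integral_exp_smul, ← sub_zero (∫ _, _), ← integral_lineDer hf
      (s := s) (by linarith), ← integral_sub hint2 hint]
    congr 1 with x
    rw [smul_eq_mul]; ring
  rw [e]
  have hI := integrable_one_add_sq_rpow (r := 1 + α + σ) (by linarith)
  refine (norm_integral_le_of_norm_le (hI.const_mul
    (2 * (2 * Real.pi * |ξ|) ^ (1 - α) * ((‖1 + s‖ + 1) * B))) ?_).trans ?_
  · refine Eventually.of_forall fun x => ?_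
    rw [norm_mul]
    have a1 := norm_exp_sub_one_le (-2 * Real.pi * x * ξ) h0 h1
    have a2 : |-2 * Real.pi * x * ξ| = (2 * Real.pi * |ξ|) * |x| := by
      rw [abs_mul, abs_mul, abs_mul, abs_neg, abs_two, abs_of_pos Real.pi_pos]; ring
    rw [a2, Real.mul_rpow (by positivity) (abs_nonneg x)] at a1
    have a3 : |x| ^ (1 - α) ≤ (1 + x ^ 2) ^ ((1 - α) / 2) := by
      calc |x| ^ (1 - α) ≤ ((1 + x ^ 2) ^ (1 / 2 : ℝ)) ^ (1 - α) :=
            Real.rpow_le_rpow (abs_nonneg x) (abs_le_rpow_half x) (by linarith)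
        _ = _ := by rw [← Real.rpow_mul (one_add_sq_pos x).le]; congr 1; ring
    calc _ ≤ (2 * ((2 * Real.pi * |ξ|) ^ (1 - α) * (1 + x ^ 2) ^ ((1 - α) / 2))) *
          ((‖1 + s‖ + 1) * B * (1 + x ^ 2) ^ (-(2 + σ) / 2)) := by
            refine mul_le_mul (a1.trans ?_) (norm_lineDer_le hf hσ x) (norm_nonneg _) (by
                  positivity)
            gcongr
      _ = 2 * (2 * Real.pi * |ξ|) ^ (1 - α) * ((‖1 + s‖ + 1) * B) *
          ((1 + x ^ 2) ^ ((1 - α) / 2) * (1 + x ^ 2) ^ (-(2 + σ) / 2)) := by ring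
      _ = _ := by
        rw [← Real.rpow_add (one_add_sq_pos x)]
        congr 2
        ring
  · rw [integral_const_mul, ftConst]
    apply le_of_eq
    ring

/-- Used with `α = 1` for decay at infinity and with `α` slightly above `max (-σ) 0` for a mild
singularity at the origin. -/
theorem norm_lineFT_le {f : ℝ → ℂ} {B : ℝ} (hf : IsCircleFun f B) {s : ℂ} {σ α : ℝ}
    (hσ : σ ≤ s.re) (hσ1 : -1 < σ) (h0 : 0 ≤ α) (h1 : α ≤ 1) (hα : -σ < α) (ξ : ℝ) :
    ‖lineFT s f ξ‖ ≤ (‖1 + s‖ + 1) * B * ftConst σ α * |ξ| ^ (-α) := by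
  have hB := hf.nonneg
  have hc := ftConst_nonneg σ α
  -- At `ξ = 0` the value of `lineFT` is `0` by the convention for inverses.
  rcases eq_or_ne ξ 0 with rfl | hξ
  · simp [lineFT]
    positivity
  have hx : 0 < 2 * Real.pi * |ξ| := by have := abs_pos.2 hξ; positivity
  unfold lineFT
  rw [norm_mul, norm_inv]
  have e : ‖(2 * Real.pi * Complex.I * ξ : ℂ)‖ = 2 * Real.pi * |ξ| := by
    simp [abs_of_pos Real.pi_pos]
  rw [e]
  calc _ ≤ (2 * Real.pi * |ξ|)⁻¹ *
        ((‖1 + s‖ + 1) * B * ftConst σ α * (2 * Real.pi * |ξ|) ^ (1 - α)) := by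
        gcongr
        exact norm_fourier_lineDer_le hf hσ hσ1 h0 h1 hα ξ
    _ = (‖1 + s‖ + 1) * B * ftConst σ α * (2 * Real.pi * |ξ|) ^ (-α) := by
        rw [sub_eq_add_neg 1 α, Real.rpow_add hx, Real.rpow_one]
        field_simp
    -- The factor `(2π)^(-α)` is at most `1`.
    _ ≤ _ := by
        gcongr _ * ?_
        refine Real.rpow_le_rpow_of_nonpos (abs_pos.2 hξ) ?_ (by linarith)
        have := Real.pi_gt_three
        nlinarith [abs_pos.2 hξ]

theorem continuous_fourier_of_integrable {f : ℝ → ℂ} (hf : Integrable f) : Continuous (𝓕 f) :=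
  VectorFourier.fourierIntegral_continuous Real.continuous_fourierChar
    (by exact continuous_inner) hf

theorem IsCircleFun.continuousOn_lineFT {f : ℝ → ℂ} {B : ℝ} (hf : IsCircleFun f B) {s : ℂ}
    (hs : -1 < s.re) : ContinuousOn (lineFT s f) {0}ᶜ := by
  refine ContinuousOn.mul (ContinuousOn.inv₀ (by fun_prop) ?_)
    (continuous_fourier_of_integrable (hf.integrable_lineDer hs)).continuousOn
  intro ξ hξ
  simpa [Real.pi_ne_zero] using hξ

theorem IsCircleFun.measurable_lineFT {f : ℝ → ℂ} {B : ℝ} (hf : IsCircleFun f B) {s : ℂ}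
    (hs : -1 < s.re) : Measurable (lineFT s f) :=
  Measurable.mul (by fun_prop)
    (continuous_fourier_of_integrable (hf.integrable_lineDer hs)).measurable

/-! ### Matrix coefficients on `AN` -/

/-- `a n_t` sends `(x, 1)` to `a⁻¹ (a²(x+t), 1)`; homogeneity produces the power of `a`. -/
theorem noncompact_rep_AN {δ : Parity} {s : ℂ} (v : SmoothVectors δ s) {a : ℝ} (ha : 0 < a)
    (t x : ℝ) : noncompact (rep δ s (elemA a * elemN t)⁻¹ v) x =
      (a : ℂ) ^ (1 + s) * noncompact v (a ^ 2 * (x + t)) := by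
  have h1 : (![a ^ 2 * (x + t), 1] : Fin 2 → ℝ) ≠ 0 := fun h => by simpa using congrFun h 1
  have hv := v.2.2.2 a⁻¹ _ (inv_ne_zero ha.ne') h1
  have hc : δ.char a⁻¹ = 1 := by
    cases δ
    · rfl
    · simp [Parity.char, ha]
  have hp : ((|a⁻¹| : ℝ) : ℂ) ^ (-1 - s) = (a : ℂ) ^ (1 + s) := by
    rw [abs_of_pos (inv_pos.2 ha), Complex.ofReal_inv, Complex.inv_cpow _ _ (by
      rw [Complex.arg_ofReal_of_nonneg ha.le]; exact Real.pi_pos.ne), ← Complex.cpow_neg]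
    congr 1; ring
  rw [hc, one_mul, hp] at hv
  unfold noncompact
  rw [← hv]
  change v.1 (((elemA a * elemN t)⁻¹)⁻¹.1.mulVec ![x, 1]) = _
  rw [inv_inv, Matrix.SpecialLinearGroup.coe_mul]
  refine congrArg v.1 (funext fun i => ?_)
  fin_cases i
  · simp [elemA, elemN, ha.ne', Matrix.mulVec, dotProduct, Fin.sum_univ_two]
    field_simp
  · simp [elemA, elemN, ha.ne', Matrix.mulVec, dotProduct, Fin.sum_univ_two]

/-- Translation becomes a character and the dilation by `a²` divides the frequency by `a²`. The
exponent is `1 + s` from the action minus `2` from the Jacobian. The computation is made on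
derivatives, since `v` need not be integrable. -/
theorem fourier_rep_AN {δ : Parity} {s : ℂ} (v : SmoothVectors δ s) {a : ℝ} (ha : 0 < a)
    (t ξ : ℝ) : fourier (rep δ s (elemA a * elemN t)⁻¹ v) ξ =
      (a : ℂ) ^ (s - 1) * Complex.exp (2 * Real.pi * Complex.I * t * ξ) *
        fourier v (ξ / a ^ 2) := by
  have haC : (a : ℂ) ≠ 0 := Complex.ofReal_ne_zero.2 ha.ne'
  rcases eq_or_ne ξ 0 with rfl | hξ
  · simp [fourier]
  have hξC : (ξ : ℂ) ≠ 0 := Complex.ofReal_ne_zero.2 hξ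
  have hd : deriv (noncompact (rep δ s (elemA a * elemN t)⁻¹ v)) = fun x =>
      (a : ℂ) ^ (1 + s) * (a ^ 2 * deriv (noncompact v) (a ^ 2 * (x + t))) := by
    rw [funext (noncompact_rep_AN v ha t)]
    funext x
    refine HasDerivAt.deriv (HasDerivAt.const_mul _ ?_)
    have h1 : HasDerivAt (fun y : ℝ => a ^ 2 * (y + t)) (a ^ 2) x := by
      simpa using ((hasDerivAt_id x).add_const t).const_mul (a ^ 2)
    have h2 := (differentiable_noncompact v (a ^ 2 * (x + t))).hasDerivAt.scomp x h1
    simpa [Complex.real_smul, Function.comp_def] using h2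
  have hF : 𝓕 (deriv (noncompact (rep δ s (elemA a * elemN t)⁻¹ v))) ξ =
      (a : ℂ) ^ (1 + s) * (Complex.exp (2 * Real.pi * Complex.I * t * ξ) *
        𝓕 (deriv (noncompact v)) (ξ / a ^ 2)) := by
    rw [hd, Real.fourier_real_eq_integral_exp_smul, Real.fourier_real_eq_integral_exp_smul]
    set G : ℝ → ℂ := fun y => Complex.exp (((-2 * Real.pi * y * (ξ / a ^ 2) : ℝ) : ℂ) * Complex.I) •
      deriv (noncompact v) y with hG
    have e1 : ∀ x : ℝ, Complex.exp (((-2 * Real.pi * x * ξ : ℝ) : ℂ) * Complex.I) •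
        ((a : ℂ) ^ (1 + s) * (a ^ 2 * deriv (noncompact v) (a ^ 2 * (x + t)))) =
        (a : ℂ) ^ (1 + s) * (Complex.exp (2 * Real.pi * Complex.I * t * ξ) *
          ((a : ℂ) ^ 2 * G (a ^ 2 * (x + t)))) := by
      intro x
      have : Complex.exp (((-2 * Real.pi * x * ξ : ℝ) : ℂ) * Complex.I) =
          Complex.exp (2 * Real.pi * Complex.I * t * ξ) *
          Complex.exp (((-2 * Real.pi * (a ^ 2 * (x + t)) * (ξ / a ^ 2) : ℝ) : ℂ) * Complex.I) := by
        rw [← Complex.exp_add]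
        congr 1
        push_cast
        field_simp
        ring
      rw [this, hG]
      simp only [smul_eq_mul]
      ring
    simp_rw [e1]
    rw [integral_const_mul, integral_const_mul, integral_const_mul,
      integral_add_right_eq_self (fun x => G (a ^ 2 * x)) t, Measure.integral_comp_mul_left,
      abs_of_pos (by positivity), Complex.real_smul]
    have : (a : ℂ) ^ 2 * (((a ^ 2)⁻¹ : ℝ) * ∫ y, G y) = ∫ y, G y := by
      push_cast
      field_simp
    rw [this]
  unfold fourier
  rw [hF]
  have e2 : (a : ℂ) ^ (1 + s) = (a : ℂ) ^ (s - 1) * (a : ℂ) ^ 2 := by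
    rw [← Complex.cpow_natCast, ← Complex.cpow_add _ _ haC]
    congr 1
    push_cast
    ring
  rw [e2]
  push_cast
  have hpi : (Real.pi : ℂ) ≠ 0 := Complex.ofReal_ne_zero.2 Real.pi_ne_zero
  field_simp

/-! ### Parseval over one period and the substitution `ξ = κ/a²`. -/

theorem hasSum_norm_sq_of_orthonormal {E ι : Type*} [NormedAddCommGroup E]
    [InnerProductSpace ℂ E] {e : ι → E} (he : Orthonormal ℂ e) {c : ι → ℂ} {x : E}
    (hx : HasSum (fun i => c i • e i) x) : HasSum (fun i => ‖c i‖ ^ 2) (‖x‖ ^ 2) := by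
  classical
  have h1 : ∀ i, inner ℂ (e i) x = c i := fun i => by
    have h := (innerSL ℂ (e i)).hasSum hx
    refine h.unique ?_
    convert hasSum_single i ?_ using 1
    · simp [he.1 i]
    · intro j hj
      simp [he.2 hj.symm]
  have h2 := (innerSL ℂ x).hasSum hx
  have h3 := Complex.hasSum_re h2
  convert h3 using 1
  · funext i
    have : inner ℂ x (e i) = starRingEnd ℂ (c i) := by rw [← h1 i, inner_conj_symm]
    simp only [innerSL_apply_apply, inner_smul_right, this, Complex.mul_conj]
    rw [Complex.ofReal_re, Complex.normSq_eq_norm_sq]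
  · rw [innerSL_apply_apply, inner_self_eq_norm_sq_to_K]
    norm_cast

theorem enorm_toLp_sq {T : ℝ} [Fact (0 < T)] (g : C(AddCircle T, ℂ)) :
    ENNReal.ofReal (‖ContinuousMap.toLp 2 AddCircle.haarAddCircle ℂ g‖ ^ 2) =
      ∫⁻ t, ‖g t‖ₑ ^ 2 ∂(AddCircle.haarAddCircle : Measure (AddCircle T)) := by
  rw [ENNReal.ofReal_pow (norm_nonneg _), ofReal_norm, Lp.enorm_def,
    eLpNorm_congr_ae (ContinuousMap.coeFn_toLp _ _)]
  have := eLpNorm_nnreal_pow_eq_lintegral (f := g)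
    (μ := (AddCircle.haarAddCircle : Measure (AddCircle T))) (p := 2) two_ne_zero
  simpa using this

/-- Parseval's identity for an absolutely convergent Fourier series. -/
theorem lintegral_sq_of_hasSum {T : ℝ} (hT : 0 < T) {ι : Type*} (n : ι → ℤ)
    (hn : Function.Injective n) (c : ι → ℂ) (hc : Summable c) (F : ℝ → ℂ)
    (hF : ∀ t : ℝ, HasSum
      (fun i => c i * Complex.exp (2 * Real.pi * Complex.I * n i * t / T)) (F t)) :
    ∫⁻ t in Ioc 0 T, ‖F t‖ₑ ^ 2 = ENNReal.ofReal T * ∑' i, ‖c i‖ₑ ^ 2 := by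
  have : Fact (0 < T) := ⟨hT⟩
  have hsum : Summable fun i => c i • (@_root_.fourier T (n i)) := by
    refine Summable.of_norm ?_
    simpa only [norm_smul, fourier_norm, mul_one] using hc.norm
  obtain ⟨g, hg⟩ := hsum
  have hgF : ∀ t : ℝ, g t = F t := fun t => by
    refine (ContinuousMap.hasSum_apply hg (t : AddCircle T)).unique ?_
    convert hF t using 2 with i
    rw [ContinuousMap.smul_apply, fourier_coe_apply, smul_eq_mul]
  have h2 : HasSum (fun i => c i • (@fourierLp T _ 2 _ (n i)))
      (ContinuousMap.toLp 2 AddCircle.haarAddCircle ℂ g) := by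
    have := (ContinuousMap.toLp (E := ℂ) 2 (@AddCircle.haarAddCircle T _) ℂ).hasSum hg
    simpa only [map_smul] using this
  have h3 := hasSum_norm_sq_of_orthonormal (orthonormal_fourier.comp n hn) h2
  have h4 := enorm_toLp_sq g
  rw [← h3.tsum_eq, ENNReal.ofReal_tsum_of_nonneg (fun i => by positivity) h3.summable] at h4
  have h5 := AddCircle.lintegral_preimage T 0 (fun t => ‖g t‖ₑ ^ 2)
  rw [zero_add, AddCircle.volume_eq_smul_haarAddCircle, lintegral_smul_measure, ← h4] at h5
  simp only [hgF] at h5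
  rw [h5, smul_eq_mul]
  congr 2
  funext i
  rw [ENNReal.ofReal_pow (norm_nonneg _), ofReal_norm]

/-- Substitution `ξ = κ/a²`, for which `da/a = dξ/(2|ξ|)` up to orientation and `a² = |κ|/|ξ|`. As
`a` runs over `(0, a₁]`, `ξ` covers the half-line of the sign of `κ` beyond `|κ|/a₁²`. -/
theorem lintegral_comp_div_sq {a₁ : ℝ} (ha₁ : 0 < a₁) {κ : ℝ} (hκ : κ ≠ 0) (σ ε : ℝ)
    (H : ℝ → ℝ≥0∞) :
    ∫⁻ a in Ioc 0 a₁, ENNReal.ofReal (a ^ (-2 - 2 * σ)) * H (κ / a ^ 2) *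
        ENNReal.ofReal (a ^ ε / a) =
      ∫⁻ ξ in {ξ : ℝ | 0 < κ * ξ ∧ |κ| ≤ a₁ ^ 2 * |ξ|},
        ENNReal.ofReal (2⁻¹ * |κ| ^ (-1 - σ + ε / 2) * |ξ| ^ (σ - ε / 2)) * H ξ := by
  have himg : (fun a : ℝ => κ / a ^ 2) '' Ioc 0 a₁ =
      {ξ : ℝ | 0 < κ * ξ ∧ |κ| ≤ a₁ ^ 2 * |ξ|} := by
    ext ξ
    constructor
    · rintro ⟨a, ⟨h0, h1⟩, rfl⟩
      refine ⟨?_, ?_⟩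
      · have : κ * (κ / a ^ 2) = κ ^ 2 / a ^ 2 := by ring
        simp only [this]
        positivity
      · rw [abs_div, abs_of_pos (by positivity : (0:ℝ) < a ^ 2), mul_div_assoc',
          le_div_iff₀ (by positivity), mul_comm]
        gcongr
    · rintro ⟨h0, h1⟩
      have hξ : ξ ≠ 0 := by rintro rfl; simp at h0
      have hpos : 0 < κ / ξ := by
        have : κ / ξ = κ * ξ / ξ ^ 2 := by field_simp
        rw [this]
        positivity
      refine ⟨√(κ / ξ), ⟨Real.sqrt_pos.2 hpos, ?_⟩, ?_⟩
      · refine Real.sqrt_le_iff.2 ⟨ha₁.le, ?_⟩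
        rw [← abs_of_pos hpos, abs_div, div_le_iff₀ (abs_pos.2 hξ)]
        exact h1
      · simp only [Real.sq_sqrt hpos.le]
        field_simp
  have hder : ∀ a ∈ Ioc 0 a₁, HasDerivWithinAt (fun a : ℝ => κ / a ^ 2)
      (-2 * κ / a ^ 3) (Ioc 0 a₁) a := by
    intro a ha
    have h := (((hasDerivAt_pow 2 a).inv (by have := ha.1; positivity)).const_mul κ)
    refine (h.congr_deriv ?_).hasDerivWithinAt.congr (fun y _ => div_eq_mul_inv _ _)
      (div_eq_mul_inv _ _)
    have := ha.1.ne'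
    field_simp
    simp [mul_comm]
  have hinj : InjOn (fun a : ℝ => κ / a ^ 2) (Ioc 0 a₁) := by
    intro a ha b hb h
    have h1 := ha.1
    have h2 := hb.1
    have h3 : κ / a ^ 2 = κ / b ^ 2 := h
    rw [div_eq_div_iff (by positivity) (by positivity)] at h3
    have h4 : b ^ 2 = a ^ 2 := mul_left_cancel₀ hκ h3
    exact ((pow_left_inj₀ h2.le h1.le two_ne_zero).1 h4).symm
  -- After pulling back with Jacobian `2|κ|/a³`, all powers of `|κ|` cancel and only a comparison of
  -- powers of `a` remains.
  rw [← himg, lintegral_image_eq_lintegral_abs_deriv_mul measurableSet_Ioc hder hinj]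
  refine setLIntegral_congr_fun measurableSet_Ioc fun a ha => ?_
  have h0 := ha.1
  have hk := abs_pos.2 hκ
  rw [mul_right_comm, ← ENNReal.ofReal_mul (by positivity), ← mul_assoc,
    ← ENNReal.ofReal_mul (by positivity)]
  congr 2
  have e1 : |-2 * κ / a ^ 3| = 2 * |κ| * a ^ (-3 : ℝ) := by
    rw [abs_div, abs_mul, abs_of_pos (by positivity : 0 < a ^ 3), Real.rpow_neg h0.le,
      abs_neg, abs_two, div_eq_mul_inv]
    norm_cast
  have e2 : |κ / a ^ 2| = |κ| * a ^ (-2 : ℝ) := by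
    rw [abs_div, abs_of_pos (by positivity : 0 < a ^ 2), Real.rpow_neg h0.le, div_eq_mul_inv]
    norm_cast
  rw [e1, e2, Real.mul_rpow hk.le (by positivity), ← Real.rpow_mul h0.le, ← Real.rpow_sub_one
        h0.ne',
    ← Real.rpow_add h0]
  have e3 : |κ| * (|κ| ^ (-1 - σ + ε / 2) * |κ| ^ (σ - ε / 2)) = 1 := by
    rw [← Real.rpow_add hk, show -1 - σ + ε / 2 + (σ - ε / 2) = -1 by ring, Real.rpow_neg_one]
    exact mul_inv_cancel₀ hk.ne'
  calc _ = a ^ ((-3 : ℝ) + -2 * (σ - ε / 2)) := by congr 1; ring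
    _ = a ^ (-3 : ℝ) * a ^ (-2 * (σ - ε / 2)) := Real.rpow_add h0 _ _
    _ = (|κ| * (|κ| ^ (-1 - σ + ε / 2) * |κ| ^ (σ - ε / 2))) *
        (a ^ (-3 : ℝ) * a ^ (-2 * (σ - ε / 2))) := by rw [e3, one_mul]
    _ = _ := by ring

/-! ### The Siegel integral as an integral over the frequencies -/

/-- The frequency of the `m`-th term of a periodic distribution. -/
def freq (p : ℕ) (m : {m : ℤ // m ≠ 0}) : ℝ := -((m : ℤ) / (p : ℝ))

theorem freq_ne_zero {p : ℕ} (hp : 0 < p) (m : {m : ℤ // m ≠ 0}) : freq p m ≠ 0 := by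
  have h1 : ((m : ℤ) : ℝ) ≠ 0 := Int.cast_ne_zero.2 m.2
  have h2 : (p : ℝ) ≠ 0 := Nat.cast_ne_zero.2 hp.ne'
  exact neg_ne_zero.2 (div_ne_zero h1 h2)

theorem inv_le_abs_freq {p : ℕ} (hp : 0 < p) (m : {m : ℤ // m ≠ 0}) : 1 / (p : ℝ) ≤ |freq p m| := by
  have h2 : (0 : ℝ) < p := Nat.cast_pos.2 hp
  rw [freq, abs_neg, abs_div, abs_of_pos h2]
  gcongr
  exact_mod_cast Int.one_le_abs m.2

/-- `b` are the coefficients of the expansion of the periodic distribution `τ`. -/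
def HasExpansion {δ : Parity} {u : ℂ} (τ : DistVectors δ u) (p : ℕ) (b : ℤ → ℂ) : Prop :=
  ∀ v : SmoothVectors δ (-u),
    HasSum (fun m : {m : ℤ // m ≠ 0} => b m * fourier v (freq p m)) (τ.toFun v)

theorem HasExpansion.hasSum_coeffAN {δ : Parity} {u : ℂ} {τ : DistVectors δ u} {p : ℕ} {b : ℤ → ℂ}
    (hb : HasExpansion τ p b) (v : SmoothVectors δ (-u)) {a : ℝ} (ha : 0 < a) (t : ℝ) :
    HasSum (fun m : {m : ℤ // m ≠ 0} => b m * ((a : ℂ) ^ (-u - 1) *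
      Complex.exp (2 * Real.pi * Complex.I * t * freq p m) * fourier v (freq p m / a ^ 2)))
      (coeffAN τ v a t) := by
  have h := hb (rep δ (-u) (elemA a * elemN t)⁻¹ v)
  simp only [fourier_rep_AN v ha] at h
  exact h

/-- Taking `t = 0` in the expansion gives the summability of the coefficients that Parseval needs.
-/
theorem HasExpansion.lintegral_coeffAN {δ : Parity} {u : ℂ} {τ : DistVectors δ u} {p : ℕ}
    (hp : 0 < p) {b : ℤ → ℂ} (hb : HasExpansion τ p b) (v : SmoothVectors δ (-u)) {a : ℝ}
    (ha : 0 < a) :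
    ∫⁻ t in Ioc 0 (p : ℝ), ‖coeffAN τ v a t‖ₑ ^ 2 = ∑' m : {m : ℤ // m ≠ 0},
      ENNReal.ofReal p * ‖b m‖ₑ ^ 2 *
        (ENNReal.ofReal (a ^ (-2 - 2 * u.re)) * ‖fourier v (freq p m / a ^ 2)‖ₑ ^ 2) := by
  have hp' : (0 : ℝ) < p := Nat.cast_pos.2 hp
  have hpC : (p : ℂ) ≠ 0 := Nat.cast_ne_zero.2 hp.ne'
  have hsum : Summable fun m : {m : ℤ // m ≠ 0} =>
      b m * ((a : ℂ) ^ (-u - 1) * fourier v (freq p m / a ^ 2)) := by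
    simpa using (hb.hasSum_coeffAN v ha 0).summable
  rw [lintegral_sq_of_hasSum hp' (fun m : {m : ℤ // m ≠ 0} => -(m : ℤ))
    (fun m n h => Subtype.ext (neg_injective h)) _ hsum (coeffAN τ v a), ← ENNReal.tsum_mul_left]
  · refine tsum_congr fun m => ?_
    rw [enorm_mul, enorm_mul, mul_pow, mul_pow, mul_assoc]
    congr 3
    rw [← ofReal_norm, Complex.norm_cpow_eq_rpow_re_of_pos ha, ← ENNReal.ofReal_pow (by positivity),
      ← Real.rpow_natCast, ← Real.rpow_mul ha.le]
    congr 2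
    simp
    ring
  · intro t
    convert hb.hasSum_coeffAN v ha t using 2 with m
    have : (2 * Real.pi * Complex.I * ((-(m : ℤ) : ℤ) : ℂ) * t / (p : ℝ) : ℂ) =
        2 * Real.pi * Complex.I * t * freq p m := by
      rw [freq]
      push_cast
      field_simp
    rw [this]
    ring

/-- The weight with which a frequency enters the Siegel integral. -/
def weight (p : ℕ) (b : ℤ → ℂ) (σ ε y : ℝ) : ℝ≥0∞ :=
  ∑' m : {m : ℤ // m ≠ 0}, {y : ℝ | 0 < freq p m * y ∧ |freq p m| ≤ |y|}.indicator
    (fun _ => ENNReal.ofReal p * ‖b m‖ₑ ^ 2 *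
      ENNReal.ofReal (2⁻¹ * |freq p m| ^ (-1 - σ + ε / 2))) y

/-- Moving away from the origin on one half-line only admits further nonnegative terms. -/
theorem weight_mono {p : ℕ} {b : ℤ → ℂ} {σ ε y z : ℝ} (h : 0 < y * z) (hyz : |y| ≤ |z|) :
    weight p b σ ε y ≤ weight p b σ ε z := by
  refine ENNReal.tsum_le_tsum fun m => ?_
  by_cases h' : y ∈ {y : ℝ | 0 < freq p m * y ∧ |freq p m| ≤ |y|}
  swap
  · rw [indicator_of_notMem h']
    exact zero_le
  rw [indicator_of_mem h']
  obtain ⟨h1, h2⟩ := h'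
  rw [indicator_of_mem]
  refine ⟨?_, h2.trans hyz⟩
  have h3 : 0 < (freq p m * y) * (y * z) := mul_pos h1 h
  have h4 : (freq p m * y) * (y * z) = y ^ 2 * (freq p m * z) := by ring
  rw [h4] at h3
  exact pos_of_mul_pos_right h3 (sq_nonneg y)

/-- No frequency is smaller than `1/𝔭` in absolute value; this is the source of the cutoff `|ξ| ≥
1/(a₁²𝔭)`. -/
theorem weight_eq_zero {p : ℕ} (hp : 0 < p) {b : ℤ → ℂ} {σ ε y : ℝ} (h : |y| < 1 / p) :
    weight p b σ ε y = 0 := by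
  refine ENNReal.tsum_eq_zero.2 fun m => indicator_of_notMem ?_ _
  rintro ⟨-, h2⟩
  exact absurd (h2.trans_lt h) (not_lt.2 (inv_le_abs_freq hp m))

theorem measurable_fourier {δ : Parity} {s : ℂ} (hs : -1 < s.re) (v : SmoothVectors δ s) :
    Measurable (fourier v) := by
  obtain ⟨B, hB⟩ := exists_isCircleFun v
  rw [fourier_eq_lineFT]
  exact hB.measurable_lineFT hs

theorem continuousOn_fourier {δ : Parity} {s : ℂ} (hs : -1 < s.re) (v : SmoothVectors δ s) :
    ContinuousOn (fourier v) {0}ᶜ := by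
  obtain ⟨B, hB⟩ := exists_isCircleFun v
  rw [fourier_eq_lineFT]
  exact hB.continuousOn_lineFT hs

theorem measurableSet_pos_and_le (κ r c : ℝ) :
    MeasurableSet {y : ℝ | 0 < κ * y ∧ r ≤ c * |y|} := by
  have h1 : MeasurableSet {y : ℝ | 0 < κ * y} := measurableSet_lt measurable_const (by fun_prop)
  have h2 : MeasurableSet {y : ℝ | r ≤ c * |y|} := measurableSet_le measurable_const (by fun_prop)
  exact h1.inter h2

/-- The central identity. All terms are nonnegative, so sums and integrals are exchanged in `[0, ∞]`
without any convergence. It is read from left to right for an arbitrary `v`, and backwards for `φ`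
to control the weight. -/
theorem HasExpansion.siegelIntegral_eq {δ : Parity} {u : ℂ} (hu : u.re < 1)
    {τ : DistVectors δ u} {p : ℕ}
    (hp : 0 < p) {b : ℤ → ℂ} (hb : HasExpansion τ p b) (v : SmoothVectors δ (-u)) (ε : ℝ) {a₁ : ℝ}
    (ha₁ : 0 < a₁) :
    siegelIntegral p ε a₁ (coeffAN τ v) =
      ∫⁻ ξ, ENNReal.ofReal (|ξ| ^ (u.re - ε / 2)) * ‖fourier v ξ‖ₑ ^ 2 *
        weight p b u.re ε (a₁ ^ 2 * ξ) := by
  have hm : Measurable (fourier v) := measurable_fourier (by simpa using hu) v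
  have e1 : siegelIntegral p ε a₁ (coeffAN τ v) = ∫⁻ a in Ioc 0 a₁, ∑' m : {m : ℤ // m ≠ 0},
      ENNReal.ofReal p * ‖b m‖ₑ ^ 2 * (ENNReal.ofReal (a ^ (-2 - 2 * u.re)) *
        ‖fourier v (freq p m / a ^ 2)‖ₑ ^ 2 * ENNReal.ofReal (a ^ ε / a)) := by
    refine setLIntegral_congr_fun measurableSet_Ioc fun a ha => ?_
    rw [hb.lintegral_coeffAN hp v ha.1, ← ENNReal.tsum_mul_right]
    refine tsum_congr fun m => ?_
    ring
  rw [e1, lintegral_tsum fun m => Measurable.aemeasurable (by fun_prop)]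
  -- The substitution for a single frequency; its domain of integration becomes the indicator in
  -- `weight`, evaluated at `a₁²ξ`.
  have e2 : ∀ m : {m : ℤ // m ≠ 0}, ∫⁻ a in Ioc 0 a₁, ENNReal.ofReal p * ‖b m‖ₑ ^ 2 *
      (ENNReal.ofReal (a ^ (-2 - 2 * u.re)) *
        ‖fourier v (freq p m / a ^ 2)‖ₑ ^ 2 * ENNReal.ofReal (a ^ ε / a)) =
      ∫⁻ ξ, ENNReal.ofReal (|ξ| ^ (u.re - ε / 2)) * ‖fourier v ξ‖ₑ ^ 2 *
        {y : ℝ | 0 < freq p m * y ∧ |freq p m| ≤ |y|}.indicator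
        (fun _ => ENNReal.ofReal p * ‖b m‖ₑ ^ 2 *
          ENNReal.ofReal (2⁻¹ * |freq p m| ^ (-1 - u.re + ε / 2))) (a₁ ^ 2 * ξ) := by
    intro m
    rw [lintegral_const_mul _ (by fun_prop),
      lintegral_comp_div_sq ha₁ (freq_ne_zero hp m) u.re ε (fun ξ => ‖fourier v ξ‖ₑ ^ 2),
      ← lintegral_const_mul _ (by fun_prop), ← lintegral_indicator]
    · refine lintegral_congr fun ξ => ?_
      have hiff : (0 < freq p m * ξ ∧ |freq p m| ≤ a₁ ^ 2 * |ξ|) ↔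
          (0 < freq p m * (a₁ ^ 2 * ξ) ∧ |freq p m| ≤ |a₁ ^ 2 * ξ|) := by
        rw [abs_mul, abs_of_pos (by positivity : 0 < a₁ ^ 2)]
        refine and_congr_left fun _ => ?_
        rw [show freq p m * (a₁ ^ 2 * ξ) = a₁ ^ 2 * (freq p m * ξ) by ring]
        exact (mul_pos_iff_of_pos_left (by positivity)).symm
      by_cases h : 0 < freq p m * ξ ∧ |freq p m| ≤ a₁ ^ 2 * |ξ|
      · rw [indicator_of_mem (by exact h), indicator_of_mem (by exact hiff.1 h),
          ENNReal.ofReal_mul (by positivity)]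
        ring
      · rw [indicator_of_notMem (by exact h), indicator_of_notMem (by exact fun h' => h (hiff.2
            h')),
          mul_zero]
    · exact measurableSet_pos_and_le _ _ _
  simp_rw [e2]
  rw [← lintegral_tsum]
  · refine lintegral_congr fun ξ => ?_
    rw [ENNReal.tsum_mul_left, weight]
  · intro m
    refine Measurable.aemeasurable (Measurable.mul (by fun_prop) ?_)
    have hS : MeasurableSet {y : ℝ | 0 < freq p m * y ∧ |freq p m| ≤ |y|} := by
      simpa using measurableSet_pos_and_le (freq p m) |freq p m| 1
    exact (measurable_const.indicator hS).comp (by fun_prop)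

theorem lintegral_rpow_div {ε a₁ : ℝ} (hε : 0 < ε) (ha₁ : 0 < a₁) :
    ∫⁻ a in Ioc 0 a₁, ENNReal.ofReal (a ^ ε / a) = ENNReal.ofReal (a₁ ^ ε / ε) := by
  have e : ∀ a ∈ Ioc 0 a₁, ENNReal.ofReal (a ^ ε / a) = ENNReal.ofReal (a ^ (ε - 1)) := fun a ha
        => by
    rw [Real.rpow_sub_one ha.1.ne']
  rw [setLIntegral_congr_fun measurableSet_Ioc e, ← ofReal_integral_eq_lintegral_ofReal]
  · rw [← intervalIntegral.integral_of_le ha₁.le, integral_rpow (Or.inl (by linarith))]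
    simp [Real.zero_rpow hε.ne']
  · exact (intervalIntegral.intervalIntegrable_rpow' (by linarith)).1
  · exact (ae_restrict_mem measurableSet_Ioc).mono fun a ha => Real.rpow_nonneg ha.1.le _

/-- The factor `a^ε` with `ε > 0` makes `da/a` integrable at `0`. -/
theorem HasExpansion.siegelIntegral_le_of_bounded {δ : Parity} {u : ℂ} {τ : DistVectors δ u}
    {p : ℕ} {φ : SmoothVectors δ (-u)} {M : ℝ} (hM : ∀ a t : ℝ, 0 < a → ‖coeffAN τ φ a t‖ ≤ M)
    {ε a₁ : ℝ} (hε : 0 < ε) (ha₁ : 0 < a₁) :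
    siegelIntegral p ε a₁ (coeffAN τ φ) ≤ ENNReal.ofReal (p * M ^ 2 * (a₁ ^ ε / ε)) := by
  have hM0 : 0 ≤ M := (norm_nonneg _).trans (hM 1 0 one_pos)
  calc siegelIntegral p ε a₁ (coeffAN τ φ) ≤
      ∫⁻ a in Ioc 0 a₁, ENNReal.ofReal (p * M ^ 2) * ENNReal.ofReal (a ^ ε / a) := by
        refine setLIntegral_mono' measurableSet_Ioc fun a ha => ?_
        gcongr
        calc ∫⁻ t in Ioc 0 (p : ℝ), ‖coeffAN τ φ a t‖ₑ ^ 2 ≤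
            ∫⁻ t in Ioc 0 (p : ℝ), ENNReal.ofReal (M ^ 2) := by
              refine lintegral_mono fun t => ?_
              simp only
              rw [← ofReal_norm, ← ENNReal.ofReal_pow (norm_nonneg _)]
              gcongr
              exact hM a t ha.1
          _ = _ := by
              rw [setLIntegral_const, Real.volume_Ioc, sub_zero, mul_comm,
                ← ENNReal.ofReal_mul (by positivity)]
    _ = _ := by
      rw [lintegral_const_mul' _ _ ENNReal.ofReal_ne_top, lintegral_rpow_div hε ha₁,
        ← ENNReal.ofReal_mul (by positivity)]

/-- A bounded matrix coefficient controls the weight on a half-line. -/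
theorem HasExpansion.exists_weight_le_of_ne_zero {δ : Parity} {u : ℂ} (hu : u.re < 1)
    {τ : DistVectors δ u} {p : ℕ} (hp : 0 < p) {b : ℤ → ℂ} (hb : HasExpansion τ p b)
    {φ : SmoothVectors δ (-u)} {M : ℝ}
    (hM : ∀ a t : ℝ, 0 < a → ‖coeffAN τ φ a t‖ ≤ M) {ξ₀ : ℝ} (hξ₀ : ξ₀ ≠ 0)
    (hφ : fourier φ ξ₀ ≠ 0) {ε : ℝ} (hε : 0 < ε) :
    ∃ C : ℝ, 0 ≤ C ∧ ∀ y, 0 < y * ξ₀ →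
      weight p b u.re ε y ≤ ENNReal.ofReal (C * |y| ^ (ε / 2)) := by
  set h : ℝ → ℝ≥0∞ := fun ξ => ENNReal.ofReal (|ξ| ^ (u.re - ε / 2)) * ‖fourier φ ξ‖ₑ ^ 2 with hh
  have hm : Measurable (fourier φ) := measurable_fourier (by simpa using hu) φ
  have hmh : Measurable h := by fun_prop
  have hxi : 0 < |ξ₀| := abs_pos.2 hξ₀
  -- For `ξ` in `S`, `R²ξ` lies on the same half-line as `R²ξ₀/2` and farther out, so monotonicity
  -- bounds the weight below by its value at `R²ξ₀/2`. The set is open and contains `ξ₀`, so `𝓕φ`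
  -- has positive mass on it.
  set S : Set ℝ := {ξ | 0 < ξ * ξ₀ ∧ |ξ₀| / 2 < |ξ|} with hS
  have hSo : IsOpen S := by
    have h1 : IsOpen {ξ : ℝ | 0 < ξ * ξ₀} := isOpen_lt continuous_const (by fun_prop)
    have h2 : IsOpen {ξ : ℝ | |ξ₀| / 2 < |ξ|} := isOpen_lt continuous_const (by fun_prop)
    exact h1.inter h2
  have hξS : ξ₀ ∈ S := ⟨mul_self_pos.2 hξ₀, by linarith⟩
  have hc : ∫⁻ ξ in S, h ξ ≠ 0 := by
    rw [← pos_iff_ne_zero, setLIntegral_pos_iff hmh]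
    have h1 : ∀ᶠ ξ in 𝓝 ξ₀, fourier φ ξ ≠ 0 :=
      ((continuousOn_fourier (by simpa using hu) φ).continuousAt
        (isOpen_compl_singleton.mem_nhds hξ₀)).eventually_ne hφ
    have h2 : ∀ᶠ ξ in 𝓝 ξ₀, ξ ∈ Function.support h ∩ S := by
      filter_upwards [h1, hSo.mem_nhds hξS, isOpen_compl_singleton.mem_nhds hξ₀] with ξ h3 h4 h5
      refine ⟨?_, h4⟩
      have h6 : (0 : ℝ) < |ξ| := abs_pos.2 h5
      simp only [hh, Function.mem_support, ne_eq, mul_eq_zero, not_or]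
      refine ⟨?_, pow_ne_zero 2 (enorm_ne_zero.2 h3)⟩
      simpa using Real.rpow_pos_of_pos h6 _
    exact Measure.measure_pos_of_mem_nhds _ h2
  have key : ∀ R : ℝ, 0 < R → weight p b u.re ε (R ^ 2 * (ξ₀ / 2)) * ∫⁻ ξ in S, h ξ ≤
      ENNReal.ofReal (p * M ^ 2 * (R ^ ε / ε)) := by
    intro R hR
    refine le_trans ?_ (HasExpansion.siegelIntegral_le_of_bounded (p := p) hM hε hR)
    rw [hb.siegelIntegral_eq hu hp φ ε hR, ← lintegral_const_mul _ hmh]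
    refine le_trans ?_ (setLIntegral_le_lintegral S _)
    refine setLIntegral_mono' hSo.measurableSet fun ξ hξ => ?_
    rw [mul_comm]
    refine mul_le_mul' le_rfl (weight_mono ?_ ?_)
    · have : R ^ 2 * (ξ₀ / 2) * (R ^ 2 * ξ) = R ^ 4 / 2 * (ξ * ξ₀) := by ring
      rw [this]
      have := hξ.1
      positivity
    · rw [abs_mul, abs_mul, abs_div, abs_two]
      gcongr
      exact hξ.2.le
  set c := ∫⁻ ξ in S, h ξ
  refine ⟨p * M ^ 2 * (2 / |ξ₀|) ^ (ε / 2) / ε * (c⁻¹).toReal, by positivity, fun y hy => ?_⟩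
  have hy0 : 0 < |y| := abs_pos.2 (by rintro rfl; simp at hy)
  have hpos : 0 < 2 * y / ξ₀ := by
    have : 2 * y / ξ₀ = 2 * (y * ξ₀) / ξ₀ ^ 2 := by field_simp
    rw [this]
    positivity
  -- This `R` satisfies `R²ξ₀/2 = y`.
  have h1 := key (√(2 * y / ξ₀)) (Real.sqrt_pos.2 hpos)
  have e1 : √(2 * y / ξ₀) ^ 2 * (ξ₀ / 2) = y := by
    rw [Real.sq_sqrt hpos.le]
    field_simp
  have e2 : √(2 * y / ξ₀) ^ ε = (2 / |ξ₀|) ^ (ε / 2) * |y| ^ (ε / 2) := by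
    rw [Real.sqrt_eq_rpow, ← Real.rpow_mul hpos.le, ← Real.mul_rpow (by positivity) hy0.le,
      ← abs_of_pos hpos, abs_div, abs_mul, abs_two]
    congr 1
    · ring
    · ring
  rw [e1, e2] at h1
  have hcinv : c⁻¹ ≠ ⊤ := ENNReal.inv_ne_top.2 hc
  have h2 : weight p b u.re ε y ≤
      ENNReal.ofReal (p * M ^ 2 * ((2 / |ξ₀|) ^ (ε / 2) * |y| ^ (ε / 2) / ε)) * c⁻¹ := by
    -- If the mass `c` were infinite, the finite bound would force the weight to vanish; finiteness
    -- need not be proved.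
    rcases eq_or_ne c ⊤ with h3 | h3
    · rw [h3] at h1 ⊢
      have : weight p b u.re ε y = 0 := by
        by_contra h4
        rw [ENNReal.mul_top h4] at h1
        exact absurd (top_le_iff.1 h1) ENNReal.ofReal_ne_top
      rw [this]
      exact zero_le
    · rw [← div_eq_mul_inv]
      exact (ENNReal.le_div_iff_mul_le (Or.inl hc) (Or.inl h3)).2 h1
  refine h2.trans (le_of_eq ?_)
  conv_lhs => rw [← ENNReal.ofReal_toReal hcinv]
  rw [← ENNReal.ofReal_mul (by positivity)]
  congr 1
  ring

theorem HasExpansion.exists_weight_le {δ : Parity} {u : ℂ} (hu : u.re < 1)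
    {τ : DistVectors δ u} {p : ℕ} (hp : 0 < p) {b : ℤ → ℂ} (hb : HasExpansion τ p b)
    {φ : SmoothVectors δ (-u)} {M : ℝ} (hM : ∀ a t : ℝ, 0 < a → ‖coeffAN τ φ a t‖ ≤ M)
    (hpos : ∃ ξ : ℝ, 0 < ξ ∧ fourier φ ξ ≠ 0) (hneg : ∃ ξ : ℝ, ξ < 0 ∧ fourier φ ξ ≠ 0)
    {ε : ℝ} (hε : 0 < ε) :
    ∃ C : ℝ, 0 < C ∧ ∀ y, weight p b u.re ε y ≤ ENNReal.ofReal (C * |y| ^ (ε / 2)) := by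
  obtain ⟨x, hx, hx'⟩ := hpos
  obtain ⟨z, hz, hz'⟩ := hneg
  obtain ⟨C₁, h1, hC₁⟩ := hb.exists_weight_le_of_ne_zero hu hp hM hx.ne' hx' hε
  obtain ⟨C₂, h2, hC₂⟩ := hb.exists_weight_le_of_ne_zero hu hp hM hz.ne hz' hε
  -- The summand `1` only ensures that the constant is positive.
  refine ⟨C₁ + C₂ + 1, by positivity, fun y => ?_⟩
  rcases lt_trichotomy y 0 with hy | rfl | hy
  · refine (hC₂ y (mul_pos_of_neg_of_neg hy hz)).trans (ENNReal.ofReal_le_ofReal ?_)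
    gcongr
    linarith
  · rw [weight_eq_zero hp (by simpa using hp)]
    exact zero_le
  · refine (hC₁ y (mul_pos hy hx)).trans (ENNReal.ofReal_le_ofReal ?_)
    gcongr
    linarith

/-- At `a₁²ξ` the bound on the weight is `C a₁^ε |ξ|^(ε/2)`, which exactly compensates the factor
`|ξ|^(-ε/2)`. -/
theorem HasExpansion.siegelIntegral_le {δ : Parity} {u : ℂ} (hu : u.re < 1)
    {τ : DistVectors δ u} {p : ℕ} (hp : 0 < p) {b : ℤ → ℂ} (hb : HasExpansion τ p b)
    {ε C : ℝ} (hC : 0 ≤ C)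
    (hW : ∀ y, weight p b u.re ε y ≤ ENNReal.ofReal (C * |y| ^ (ε / 2)))
    (v : SmoothVectors δ (-u)) {a₁ : ℝ} (ha₁ : 0 < a₁) :
    siegelIntegral p ε a₁ (coeffAN τ v) ≤ ENNReal.ofReal (C * a₁ ^ ε) *
      ∫⁻ ξ in {ξ : ℝ | 1 / (a₁ ^ 2 * p) ≤ |ξ|},
        ENNReal.ofReal (|ξ| ^ u.re) * ‖fourier v ξ‖ₑ ^ 2 := by
  have hp' : (0 : ℝ) < p := Nat.cast_pos.2 hp
  have hS : MeasurableSet {ξ : ℝ | 1 / (a₁ ^ 2 * p) ≤ |ξ|} :=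
    measurableSet_le measurable_const (by fun_prop)
  rw [hb.siegelIntegral_eq hu hp v ε ha₁, ← lintegral_const_mul' _ _ ENNReal.ofReal_ne_top,
    ← lintegral_indicator hS]
  refine lintegral_mono fun ξ => ?_
  simp only
  by_cases hξ : 1 / (a₁ ^ 2 * p) ≤ |ξ|
  · rw [indicator_of_mem (by exact hξ)]
    have hx : 0 < |ξ| := lt_of_lt_of_le (by positivity) hξ
    calc _ ≤ ENNReal.ofReal (|ξ| ^ (u.re - ε / 2)) * ‖fourier v ξ‖ₑ ^ 2 *
          ENNReal.ofReal (C * |a₁ ^ 2 * ξ| ^ (ε / 2)) := mul_le_mul' le_rfl (hW _)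
      _ = ENNReal.ofReal (|ξ| ^ (u.re - ε / 2)) * ENNReal.ofReal (C * |a₁ ^ 2 * ξ| ^ (ε / 2)) *
          ‖fourier v ξ‖ₑ ^ 2 := by ring
      _ = ENNReal.ofReal (C * a₁ ^ ε) * ENNReal.ofReal (|ξ| ^ u.re) * ‖fourier v ξ‖ₑ ^ 2 := by
          rw [← ENNReal.ofReal_mul (by positivity), ← ENNReal.ofReal_mul (by positivity)]
          congr 2
          rw [abs_mul, abs_of_pos (by positivity : 0 < a₁ ^ 2), Real.mul_rpow (by positivity) hx.le,
            ← Real.rpow_natCast, ← Real.rpow_mul ha₁.le, Real.rpow_sub hx]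
          have : ((2 : ℕ) : ℝ) * (ε / 2) = ε := by push_cast; ring
          rw [this]
          have := (Real.rpow_pos_of_pos hx (ε / 2)).ne'
          field_simp
      _ = _ := by ring
  · rw [indicator_of_notMem (by exact hξ), weight_eq_zero hp, mul_zero]
    rw [not_le] at hξ
    rw [abs_mul, abs_of_pos (by positivity : 0 < a₁ ^ 2)]
    calc a₁ ^ 2 * |ξ| < a₁ ^ 2 * (1 / (a₁ ^ 2 * (p : ℝ))) := by gcongr
      _ = 1 / (p : ℝ) := by field_simp

theorem integrableOn_abs_rpow_ge {β r : ℝ} (hβ : β < -1) (hr : 0 < r) :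
    IntegrableOn (fun ξ : ℝ => |ξ| ^ β) {ξ | r ≤ |ξ|} := by
  have h1 : Integrable fun x : ℝ => (1 + x ^ 2) ^ (β / 2) := by
    simpa using integrable_one_add_sq_rpow (r := -β) (by linarith)
  refine (h1.const_mul (((r ^ 2)⁻¹ + 1) ^ (-β / 2))).integrableOn.mono'
    (by fun_prop : Measurable fun ξ : ℝ => |ξ| ^ β).aestronglyMeasurable ?_
  refine (ae_restrict_mem (measurableSet_le measurable_const (by fun_prop))).mono fun ξ hξ => ?_
  have hξ' : r ≤ |ξ| := hξ
  have hx : 0 < |ξ| := hr.trans_le hξ'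
  rw [Real.norm_of_nonneg (by positivity)]
  -- Away from the origin `1 + ξ²` and `ξ²` are comparable, so the global integrability of `(1 +
  -- x²)^(β/2)` can be used.
  have h2 : 1 + ξ ^ 2 ≤ ((r ^ 2)⁻¹ + 1) * ξ ^ 2 := by
    have : r ^ 2 ≤ ξ ^ 2 := by
      rw [← sq_abs ξ]
      gcongr
    have h3 : 1 ≤ (r ^ 2)⁻¹ * ξ ^ 2 := by
      rw [← div_eq_inv_mul]
      exact (one_le_div (by positivity)).2 this
    linarith
  have h3 : |ξ| ^ β = (ξ ^ 2) ^ (β / 2) := by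
    rw [← sq_abs, ← Real.rpow_natCast, ← Real.rpow_mul hx.le]
    congr 1
    push_cast
    ring
  have h4 : 0 < ξ ^ 2 := by rw [← sq_abs]; positivity
  calc |ξ| ^ β = ((r ^ 2)⁻¹ + 1) ^ (-β / 2) *
        (((r ^ 2)⁻¹ + 1) ^ (β / 2) * (ξ ^ 2) ^ (β / 2)) := by
        rw [← mul_assoc, ← Real.rpow_add (by positivity), h3]
        simp [neg_div]
    _ ≤ _ := by
        rw [← Real.mul_rpow (by positivity) h4.le]
        gcongr ?_ * ?_
        exact Real.rpow_le_rpow_of_nonpos (one_add_sq_pos ξ) h2 (by linarith)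

/-- With `𝓕v = O(|ξ|⁻¹)` the integrand is `O(|ξ|^(u₀-2))`, integrable at infinity because `u₀ < 1`.
-/
theorem lintegral_fourier_ge_lt_top {δ : Parity} {u : ℂ} (hu : u.re < 1)
    (v : SmoothVectors δ (-u)) {r : ℝ} (hr : 0 < r) :
    ∫⁻ ξ in {ξ : ℝ | r ≤ |ξ|}, ENNReal.ofReal (|ξ| ^ u.re) * ‖fourier v ξ‖ₑ ^ 2 < ⊤ := by
  obtain ⟨B, hB⟩ := exists_isCircleFun v
  have hS : MeasurableSet {ξ : ℝ | r ≤ |ξ|} := measurableSet_le measurable_const (by fun_prop)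
  set D := (‖1 + -u‖ + 1) * B * ftConst (-u.re) 1
  have hD : ∀ ξ, ‖fourier v ξ‖ ≤ D * |ξ| ^ (-1 : ℝ) := fun ξ => by
    rw [fourier_eq_lineFT]
    exact norm_lineFT_le hB (by simp) (by linarith) zero_le_one le_rfl (by linarith) ξ
  have hint := (integrableOn_abs_rpow_ge (β := u.re - 2) (by linarith) hr).const_mul (D ^ 2)
  refine lt_of_le_of_lt ?_ hint.lintegral_lt_top
  refine setLIntegral_mono' hS fun ξ hξ => ?_
  have hx : 0 < |ξ| := hr.trans_le hξ
  rw [← ofReal_norm, ← ENNReal.ofReal_pow (norm_nonneg _), ← ENNReal.ofReal_mul (by positivity)]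
  refine ENNReal.ofReal_le_ofReal ?_
  calc |ξ| ^ u.re * ‖fourier v ξ‖ ^ 2 ≤ |ξ| ^ u.re * (D * |ξ| ^ (-1 : ℝ)) ^ 2 := by
        gcongr
        exact hD ξ
    _ = D ^ 2 * (|ξ| ^ u.re * (|ξ| ^ (-1 : ℝ) * |ξ| ^ (-1 : ℝ))) := by ring
    _ = _ := by
        rw [← Real.rpow_add hx, ← Real.rpow_add hx]
        congr 2
        ring

/-! ### Plancherel's theorem -/

/-- A function in `L²` with integrable derivative has an `L²` Fourier transform, computed from
that of the derivative. -/
theorem eLpNorm_fourier_deriv {v v' : ℝ → ℂ} (hv : MemLp v 2) (hd : ∀ x, HasDerivAt v (v' x) x)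
    (hv' : Integrable v') (hb : ∃ B, ∀ x, ‖v x‖ ≤ B) :
    eLpNorm (fun ξ : ℝ => (2 * Real.pi * Complex.I * ξ)⁻¹ * 𝓕 v' ξ) 2 = eLpNorm v 2 := by
  set V : Lp ℂ 2 (volume : Measure ℝ) := hv.toLp v with hV
  set W : Lp ℂ 2 (volume : Measure ℝ) := 𝓕 V with hW
  have hvc : Continuous v := continuous_iff_continuousAt.2 fun x => (hd x).continuousAt
  have hWl : LocallyIntegrable W volume := (Lp.memLp W).locallyIntegrable (by norm_num)
  have hpol : Continuous fun ξ : ℝ => (2 * Real.pi * Complex.I * ξ : ℂ) := by fun_prop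
  -- Since `v` may fail to be integrable, its `L²` transform `W` is identified by duality. For a
  -- test function `ψ` and `χ = 2πiξψ`, `∫ ψ 𝓕v' = ∫ 𝓕ψ v' = ∫ 𝓕χ v = ∫ χ W`; the middle equality is
  -- integration by parts, for which the boundedness of `v` supplies integrability.
  have key : 𝓕 v' =ᵐ[volume] fun ξ => (2 * Real.pi * Complex.I * ξ : ℂ) * W ξ := by
    refine ae_eq_of_integral_contDiff_smul_eq
      (continuous_fourier_of_integrable hv').locallyIntegrable ?_ ?_
    · have := hWl.continuous_smul hpol
      exact this
    intro g hg hgc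
    have hgC : ContDiff ℝ ∞ fun x => ((g x : ℝ) : ℂ) := Complex.ofRealCLM.contDiff.comp hg
    have hgcC : HasCompactSupport fun x => ((g x : ℝ) : ℂ) :=
      hgc.comp_left (g := fun y : ℝ => (y : ℂ)) (by simp)
    set ψ : SchwartzMap ℝ ℂ := hgcC.toSchwartzMap hgC with hψ
    have hχC : ContDiff ℝ ∞ fun x : ℝ => (2 * Real.pi * Complex.I * x : ℂ) * ((g x : ℝ) : ℂ) :=
      ContDiff.mul (contDiff_const.mul Complex.ofRealCLM.contDiff) hgC
    have hχc : HasCompactSupport fun x : ℝ => (2 * Real.pi * Complex.I * x : ℂ) * ((g x : ℝ) : ℂ) :=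
      hgcC.mul_left
    set χ : SchwartzMap ℝ ℂ := hχc.toSchwartzMap hχC with hχ
    have hψg : ∀ x, ψ x = (g x : ℂ) := fun x => rfl
    have hχg : ∀ x, χ x = (2 * Real.pi * Complex.I * x : ℂ) * ψ x := fun x => rfl
    have hder : ∀ x, HasDerivAt (𝓕 (ψ : ℝ → ℂ)) (-𝓕 (χ : ℝ → ℂ) x) x := by
      intro x
      have hi : Integrable fun x : ℝ => x • ψ x := by
        refine Continuous.integrable_of_hasCompactSupport (by fun_prop) ?_
        exact hgcC.smul_left (f := fun x : ℝ => x)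
      refine (Real.hasDerivAt_fourier ψ.integrable hi x).congr_deriv ?_
      rw [Real.fourier_real_eq, Real.fourier_real_eq, ← integral_neg]
      congr 1 with y
      rw [hχg, ← smul_neg, smul_eq_mul]
      congr 1
      ring
    have h1 : ∫ ξ, ψ ξ * 𝓕 v' ξ = ∫ x, 𝓕 (ψ : ℝ → ℂ) x * v' x := by
      have := VectorFourier.integral_fourierIntegral_smul_eq_flip (μ := volume) (ν := volume)
        (L := innerₗ ℝ) Real.continuous_fourierChar continuous_inner ψ.integrable hv'
      rw [flip_innerₗ] at this
      exact this.symm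
    have h2 : ∫ x, 𝓕 (ψ : ℝ → ℂ) x * v' x = ∫ x, 𝓕 (χ : ℝ → ℂ) x * v x := by
      obtain ⟨B, hB⟩ := hb
      have hF : ∀ θ : SchwartzMap ℝ ℂ, 𝓕 (θ : ℝ → ℂ) = (𝓕 θ : SchwartzMap ℝ ℂ) := fun θ => rfl
      have hI : ∀ θ : SchwartzMap ℝ ℂ, Integrable (fun x => 𝓕 (θ : ℝ → ℂ) x * v x) := by
        intro θ
        rw [hF]
        exact ((𝓕 θ : SchwartzMap ℝ ℂ).integrable).mul_bdd hvc.aestronglyMeasurable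
          (Eventually.of_forall hB)
      have hI' : Integrable (fun x => 𝓕 (ψ : ℝ → ℂ) x * v' x) := by
        refine hv'.bdd_mul (c := ∫ x, ‖ψ x‖)
          (continuous_fourier_of_integrable ψ.integrable).aestronglyMeasurable
          (Eventually.of_forall fun x => ?_)
        exact VectorFourier.norm_fourierIntegral_le_integral_norm _ _ _ _ _
      have := integral_mul_deriv_eq_deriv_mul_of_integrable (fun x _ => hder x) (fun x _ => hd x)
        hI' (by simpa [neg_mul, Pi.mul_def] using (hI χ).neg) (hI ψ)
      rw [this, ← integral_neg]
      simp
    have h3 : ∫ x, 𝓕 (χ : ℝ → ℂ) x * v x = ∫ ξ, χ ξ * W ξ := by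
      have := congrArg (fun T => T χ) (Lp.fourier_toTemperedDistribution_eq V)
      simp only [TemperedDistribution.fourier_apply, Lp.toTemperedDistribution_apply,
        smul_eq_mul] at this
      rw [hW, ← this]
      refine integral_congr_ae ?_
      filter_upwards [hv.coeFn_toLp] with x hx
      rw [hV, hx]
      rfl
    have h4 : ∫ ξ, g ξ • 𝓕 v' ξ = ∫ ξ, ψ ξ * 𝓕 v' ξ := by simp [hψg, Complex.real_smul]
    rw [h4, h1, h2, h3]
    congr 1 with ξ
    rw [hχg, hψg, Complex.real_smul]
    ring
  have h5 : (fun ξ : ℝ => (2 * Real.pi * Complex.I * ξ : ℂ)⁻¹ * 𝓕 v' ξ) =ᵐ[volume] W := by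
    filter_upwards [key, (by simp [ae_iff] : ∀ᵐ ξ : ℝ, ξ ≠ 0)] with ξ h1 h2
    rw [h1]
    refine inv_mul_cancel_left₀ ?_ _
    simp [Real.pi_ne_zero, h2]
  rw [eLpNorm_congr_ae h5, ← ENNReal.toReal_eq_toReal_iff' (Lp.eLpNorm_ne_top W) hv.eLpNorm_ne_top,
    ← Lp.norm_def, hW, Lp.norm_fourier_eq, hV, Lp.norm_toLp]

theorem integrableOn_abs_rpow_lt {β : ℝ} (hβ : -1 < β) :
    IntegrableOn (fun ξ : ℝ => |ξ| ^ β) {ξ | |ξ| < 1} := by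
  have h1 : IntegrableOn (fun ξ : ℝ => |ξ| ^ β) (Ioc 0 1) := by
    refine (intervalIntegral.intervalIntegrable_rpow' (a := 0) (b := 1) hβ).1.congr_fun ?_
      measurableSet_Ioc
    intro x hx
    simp [abs_of_pos hx.1]
  have h2 : IntegrableOn (fun ξ : ℝ => |ξ| ^ β) (Ico (-1) 0) := by
    have := ((Measure.measurePreserving_neg (volume : Measure ℝ)).integrableOn_comp_preimage
      (Homeomorph.neg ℝ).measurableEmbedding).2 h1
    simpa [Function.comp_def] using this
  have h3 : IntegrableOn (fun ξ : ℝ => |ξ| ^ β) {0} := integrableOn_singleton (by simp) (by simp)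
  refine ((h1.union h2).union h3).mono_set ?_
  intro ξ hξ
  rw [mem_ofPred_eq, abs_lt] at hξ
  rcases lt_trichotomy ξ 0 with h | h | h
  · exact Or.inl (Or.inr ⟨hξ.1.le, h⟩)
  · exact Or.inr h
  · exact Or.inl (Or.inl ⟨h, hξ.2.le⟩)

/-- A function with prescribed powers of `|ξ|` at the origin and at infinity. -/
def twoPow (β γ ξ : ℝ) : ℝ := if |ξ| < 1 then |ξ| ^ β else |ξ| ^ γ

theorem integrable_twoPow {β γ : ℝ} (hβ : -1 < β) (hγ : γ < -1) : Integrable (twoPow β γ) := by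
  have hS : MeasurableSet {ξ : ℝ | |ξ| < 1} := measurableSet_lt (by fun_prop) measurable_const
  refine Integrable.piecewise (s := {ξ : ℝ | |ξ| < 1}) hS (integrableOn_abs_rpow_lt hβ) ?_
  have : {ξ : ℝ | |ξ| < 1}ᶜ = {ξ | 1 ≤ |ξ|} := by ext ξ; simp
  rw [this]
  exact integrableOn_abs_rpow_ge hγ one_pos

/-! ### Holomorphic dependence on the parameter -/

/-- An integral depending on a complex parameter is holomorphic if the integrand is, and is locally
uniformly dominated. -/
theorem differentiableOn_integral_of_dominated {α : Type*} [MeasurableSpace α] {μ : Measure α}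
    {U : Set ℂ} {F : ℂ → α → ℂ}
    (hm : ∀ s ∈ U, AEStronglyMeasurable (F s) μ)
    (hd : ∀ᵐ x ∂μ, DifferentiableOn ℂ (fun s => F s x) U)
    (hb : ∀ s₀ ∈ U, ∃ r > 0, ∃ G : α → ℝ, Integrable G μ ∧ Metric.ball s₀ r ⊆ U ∧
      ∀ᵐ x ∂μ, ∀ s ∈ Metric.ball s₀ r, ‖F s x‖ ≤ G x) :
    DifferentiableOn ℂ (fun s => ∫ x, F s x ∂μ) U := by
  intro s₀ hs₀
  obtain ⟨r, hr, G, hG, hU, hFG⟩ := hb s₀ hs₀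
  -- Room for Cauchy's estimate: `r/2 + r/3 < r`, so the derivative is bounded by `G/(r/3)` on the
  -- ball of radius `r/2`.
  have hsub : ∀ s ∈ Metric.ball s₀ (r / 2), Metric.closedBall s (r / 3) ⊆ Metric.ball s₀ r := by
    intro s hs
    refine Metric.closedBall_subset_ball' ?_
    rw [Metric.mem_ball] at hs
    linarith
  have hmem : s₀ ∈ Metric.ball s₀ r := Metric.mem_ball_self hr
  have hda : ∀ᵐ x ∂μ, ∀ s ∈ Metric.ball s₀ r, DifferentiableAt ℂ (fun s => F s x) s := by
    filter_upwards [hd] with x hx s hs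
    exact (hx.mono hU).differentiableAt (Metric.isOpen_ball.mem_nhds hs)
  refine DifferentiableAt.differentiableWithinAt ?_
  -- The derivative is a pointwise limit of difference quotients along the real increments
  -- `r/(n+2)`, each measurable.
  have hmeas : AEStronglyMeasurable (fun x => deriv (fun s => F s x) s₀) μ := by
    set t : ℕ → ℂ := fun n => ((r / (n + 2) : ℝ) : ℂ) with ht
    have htn : ∀ n, t n ≠ 0 := fun n => Complex.ofReal_ne_zero.2 (by positivity)
    have ht0 : Tendsto t atTop (𝓝[≠] 0) := by
      refine tendsto_nhdsWithin_iff.2 ⟨?_, Eventually.of_forall htn⟩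
      have h1 : Tendsto (fun n : ℕ => r / ((n : ℝ) + 2)) atTop (𝓝 0) :=
        Tendsto.const_div_atTop
          (tendsto_atTop_add_const_right _ _ tendsto_natCast_atTop_atTop) r
      have h2 := (Complex.continuous_ofReal.tendsto 0).comp h1
      simpa [ht, Function.comp_def] using h2
    refine aestronglyMeasurable_of_tendsto_ae (u := atTop)
      (f := fun n x => (t n)⁻¹ • (F (s₀ + t n) x - F s₀ x)) (fun n => ?_) ?_
    · refine AEStronglyMeasurable.const_smul ((hm _ (hU ?_)).sub (hm _ hs₀)) ((t n)⁻¹)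
      rw [Metric.mem_ball, dist_eq_norm, add_sub_cancel_left, Complex.norm_real,
        Real.norm_of_nonneg (by positivity)]
      exact div_lt_self hr (by linarith [(Nat.cast_nonneg n : (0 : ℝ) ≤ n)])
    · filter_upwards [hda] with x hx
      exact (hasDerivAt_iff_tendsto_slope_zero.1 (hx s₀ hmem).hasDerivAt).comp ht0
  refine (hasDerivAt_integral_of_dominated_loc_of_deriv_le (F := F)
    (F' := fun s x => deriv (fun s => F s x) s) (bound := fun x => G x / (r / 3))
    (s := Metric.ball s₀ (r / 2)) (Metric.ball_mem_nhds s₀ (by positivity)) ?_ ?_ hmeas ?_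
    (hG.div_const _) ?_).2.differentiableAt
  · filter_upwards [Metric.ball_mem_nhds s₀ hr] with s hs
    exact hm s (hU hs)
  · exact hG.mono' (hm s₀ hs₀) (hFG.mono fun x hx => hx s₀ hmem)
  · filter_upwards [hda, hFG] with x hx hxG s hs
    refine Complex.norm_deriv_le_of_forall_mem_sphere_norm_le (by positivity) ?_ ?_
    · refine DifferentiableOn.diffContOnCl ?_
      rw [closure_ball s (by positivity)]
      exact fun z hz => (hx z (hsub s hs hz)).differentiableWithinAt
    · exact fun z hz => hxG z (hsub s hs (Metric.sphere_subset_closedBall hz))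
  · filter_upwards [hda] with x hx s hs
    exact (hx s (Metric.ball_subset_ball (by linarith) hs)).hasDerivAt

theorem differentiable_lineDer (f : ℝ → ℂ) (x : ℝ) : Differentiable ℂ fun s => lineDer s f x := by
  unfold lineDer
  refine Differentiable.mul (fun s => ?_) (by fun_prop)
  exact DifferentiableAt.const_cpow (by fun_prop) (Or.inl (ofReal_one_add_sq_ne_zero x))

theorem IsCircleFun.differentiableOn_lineFT {f : ℝ → ℂ} {B : ℝ} (hf : IsCircleFun f B) (ξ : ℝ) :
    DifferentiableOn ℂ (fun s => lineFT s f ξ) {s : ℂ | -1 < s.re} := by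
  unfold lineFT
  refine DifferentiableOn.const_mul ?_ _
  simp only [Real.fourier_real_eq_integral_exp_smul]
  refine differentiableOn_integral_of_dominated (fun s hs => ?_) ?_ ?_
  · have h1 : Continuous fun x : ℝ =>
        Complex.exp (((-2 * Real.pi * x * ξ : ℝ) : ℂ) * Complex.I) := by fun_prop
    exact (h1.smul (hf.continuous_lineDer s)).aestronglyMeasurable
  · refine Eventually.of_forall fun x => Differentiable.differentiableOn ?_
    exact (differentiable_lineDer f x).const_mul _
  · intro s₀ hs₀
    have hs₀' : -1 < s₀.re := hs₀
    -- Half the distance to the line `Re s = -1`, so the majorant keeps a decay exponent `2 + Re s₀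
    -- - r > 1`.
    set r := (s₀.re + 1) / 2 with hr
    have hr0 : 0 < r := by rw [hr]; linarith
    have hre : ∀ s ∈ Metric.ball s₀ r, s₀.re - r ≤ s.re := by
      intro s hs
      have := (Complex.abs_re_le_norm (s - s₀)).trans_lt (mem_ball_iff_norm.1 hs)
      rw [Complex.sub_re, abs_lt] at this
      linarith [this.1]
    refine ⟨r, hr0, fun x => (‖1 + s₀‖ + r + 1) * B * (1 + x ^ 2) ^ (-(2 + (s₀.re - r)) / 2),
      (integrable_one_add_sq_rpow (by linarith)).const_mul _, fun s hs => ?_,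
      Eventually.of_forall fun x s hs => ?_⟩
    · have := hre s hs
      simp only [mem_ofPred_eq]
      linarith
    · rw [norm_smul, Complex.norm_exp_ofReal_mul_I, one_mul]
      refine (norm_lineDer_le hf (hre s hs) x).trans ?_
      have hB := hf.nonneg
      have : ‖1 + s‖ ≤ ‖1 + s₀‖ + r := by
        calc ‖1 + s‖ = ‖(1 + s₀) + (s - s₀)‖ := by congr 1; ring
          _ ≤ _ := (norm_add_le _ _).trans (by
            gcongr
            exact (mem_ball_iff_norm.1 hs).le)
      have h2 := one_add_sq_pos x
      refine mul_le_mul_of_nonneg_right (mul_le_mul_of_nonneg_right ?_ hB) (by positivity)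
      linarith

/-! ### The invariant pairing -/

/-- The integrand of the pairing of two functions on the circle. -/
def pairIntegrand (s : ℂ) (f g : ℝ → ℂ) (ξ : ℝ) : ℂ :=
  ((|ξ| : ℝ) : ℂ) ^ (-s) * (lineFT s f ξ * lineFT s g (-ξ))

/-- The pairing `∫ |ξ|^{-s} 𝓕v(ξ) 𝓕w(-ξ) dξ`. -/
def pairing (s : ℂ) (f g : ℝ → ℂ) : ℂ := ∫ ξ, pairIntegrand s f g ξ

/-- The strip of unitarity. -/
def strip : Set ℂ := {s : ℂ | -1 < s.re ∧ s.re < 1}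

/-- Near the origin both transforms are bounded with the exponent `α`, at infinity with the exponent
`1`. The bounds `σ₁ ≤ Re s ≤ σ₂` replace `Re s` by whichever endpoint is worse in each range. -/
theorem norm_pairIntegrand_le {f g : ℝ → ℂ} {B B' : ℝ} (hf : IsCircleFun f B)
    (hg : IsCircleFun g B') {s : ℂ} {σ₁ σ₂ α D : ℝ} (h1 : σ₁ ≤ s.re) (h2 : s.re ≤ σ₂)
    (hσ : -1 < σ₁) (hα0 : 0 ≤ α) (hα1 : α ≤ 1) (hα : -σ₁ < α) (hD : ‖1 + s‖ + 1 ≤ D) {ξ : ℝ}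
    (hξ : ξ ≠ 0) :
    ‖pairIntegrand s f g ξ‖ ≤ D ^ 2 * B * B' * (ftConst σ₁ α ^ 2 + ftConst σ₁ 1 ^ 2) *
      twoPow (-σ₂ - 2 * α) (-σ₁ - 2) ξ := by
  have hx : 0 < |ξ| := abs_pos.2 hξ
  have hB := hf.nonneg
  have hB' := hg.nonneg
  have hD0 : 0 ≤ D := le_trans (by positivity) hD
  have hnorm : ‖pairIntegrand s f g ξ‖ = |ξ| ^ (-s.re) * (‖lineFT s f ξ‖ * ‖lineFT s g (-ξ)‖) := by
    rw [pairIntegrand, norm_mul, norm_mul, Complex.norm_cpow_eq_rpow_re_of_pos hx, Complex.neg_re]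
  have hgen : ∀ γ : ℝ, 0 ≤ γ → γ ≤ 1 → -σ₁ < γ →
      ‖lineFT s f ξ‖ * ‖lineFT s g (-ξ)‖ ≤
        D ^ 2 * B * B' * ftConst σ₁ γ ^ 2 * |ξ| ^ (-(2 * γ)) := by
    intro γ h3 h4 h5
    have hc := ftConst_nonneg σ₁ γ
    have e1 := norm_lineFT_le hf h1 hσ h3 h4 h5 ξ
    have e2 := norm_lineFT_le hg h1 hσ h3 h4 h5 (-ξ)
    rw [abs_neg] at e2
    calc _ ≤ (D * B * ftConst σ₁ γ * |ξ| ^ (-γ)) * (D * B' * ftConst σ₁ γ * |ξ| ^ (-γ)) := by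
          refine mul_le_mul (e1.trans ?_) (e2.trans ?_) (norm_nonneg _) (by positivity)
          · gcongr
          · gcongr
      _ = D ^ 2 * B * B' * ftConst σ₁ γ ^ 2 * (|ξ| ^ (-γ) * |ξ| ^ (-γ)) := by ring
      _ = _ := by
          rw [← Real.rpow_add hx]
          congr 2
          ring
  rw [hnorm, twoPow]
  split_ifs with hlt
  · have e := hgen α hα0 hα1 hα
    calc _ ≤ |ξ| ^ (-σ₂) * (D ^ 2 * B * B' * ftConst σ₁ α ^ 2 * |ξ| ^ (-(2 * α))) := by
          refine mul_le_mul ?_ e (by positivity) (by positivity)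
          exact Real.rpow_le_rpow_of_exponent_ge hx hlt.le (by linarith)
      _ = D ^ 2 * B * B' * ftConst σ₁ α ^ 2 * (|ξ| ^ (-σ₂) * |ξ| ^ (-(2 * α))) := by ring
      _ ≤ _ := by
          rw [← Real.rpow_add hx, ← sub_eq_add_neg]
          gcongr
          exact le_add_of_nonneg_right (sq_nonneg _)
  · have e := hgen 1 zero_le_one le_rfl (by linarith)
    calc _ ≤ |ξ| ^ (-σ₁) * (D ^ 2 * B * B' * ftConst σ₁ 1 ^ 2 * |ξ| ^ (-(2 * 1) : ℝ)) := by
          refine mul_le_mul ?_ e (by positivity) (by positivity)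
          exact Real.rpow_le_rpow_of_exponent_le (not_lt.1 hlt) (by linarith)
      _ = D ^ 2 * B * B' * ftConst σ₁ 1 ^ 2 * (|ξ| ^ (-σ₁) * |ξ| ^ (-(2 * 1) : ℝ)) := by ring
      _ ≤ _ := by
          rw [← Real.rpow_add hx, ← sub_eq_add_neg, mul_one]
          gcongr
          exact le_add_of_nonneg_left (sq_nonneg _)

theorem exists_dominating_pairIntegrand {f g : ℝ → ℂ} {B B' : ℝ} (hf : IsCircleFun f B)
    (hg : IsCircleFun g B') {s₀ : ℂ} (hs₀ : s₀ ∈ strip) :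
    ∃ r > 0, ∃ G : ℝ → ℝ, Integrable G ∧ Metric.ball s₀ r ⊆ strip ∧
      ∀ᵐ ξ, ∀ s ∈ Metric.ball s₀ r, ‖pairIntegrand s f g ξ‖ ≤ G ξ := by
  have habs : |s₀.re| < 1 := abs_lt.2 hs₀
  -- With `α = max (-Re s₀) 0 + 2η`, the singularity at the origin has order at most `|Re s₀| + 5η <
  -- 1`.
  set η := (1 - |s₀.re|) / 6 with hη
  have hη0 : 0 < η := by rw [hη]; linarith
  have hre : ∀ s ∈ Metric.ball s₀ η, s₀.re - η ≤ s.re ∧ s.re ≤ s₀.re + η := by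
    intro s hs
    have := (Complex.abs_re_le_norm (s - s₀)).trans_lt (mem_ball_iff_norm.1 hs)
    rw [Complex.sub_re, abs_lt] at this
    constructor <;> linarith [this.1, this.2]
  have hle1 := le_abs_self s₀.re
  have hle2 := neg_le_abs s₀.re
  set α := max (-s₀.re) 0 + 2 * η with hα
  have hm1 : -s₀.re ≤ max (-s₀.re) 0 := le_max_left _ _
  have hm0 : 0 ≤ max (-s₀.re) 0 := le_max_right _ _
  have hm2 : max (-s₀.re) 0 ≤ |s₀.re| := max_le hle2 (abs_nonneg _)
  have hm3 : s₀.re + 2 * max (-s₀.re) 0 ≤ |s₀.re| := by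
    rcases le_total (-s₀.re) 0 with h | h
    · rw [max_eq_right h]; linarith
    · rw [max_eq_left h]; linarith
  refine ⟨η, hη0, fun ξ => (‖1 + s₀‖ + η + 1) ^ 2 * B * B' *
    (ftConst (s₀.re - η) α ^ 2 + ftConst (s₀.re - η) 1 ^ 2) *
      twoPow (-(s₀.re + η) - 2 * α) (-(s₀.re - η) - 2) ξ,
    (integrable_twoPow (by linarith) (by linarith)).const_mul _, fun s hs => ?_, ?_⟩
  · have := hre s hs
    constructor <;> linarith [this.1, this.2]
  · filter_upwards [(by simp [ae_iff] : ∀ᵐ ξ : ℝ, ξ ≠ 0)] with ξ hξ s hs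
    refine norm_pairIntegrand_le hf hg (hre s hs).1 (hre s hs).2 (by linarith) (by linarith)
      (by linarith) (by linarith) ?_ hξ
    have : ‖1 + s‖ ≤ ‖1 + s₀‖ + η := by
      calc ‖1 + s‖ = ‖(1 + s₀) + (s - s₀)‖ := by congr 1; ring
        _ ≤ _ := (norm_add_le _ _).trans (by
          gcongr
          exact (mem_ball_iff_norm.1 hs).le)
    linarith

theorem measurable_pairIntegrand {f g : ℝ → ℂ} {B B' : ℝ} (hf : IsCircleFun f B)
    (hg : IsCircleFun g B') {s : ℂ} (hs : s ∈ strip) : Measurable (pairIntegrand s f g) := by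
  have h1 := hf.measurable_lineFT hs.1
  have h2 := hg.measurable_lineFT hs.1
  unfold pairIntegrand
  fun_prop

theorem integrable_pairIntegrand {f g : ℝ → ℂ} {B B' : ℝ} (hf : IsCircleFun f B)
    (hg : IsCircleFun g B') {s : ℂ} (hs : s ∈ strip) : Integrable (pairIntegrand s f g) := by
  obtain ⟨r, hr, G, hG, -, h⟩ := exists_dominating_pairIntegrand hf hg hs
  exact hG.mono' (measurable_pairIntegrand hf hg hs).aestronglyMeasurable
    (h.mono fun ξ hξ => hξ s (Metric.mem_ball_self hr))

/-- Holomorphy is the reason for taking the pairing bilinear rather than sesquilinear, and for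
keeping the functions on the circle fixed as `s` varies. -/
theorem differentiableOn_pairing {f g : ℝ → ℂ} {B B' : ℝ} (hf : IsCircleFun f B)
    (hg : IsCircleFun g B') : DifferentiableOn ℂ (fun s => pairing s f g) strip := by
  refine differentiableOn_integral_of_dominated
    (fun s hs => (measurable_pairIntegrand hf hg hs).aestronglyMeasurable) ?_
    (fun s₀ hs₀ => exists_dominating_pairIntegrand hf hg hs₀)
  filter_upwards [(by simp [ae_iff] : ∀ᵐ ξ : ℝ, ξ ≠ 0)] with ξ hξ
  have hsub : strip ⊆ {s : ℂ | -1 < s.re} := fun s hs => hs.1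
  refine DifferentiableOn.mul (fun s _ => ?_) (((hf.differentiableOn_lineFT ξ).mono hsub).mul
    ((hg.differentiableOn_lineFT (-ξ)).mono hsub))
  have hx : ((|ξ| : ℝ) : ℂ) ≠ 0 := Complex.ofReal_ne_zero.2 (abs_pos.2 hξ).ne'
  exact (DifferentiableAt.const_cpow (by fun_prop) (Or.inl hx)).differentiableWithinAt

theorem isOpen_strip : IsOpen strip :=
  (isOpen_lt continuous_const Complex.continuous_re).inter
    (isOpen_lt Complex.continuous_re continuous_const)

theorem isPreconnected_strip : IsPreconnected strip := by
  refine Convex.isPreconnected ?_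
  exact (convex_halfSpace_re_gt (-1)).inter (convex_halfSpace_re_lt 1)

/-- Two pairings that agree for real parameters in `(0, 1)` agree on the whole strip. -/
theorem pairing_eq_of_eq {f g f' g' : ℝ → ℂ} {B₁ B₂ B₃ B₄ : ℝ} (hf : IsCircleFun f B₁)
    (hg : IsCircleFun g B₂) (hf' : IsCircleFun f' B₃) (hg' : IsCircleFun g' B₄)
    (h : ∀ σ : ℝ, 0 < σ → σ < 1 → pairing σ f g = pairing σ f' g') {s : ℂ} (hs : s ∈ strip) :
    pairing s f g = pairing s f' g' := by
  have hz : ((1 / 2 : ℝ) : ℂ) ∈ strip := by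
    constructor <;> simp <;> norm_num
  refine ((differentiableOn_pairing hf hg).analyticOnNhd
        isOpen_strip).eqOn_of_preconnected_of_frequently_eq
    ((differentiableOn_pairing hf' hg').analyticOnNhd isOpen_strip) isPreconnected_strip hz ?_ hs
  have ht : Tendsto (fun x : ℝ => (x : ℂ)) (𝓝[≠] (1 / 2)) (𝓝[≠] ((1 / 2 : ℝ) : ℂ)) :=
    tendsto_nhdsWithin_iff.2 ⟨(Complex.continuous_ofReal.tendsto _).mono_left nhdsWithin_le_nhds,
      eventually_nhdsWithin_of_forall fun x hx h =>
        hx (Complex.ofReal_injective h)⟩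
  refine ht.frequently (Eventually.frequently ?_)
  have h1 : Ioo (0 : ℝ) 1 ∈ 𝓝 (1 / 2 : ℝ) := Ioo_mem_nhds (by norm_num) (by norm_num)
  filter_upwards [mem_nhdsWithin_of_mem_nhds h1] with σ hσ
  exact h σ hσ.1 hσ.2

/-! ### The Fourier transform of `|x|^{σ - 1}` -/

/-- Euler's integral after `t ↦ 1/t`. -/
theorem integral_rpow_mul_exp_div {a r : ℝ} (ha : 0 < a) (hr : 0 < r) :
    ∫ t in Ioi (0 : ℝ), t ^ (-a - 1) * Real.exp (-(r / t)) = (1 / r) ^ a * Real.Gamma a := by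
  rw [← Real.integral_rpow_mul_exp_neg_mul_Ioi ha hr,
    ← integral_comp_rpow_Ioi (fun t : ℝ => t ^ (a - 1) * Real.exp (-(r * t)))
      (p := -1) (by norm_num)]
  refine setIntegral_congr_fun measurableSet_Ioi fun t ht => ?_
  have ht' : (0 : ℝ) < t := ht
  simp only [smul_eq_mul, abs_neg, abs_one, one_mul]
  rw [← Real.rpow_mul ht'.le, ← mul_assoc, ← Real.rpow_add ht', Real.rpow_neg_one, div_eq_mul_inv]
  congr 2
  ring

/-- A nonintegrable function has integral `0` by convention, so the positive value of the Gamma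
integral already proves integrability. -/
theorem integrableOn_rpow_mul_exp {a r : ℝ} (ha : 0 < a) (hr : 0 < r) :
    IntegrableOn (fun t : ℝ => t ^ (a - 1) * Real.exp (-(r * t))) (Ioi 0) := by
  refine Integrable.of_integral_ne_zero ?_
  rw [Real.integral_rpow_mul_exp_neg_mul_Ioi ha hr]
  have := Real.Gamma_pos_of_pos ha
  positivity

theorem integrableOn_rpow_mul_exp_div {a r : ℝ} (ha : 0 < a) (hr : 0 < r) :
    IntegrableOn (fun t : ℝ => t ^ (-a - 1) * Real.exp (-(r / t))) (Ioi 0) := by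
  refine Integrable.of_integral_ne_zero ?_
  rw [integral_rpow_mul_exp_div ha hr]
  have := Real.Gamma_pos_of_pos ha
  positivity

/-- Fubini for a positive kernel `k(t, x)` with `∫ k(t, x) dt = c |x|^β`. -/
theorem integral_integral_kernel {k : ℝ → ℝ → ℝ} {c β : ℝ} {H : ℝ → ℂ}
    (hkm : Measurable (Function.uncurry k)) (hk0 : ∀ t ∈ Ioi (0 : ℝ), ∀ x, 0 ≤ k t x)
    (hki : ∀ x, x ≠ 0 → IntegrableOn (fun t => k t x) (Ioi 0))
    (hk : ∀ x, x ≠ 0 → ∫ t in Ioi (0 : ℝ), k t x = c * |x| ^ β)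
    (hH : AEStronglyMeasurable H) (hHi : Integrable fun x => ((|x| ^ β : ℝ) : ℂ) * H x) :
    ∫ t in Ioi (0 : ℝ), ∫ x, (k t x : ℂ) * H x = c * ∫ x, ((|x| ^ β : ℝ) : ℂ) * H x := by
  have hne : ∀ᵐ x : ℝ, x ≠ 0 := by simp [ae_iff]
  have hmeas : AEStronglyMeasurable (fun q : ℝ × ℝ => (k q.1 q.2 : ℂ) * H q.2)
      ((volume.restrict (Ioi 0)).prod volume) :=
    (Complex.measurable_ofReal.comp hkm).aestronglyMeasurable.mul hH.comp_snd
  have hint : Integrable (fun q : ℝ × ℝ => (k q.1 q.2 : ℂ) * H q.2)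
      ((volume.restrict (Ioi 0)).prod volume) := by
    rw [integrable_prod_iff' hmeas]
    refine ⟨hne.mono fun x hx => ?_, ?_⟩
    · exact ((hki x hx).ofReal (𝕜 := ℂ)).mul_const (H x)
    refine (hHi.norm.const_mul c).congr (hne.mono fun x hx => ?_)
    simp only [norm_mul, Complex.norm_real]
    rw [integral_mul_const, Real.norm_of_nonneg (by positivity : 0 ≤ |x| ^ β), ← mul_assoc, ← hk
          x hx]
    congr 1
    refine setIntegral_congr_fun measurableSet_Ioi fun t ht => ?_
    exact (Real.norm_of_nonneg (hk0 t ht x)).symm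
  rw [integral_integral_swap hint, ← integral_const_mul]
  refine integral_congr_ae (hne.mono fun x hx => ?_)
  simp only
  rw [integral_mul_const, integral_complex_ofReal, hk x hx]
  push_cast
  ring

/-- The constant in the Gaussian superposition of `|x|^{-σ}`. -/
def gaussConst (σ : ℝ) : ℝ := (1 / Real.pi) ^ (σ / 2) * Real.Gamma (σ / 2)

theorem gaussConst_pos {σ : ℝ} (hσ : 0 < σ) : 0 < gaussConst σ := by
  have := Real.Gamma_pos_of_pos (half_pos hσ)
  have := Real.pi_pos
  unfold gaussConst
  positivity

theorem one_div_pi_mul_sq_rpow {x : ℝ} (hx : x ≠ 0) (σ : ℝ) :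
    (1 / (Real.pi * x ^ 2)) ^ (σ / 2) = (1 / Real.pi) ^ (σ / 2) * |x| ^ (-σ) := by
  have hpi := Real.pi_pos
  have hx' := abs_pos.2 hx
  have : 1 / (Real.pi * x ^ 2) = 1 / Real.pi * |x| ^ (-2 : ℝ) := by
    rw [Real.rpow_neg hx'.le]
    norm_cast
    rw [sq_abs]
    field_simp
  rw [this, Real.mul_rpow (by positivity) (by positivity), ← Real.rpow_mul hx'.le]
  congr 2
  ring

/-- The Fourier transform of `|ξ|^{-σ}` is a multiple of `|x|^{σ - 1}`. -/
theorem integral_abs_rpow_mul_fourier {σ : ℝ} (h0 : 0 < σ) (h1 : σ < 1) {h : ℝ → ℂ}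
    (hh : Integrable h) (hF : Integrable fun ξ => ((|ξ| ^ (-σ) : ℝ) : ℂ) * 𝓕 h ξ)
    (hR : Integrable fun x => ((|x| ^ (σ - 1) : ℝ) : ℂ) * h x) :
    gaussConst σ * ∫ ξ, ((|ξ| ^ (-σ) : ℝ) : ℂ) * 𝓕 h ξ =
      gaussConst (1 - σ) * ∫ x, ((|x| ^ (σ - 1) : ℝ) : ℂ) * h x := by
  have hpi := Real.pi_pos
  have hsq : ∀ x : ℝ, x ≠ 0 → 0 < Real.pi * x ^ 2 := fun x hx => by positivity
  -- Both powers are superpositions of Gaussians: `|ξ|^{-σ}` of `e^{-πtξ²}` and, in `e2`,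
  -- `|x|^(σ-1)` of `e^{-πx²/t}`. For fixed `t` the Fourier transform exchanges the two families up
  -- to `t^(-1/2)`, and this factor accounts for the difference between the powers of `t`.
  have e1 := integral_integral_kernel (c := gaussConst σ)
    (k := fun t ξ => t ^ (σ / 2 - 1) * Real.exp (-(Real.pi * ξ ^ 2 * t)))
    (by unfold Function.uncurry; fun_prop) (fun t ht ξ => by have : 0 < t := ht; positivity)
    (fun ξ hξ => integrableOn_rpow_mul_exp (half_pos h0) (hsq ξ hξ))
    (fun ξ hξ => by
      rw [Real.integral_rpow_mul_exp_neg_mul_Ioi (half_pos h0) (hsq ξ hξ),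
        one_div_pi_mul_sq_rpow hξ, gaussConst]
      ring)
    (continuous_fourier_of_integrable hh).aestronglyMeasurable hF
  have e2 := integral_integral_kernel (c := gaussConst (1 - σ))
    (k := fun t x => t ^ (-((1 - σ) / 2) - 1) * Real.exp (-(Real.pi * x ^ 2 / t))) (β := σ - 1)
    (by unfold Function.uncurry; fun_prop) (fun t ht ξ => by have : 0 < t := ht; positivity)
    (fun x hx => integrableOn_rpow_mul_exp_div (by linarith) (hsq x hx))
    (fun x hx => by
      rw [integral_rpow_mul_exp_div (by linarith) (hsq x hx),
        one_div_pi_mul_sq_rpow hx, gaussConst, neg_sub]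
      ring)
    hh.aestronglyMeasurable hR
  rw [← e1, ← e2]
  refine setIntegral_congr_fun measurableSet_Ioi fun t ht => ?_
  have ht' : 0 < t := ht
  have htC : (t : ℂ) ≠ 0 := Complex.ofReal_ne_zero.2 ht'.ne'
  have hgi : Integrable fun ξ : ℝ => Complex.exp (-Real.pi * t * ξ ^ 2) := by
    have := integrable_cexp_neg_mul_sq (b := Real.pi * t) (by
      rw [← Complex.ofReal_mul, Complex.ofReal_re]; positivity)
    simpa [neg_mul] using this
  have hflip := VectorFourier.integral_fourierIntegral_smul_eq_flip (μ := volume) (ν := volume)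
    (L := innerₗ ℝ) Real.continuous_fourierChar continuous_inner hgi hh
  rw [flip_innerₗ] at hflip
  change ∫ x, 𝓕 (fun ξ : ℝ => Complex.exp (-Real.pi * t * ξ ^ 2)) x • h x =
    ∫ ξ : ℝ, Complex.exp (-Real.pi * t * ξ ^ 2) • 𝓕 h ξ at hflip
  rw [fourier_gaussian_pi (by simpa using ht')] at hflip
  have l1 : ∫ ξ : ℝ, ((t ^ (σ / 2 - 1) * Real.exp (-(Real.pi * ξ ^ 2 * t)) : ℝ) : ℂ) * 𝓕 h ξ =
      (t : ℂ) ^ ((σ / 2 - 1 : ℝ) : ℂ) *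
        ∫ ξ : ℝ, Complex.exp (-Real.pi * t * ξ ^ 2) • 𝓕 h ξ := by
    rw [← integral_const_mul]
    congr 1 with ξ
    rw [Complex.ofReal_mul, Complex.ofReal_cpow ht'.le, Complex.ofReal_exp, smul_eq_mul, mul_assoc]
    congr 3
    push_cast
    ring
  have l2 : ∫ x : ℝ, ((t ^ (-((1 - σ) / 2) - 1) * Real.exp (-(Real.pi * x ^ 2 / t)) : ℝ) : ℂ) *
        h x =
      (t : ℂ) ^ ((σ / 2 - 1 : ℝ) : ℂ) *
        ∫ x : ℝ, (1 / (t : ℂ) ^ (1 / 2 : ℂ) * Complex.exp (-Real.pi / t * x ^ 2)) • h x := by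
    rw [← integral_const_mul]
    congr 1 with x
    rw [Complex.ofReal_mul, Complex.ofReal_cpow ht'.le, Complex.ofReal_exp, smul_eq_mul,
      ← mul_assoc, ← mul_assoc, mul_one_div, ← Complex.cpow_sub _ _ htC]
    congr 3
    · push_cast
      ring
    · push_cast
      ring
  rw [l1, l2, ← hflip]

/-! ### The pairing on the circle -/

theorem lineFT_eq_fourier {f : ℝ → ℂ} {B : ℝ} (hf : IsCircleFun f B) {s : ℂ} (hs : 0 < s.re)
    {ξ : ℝ} (hξ : ξ ≠ 0) : lineFT s f ξ = 𝓕 (lineFun s f) ξ := by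
  have hd : deriv (lineFun s f) = lineDer s f := funext fun x => (hasDerivAt_lineFun hf s x).deriv
  unfold lineFT
  rw [← hd, Real.fourier_deriv (hf.integrable_lineFun hs)
    (fun x => (hasDerivAt_lineFun hf s x).differentiableAt)
    (by rw [hd]; exact hf.integrable_lineDer (by linarith))]
  refine inv_mul_cancel_left₀ ?_ _
  simp [Real.pi_ne_zero, hξ]

/-- For `|q.1| < 1` the power is integrable and `v` is bounded; elsewhere the power is at most `1`
and the convolution integrand of two integrable functions remains. -/
theorem integrable_kernel_mul {v w : ℝ → ℂ} (hv : Integrable v) {B : ℝ}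
    (hB : ∀ x, ‖v x‖ ≤ B) (hw : Integrable w) {β : ℝ} (hβ : -1 < β) (hβ0 : β ≤ 0) :
    Integrable (fun q : ℝ × ℝ => ((|q.1| ^ β : ℝ) : ℂ) * (w q.2 * v (q.1 - q.2)))
      (volume.prod volume) := by
  have hS : MeasurableSet {x : ℝ | |x| < 1} := measurableSet_lt (by fun_prop) measurable_const
  have h1 : Integrable ({x : ℝ | |x| < 1}.indicator fun x => |x| ^ β) :=
    (integrable_indicator_iff hS).2 (integrableOn_abs_rpow_lt hβ)
  have h2 := (h1.mul_prod hw.norm).const_mul B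
  have h3 := (hw.convolution_integrand (ContinuousLinearMap.mul ℂ ℂ) hv)
  have hm : Measurable fun q : ℝ × ℝ => ((|q.1| ^ β : ℝ) : ℂ) := by fun_prop
  refine (h2.add h3.norm).mono' (hm.aestronglyMeasurable.mul h3.aestronglyMeasurable)
    (Eventually.of_forall fun q => ?_)
  simp only [Pi.add_apply, ContinuousLinearMap.mul_apply', norm_mul, Complex.norm_real]
  rw [Real.norm_of_nonneg (by positivity : 0 ≤ |q.1| ^ β)]
  by_cases hq : |q.1| < 1
  · rw [indicator_of_mem (by exact hq)]
    calc |q.1| ^ β * (‖w q.2‖ * ‖v (q.1 - q.2)‖) ≤ |q.1| ^ β * (‖w q.2‖ * B) := by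
          gcongr
          exact hB _
      _ = B * (|q.1| ^ β * ‖w q.2‖) := by ring
      _ ≤ _ := le_add_of_nonneg_right (by positivity)
  · rw [indicator_of_notMem (by exact hq), zero_mul, mul_zero, zero_add]
    refine mul_le_of_le_one_left (by positivity) ?_
    exact Real.rpow_le_one_of_one_le_of_nonpos (not_lt.1 hq) hβ0

/-- The product `𝓕v(ξ) 𝓕w(-ξ)` is the transform of the convolution `h` of `v` with the reflection of
`w`. Transferring `|ξ|^{-σ}` to `|z|^(σ-1)` and unfolding `h` gives a double integral in `x - y`. -/
theorem pairing_eq_integral {f g : ℝ → ℂ} {B B' : ℝ} (hf : IsCircleFun f B)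
    (hg : IsCircleFun g B') {σ : ℝ} (h0 : 0 < σ) (h1 : σ < 1) :
    gaussConst σ * pairing σ f g = gaussConst (1 - σ) *
      ∫ y, lineFun σ g y * ∫ x, ((|x - y| ^ (σ - 1) : ℝ) : ℂ) * lineFun σ f x := by
  set v := lineFun σ f with hv
  set w := lineFun σ g with hw
  have hσ : 0 < (σ : ℂ).re := by simpa using h0
  have hstrip : (σ : ℂ) ∈ strip := by constructor <;> simp <;> linarith
  have hvi : Integrable v := hf.integrable_lineFun hσ
  have hwi : Integrable w := hg.integrable_lineFun hσ
  have hwn : Integrable fun t => w (-t) := hwi.comp_neg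
  have hvB : ∀ x, ‖v x‖ ≤ B := fun x => by
    refine (norm_lineFun_le hf σ x).trans (mul_le_of_le_one_right hf.nonneg ?_)
    refine Real.rpow_le_one_of_one_le_of_nonpos (by nlinarith) ?_
    rw [Complex.ofReal_re]
    linarith
  set h : ℝ → ℂ := fun z => ∫ t, w (-t) * v (z - t) with hh
  have hconv : h = convolution (fun t => w (-t)) v (ContinuousLinearMap.mul ℂ ℂ) volume := rfl
  have hhi : Integrable h := by
    rw [hconv]
    exact hwn.integrable_convolution _ hvi
  have hFh : ∀ ξ, 𝓕 h ξ = 𝓕 v ξ * 𝓕 w (-ξ) := fun ξ => by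
    rw [hconv, Real.fourier_mul_convolution_eq hwn hvi, mul_comm]
    congr 1
    rw [Real.fourier_real_eq, Real.fourier_real_eq, ← integral_neg_eq_self]
    simp
  have hpair : ∀ᵐ ξ : ℝ, ((|ξ| ^ (-σ) : ℝ) : ℂ) * 𝓕 h ξ = pairIntegrand σ f g ξ := by
    filter_upwards [(by simp [ae_iff] : ∀ᵐ ξ : ℝ, ξ ≠ 0)] with ξ hξ
    rw [hFh, pairIntegrand, lineFT_eq_fourier hf hσ hξ, lineFT_eq_fourier hg hσ (neg_ne_zero.2 hξ),
      Complex.ofReal_cpow (abs_nonneg ξ), Complex.ofReal_neg]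
  have hker := integrable_kernel_mul hvi hvB hwn
    (β := σ - 1) (by linarith) (by linarith)
  have hR : Integrable fun z => ((|z| ^ (σ - 1) : ℝ) : ℂ) * h z := by
    refine hker.integral_prod_left.congr (Eventually.of_forall fun z => ?_)
    simp only [hh]
    rw [integral_const_mul]
  have key := integral_abs_rpow_mul_fourier h0 h1 hhi
    ((integrable_pairIntegrand hf hg hstrip).congr (hpair.mono fun ξ h => h.symm)) hR
  rw [integral_congr_ae hpair] at key
  rw [pairing, key]
  congr 1
  have e1 : ∫ z, ((|z| ^ (σ - 1) : ℝ) : ℂ) * h z =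
      ∫ z, ∫ t, ((|z| ^ (σ - 1) : ℝ) : ℂ) * (w (-t) * v (z - t)) := by
    congr 1 with z
    rw [integral_const_mul]
  rw [e1, integral_integral_swap hker, ← integral_neg_eq_self]
  congr 1 with y
  rw [← integral_sub_right_eq_self _ y, ← integral_const_mul]
  congr 1 with x
  simp only [neg_neg, sub_neg_eq_add, sub_add_cancel]
  ring

/-! ### Passage to the circle and invariance under rotations -/

/-- The interval of angles parametrizing the line by `x = tan θ`. -/
def halfCircle : Set ℝ := Ioo (-(Real.pi / 2)) (Real.pi / 2)

theorem measurableSet_halfCircle : MeasurableSet halfCircle := measurableSet_Ioo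

theorem cos_pos_of_mem_halfCircle {θ : ℝ} (hθ : θ ∈ halfCircle) : 0 < Real.cos θ :=
  Real.cos_pos_of_mem_Ioo hθ

theorem hasDerivWithinAt_tan {θ : ℝ} (hθ : θ ∈ halfCircle) :
    HasDerivWithinAt Real.tan (1 / Real.cos θ ^ 2) halfCircle θ :=
  (Real.hasDerivAt_tan (cos_pos_of_mem_halfCircle hθ).ne').hasDerivWithinAt

theorem integral_eq_integral_tan (F : ℝ → ℂ) :
    ∫ x, F x = ∫ θ in halfCircle, (1 / Real.cos θ ^ 2 : ℝ) • F (Real.tan θ) := by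
  have h := integral_image_eq_integral_abs_deriv_smul measurableSet_halfCircle
    (fun θ hθ => hasDerivWithinAt_tan hθ) Real.injOn_tan F
  rw [halfCircle, Real.image_tan_Ioo, setIntegral_univ] at h
  rw [h]
  refine setIntegral_congr_fun measurableSet_halfCircle fun θ _ => ?_
  rw [abs_of_nonneg (by positivity)]

theorem lintegral_eq_lintegral_tan (F : ℝ → ℝ≥0∞) :
    ∫⁻ x, F x = ∫⁻ θ in halfCircle, ENNReal.ofReal (1 / Real.cos θ ^ 2) * F (Real.tan θ) := by
  have h := lintegral_image_eq_lintegral_abs_deriv_mul measurableSet_halfCircle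
    (fun θ hθ => hasDerivWithinAt_tan hθ) Real.injOn_tan F
  rw [halfCircle, Real.image_tan_Ioo, setLIntegral_univ] at h
  rw [h]
  refine setLIntegral_congr_fun measurableSet_halfCircle fun θ _ => ?_
  rw [abs_of_nonneg (by positivity)]

theorem one_add_tan_sq {θ : ℝ} (hθ : θ ∈ halfCircle) :
    1 + Real.tan θ ^ 2 = Real.cos θ ^ (-2 : ℝ) := by
  have hc := cos_pos_of_mem_halfCircle hθ
  rw [Real.tan_eq_sin_div_cos, Real.rpow_neg hc.le]
  norm_cast
  field_simp
  linarith [Real.sin_sq_add_cos_sq θ]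

theorem arctan_tan_of_mem {θ : ℝ} (hθ : θ ∈ halfCircle) : Real.arctan (Real.tan θ) = θ :=
  Real.arctan_tan hθ.1 hθ.2

theorem lineFun_tan (σ : ℝ) (f : ℝ → ℂ) {θ : ℝ} (hθ : θ ∈ halfCircle) :
    lineFun σ f (Real.tan θ) = ((Real.cos θ ^ (1 + σ) : ℝ) : ℂ) * f θ := by
  have hc := cos_pos_of_mem_halfCircle hθ
  rw [lineFun, arctan_tan_of_mem hθ, one_add_tan_sq hθ]
  congr 1
  have : ((-1 - (σ : ℂ)) / 2) = (((-1 - σ) / 2 : ℝ) : ℂ) := by push_cast; ring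
  rw [this, ← Complex.ofReal_cpow (by positivity), ← Real.rpow_mul hc.le]
  congr 2
  ring

theorem abs_tan_sub_tan {θ φ : ℝ} (hθ : θ ∈ halfCircle) (hφ : φ ∈ halfCircle) :
    |Real.tan θ - Real.tan φ| = |Real.sin (θ - φ)| * (Real.cos θ ^ (-1 : ℝ) * Real.cos φ ^ (-1 :
          ℝ)) := by
  have h1 := cos_pos_of_mem_halfCircle hθ
  have h2 := cos_pos_of_mem_halfCircle hφ
  have : Real.tan θ - Real.tan φ = Real.sin (θ - φ) * (Real.cos θ ^ (-1 : ℝ) * Real.cos φ ^ (-1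
        : ℝ)) := by
    rw [Real.sin_sub, Real.tan_eq_sin_div_cos, Real.tan_eq_sin_div_cos, Real.rpow_neg_one,
      Real.rpow_neg_one]
    field_simp
  rw [this, abs_mul]
  congr 1
  exact abs_of_pos (by positivity)

/-- With `x = tan θ` and `y = tan φ`, `x - y = sin(θ-φ)/(cos θ cos φ)`. In each variable the
Jacobian, the kernel and the homogeneity factor contribute `cos` to the powers `-2`, `1-σ` and
`1+σ`, which cancel. -/
theorem integral_kernel_eq_circle (σ : ℝ) (f g : ℝ → ℂ) :
    ∫ y, lineFun σ g y * ∫ x, ((|x - y| ^ (σ - 1) : ℝ) : ℂ) * lineFun σ f x =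
      ∫ φ in halfCircle, g φ *
        ∫ θ in halfCircle, ((|Real.sin (θ - φ)| ^ (σ - 1) : ℝ) : ℂ) * f θ := by
  rw [integral_eq_integral_tan]
  refine setIntegral_congr_fun measurableSet_halfCircle fun φ hφ => ?_
  have hcφ := cos_pos_of_mem_halfCircle hφ
  have inner : ∫ x, ((|x - Real.tan φ| ^ (σ - 1) : ℝ) : ℂ) * lineFun σ f x =
      ((Real.cos φ ^ (1 - σ) : ℝ) : ℂ) *
        ∫ θ in halfCircle, ((|Real.sin (θ - φ)| ^ (σ - 1) : ℝ) : ℂ) * f θ := by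
    rw [integral_eq_integral_tan, ← integral_const_mul]
    refine setIntegral_congr_fun measurableSet_halfCircle fun θ hθ => ?_
    have hcθ := cos_pos_of_mem_halfCircle hθ
    have key : 1 / Real.cos θ ^ 2 * ((|Real.sin (θ - φ)| *
        (Real.cos θ ^ (-1 : ℝ) * Real.cos φ ^ (-1 : ℝ))) ^ (σ - 1) * Real.cos θ ^ (1 + σ)) =
        Real.cos φ ^ (1 - σ) * |Real.sin (θ - φ)| ^ (σ - 1) := by
      rw [Real.mul_rpow (abs_nonneg _) (by positivity), Real.mul_rpow (by positivity) (by
            positivity),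
        ← Real.rpow_mul hcθ.le, ← Real.rpow_mul hcφ.le]
      have e1 : 1 / Real.cos θ ^ 2 = Real.cos θ ^ (-2 : ℝ) := by
        rw [Real.rpow_neg hcθ.le, one_div]
        norm_cast
      rw [e1]
      have e2 : Real.cos θ ^ (-2 : ℝ) * (Real.cos θ ^ (-1 * (σ - 1)) * Real.cos θ ^ (1 + σ)) = 1
            := by
        rw [← Real.rpow_add hcθ, ← Real.rpow_add hcθ,
          show (-2 : ℝ) + (-1 * (σ - 1) + (1 + σ)) = 0 by ring, Real.rpow_zero]
      have e3 : (-1 * (σ - 1)) = 1 - σ := by ring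
      rw [e3] at e2 ⊢
      linear_combination (Real.cos φ ^ (1 - σ) * |Real.sin (θ - φ)| ^ (σ - 1)) * e2
    have keyC := congrArg (fun r : ℝ => (r : ℂ)) key
    simp only [Complex.ofReal_mul] at keyC
    rw [lineFun_tan σ f hθ, abs_tan_sub_tan hθ hφ, Complex.real_smul]
    linear_combination f θ * keyC
  rw [inner, lineFun_tan σ g hφ, Complex.real_smul]
  have e1 : (1 / Real.cos φ ^ 2) * (Real.cos φ ^ (1 + σ) * Real.cos φ ^ (1 - σ)) = 1 := by
    have : 1 / Real.cos φ ^ 2 = Real.cos φ ^ (-2 : ℝ) := by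
      rw [Real.rpow_neg hcφ.le, one_div]
      norm_cast
    rw [this, ← Real.rpow_add hcφ, ← Real.rpow_add hcφ,
      show (-2 : ℝ) + ((1 + σ) + (1 - σ)) = 0 by ring, Real.rpow_zero]
  have e2 : ((1 / Real.cos φ ^ 2 : ℝ) : ℂ) * (((Real.cos φ ^ (1 + σ) : ℝ) : ℂ) *
      ((Real.cos φ ^ (1 - σ) : ℝ) : ℂ)) = 1 := by exact_mod_cast e1
  linear_combination (g φ * ∫ θ in halfCircle, ((|Real.sin (θ - φ)| ^ (σ - 1) : ℝ) : ℂ) * f θ) * e2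

theorem integral_halfCircle_comp_sub {E : Type*} [NormedAddCommGroup E] [NormedSpace ℝ E]
    {F : ℝ → E} (hF : Function.Periodic F Real.pi)
    (α : ℝ) : ∫ θ in halfCircle, F (θ - α) = ∫ θ in halfCircle, F θ := by
  have hle : -(Real.pi / 2) ≤ Real.pi / 2 := by linarith [Real.pi_pos]
  rw [halfCircle, ← integral_Ioc_eq_integral_Ioo, ← integral_Ioc_eq_integral_Ioo,
    ← intervalIntegral.integral_of_le hle, ← intervalIntegral.integral_of_le hle,
    intervalIntegral.integral_comp_sub_right]
  have := hF.intervalIntegral_add_eq (-(Real.pi / 2) - α) (-(Real.pi / 2))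
  convert this using 2 <;> ring

theorem IsCircleFun.comp_sub {f : ℝ → ℂ} {B : ℝ} (hf : IsCircleFun f B) (α : ℝ) :
    IsCircleFun (fun θ => f (θ - α)) B :=
  ⟨hf.contDiff.comp (contDiff_id.sub contDiff_const), fun θ => hf.bound _, fun θ => by
    rw [deriv_comp_sub_const]
    exact hf.bound_deriv _⟩

theorem abs_sin_periodic (φ r : ℝ) :
    Function.Periodic (fun θ : ℝ => ((|Real.sin (θ - φ)| ^ r : ℝ) : ℂ)) Real.pi := fun θ => by
  simp only
  rw [add_sub_right_comm, Real.sin_add_pi, abs_neg]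

/-- The pairing of periodic functions is invariant under rotations. -/
theorem pairing_comp_sub {f g : ℝ → ℂ} {B B' : ℝ} (hf : IsCircleFun f B)
    (hg : IsCircleFun g B') (hfp : Function.Periodic f Real.pi)
    (hgp : Function.Periodic g Real.pi) (α : ℝ) {s : ℂ} (hs : s ∈ strip) :
    pairing s (fun θ => f (θ - α)) (fun θ => g (θ - α)) = pairing s f g := by
  -- By analytic continuation only real parameters in `(0, 1)` matter, where the kernel
  -- `|sin(θ-φ)|^(σ-1)` is available. It is `π`-periodic and depends on the difference alone, so a
  -- common shift is absorbed first in `θ`, then in `φ`.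
  refine pairing_eq_of_eq (hf.comp_sub α) (hg.comp_sub α) hf hg (fun σ h0 h1 => ?_) hs
  have hc : ((gaussConst σ : ℝ) : ℂ) ≠ 0 := Complex.ofReal_ne_zero.2 (gaussConst_pos h0).ne'
  refine mul_left_cancel₀ hc ?_
  rw [pairing_eq_integral (hf.comp_sub α) (hg.comp_sub α) h0 h1, pairing_eq_integral hf hg h0 h1,
    integral_kernel_eq_circle, integral_kernel_eq_circle]
  congr 1
  set J : ℝ → ℂ := fun φ => ∫ θ in halfCircle, ((|Real.sin (θ - φ)| ^ (σ - 1) : ℝ) : ℂ) * f θ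
        with hJ
  have hJp : Function.Periodic J Real.pi := fun φ => by
    simp only [hJ]
    congr 1 with θ
    rw [← sub_sub, Real.sin_sub_pi, abs_neg]
  have hin : ∀ φ, ∫ θ in halfCircle, ((|Real.sin (θ - φ)| ^ (σ - 1) : ℝ) : ℂ) * f (θ - α) =
      J (φ - α) := fun φ => by
    have h := integral_halfCircle_comp_sub (F := fun θ =>
      ((|Real.sin (θ - (φ - α))| ^ (σ - 1) : ℝ) : ℂ) * f θ)
      ((abs_sin_periodic (φ - α) (σ - 1)).mul hfp) α
    simp only [sub_sub_sub_cancel_right] at h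
    exact h
  simp only [hin]
  exact integral_halfCircle_comp_sub (hgp.mul hJp) α

/-- On the imaginary axis the homogeneity factor squared is `(1 + x²)⁻¹`, the density of `dθ`. -/
theorem lintegral_lineFun_sq {f : ℝ → ℂ} {B : ℝ} (hf : IsCircleFun f B) {s : ℂ} (hs : s.re = 0) :
    ∫⁻ x, ‖lineFun s f x‖ₑ ^ 2 = ENNReal.ofReal (∫ θ in halfCircle, ‖f θ‖ ^ 2) := by
  rw [lintegral_eq_lintegral_tan, ofReal_integral_eq_lintegral_ofReal]
  · refine setLIntegral_congr_fun measurableSet_halfCircle fun θ hθ => ?_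
    have hc := cos_pos_of_mem_halfCircle hθ
    rw [← ofReal_norm, ← ENNReal.ofReal_pow (norm_nonneg _), ← ENNReal.ofReal_mul (by positivity)]
    congr 1
    rw [lineFun, norm_mul, norm_cpow_one_add_sq, arctan_tan_of_mem hθ, one_add_tan_sq hθ,
      ← Real.rpow_mul hc.le]
    have : (-2 : ℝ) * ((-1 - s) / 2).re = 1 := by simp [hs]; norm_num
    rw [this, Real.rpow_one]
    field_simp
  · have hc : Continuous fun θ => ‖f θ‖ ^ 2 := hf.contDiff.continuous.norm.pow 2
    exact (hc.integrableOn_Icc (a := -(Real.pi / 2)) (b := Real.pi / 2)).mono_set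
          Ioo_subset_Icc_self
  · exact Eventually.of_forall fun θ => sq_nonneg _

/-! ### The unitary norm -/

theorem eLpNorm_two_sq {α : Type*} [MeasurableSpace α] (μ : Measure α) (f : α → ℂ) :
    eLpNorm f 2 μ ^ 2 = ∫⁻ x, ‖f x‖ₑ ^ 2 ∂μ := by
  have := eLpNorm_nnreal_pow_eq_lintegral (f := f) (μ := μ) (p := 2) two_ne_zero
  simpa using this

theorem unitaryMeasure_eq_volume {s : ℂ} (hs : s.re = 0) : unitaryMeasure s = volume := by
  simp [unitaryMeasure, hs]

theorem lintegral_unitaryMeasure {s : ℂ} {F : ℝ → ℝ≥0∞} (hF : Measurable F) :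
    ∫⁻ x, F x ∂(unitaryMeasure s) = ∫⁻ x, ENNReal.ofReal (|x| ^ (-s.re)) * F x :=
  lintegral_withDensity_eq_lintegral_mul _ (by fun_prop) hF

theorem continuous_noncompact {δ : Parity} {s : ℂ} (v : SmoothVectors δ s) :
    Continuous (noncompact v) :=
  (differentiable_noncompact v).continuous

theorem memLp_noncompact {δ : Parity} {s : ℂ} (hs : s.re = 0) (v : SmoothVectors δ s) :
    MemLp (noncompact v) 2 := by
  obtain ⟨B, hB⟩ := exists_isCircleFun v
  refine ⟨(continuous_noncompact v).aestronglyMeasurable, ?_⟩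
  have h : eLpNorm (noncompact v) 2 volume ^ 2 < ⊤ := by
    rw [eLpNorm_two_sq]
    simp only [noncompact_eq_lineFun]
    rw [lintegral_lineFun_sq hB hs]
    exact ENNReal.ofReal_lt_top
  exact (ENNReal.pow_lt_top_iff.1 h).resolve_right two_ne_zero

theorem noncompact_bounded {δ : Parity} {s : ℂ} (hs : s.re = 0) (v : SmoothVectors δ s) :
    ∃ B, ∀ x, ‖noncompact v x‖ ≤ B := by
  obtain ⟨B, hB⟩ := exists_isCircleFun v
  refine ⟨B, fun x => ?_⟩
  rw [noncompact_eq_lineFun]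
  refine (norm_lineFun_le hB s x).trans (mul_le_of_le_one_right hB.nonneg ?_)
  exact Real.rpow_le_one_of_one_le_of_nonpos (by nlinarith) (by rw [hs]; norm_num)

theorem eLpNorm_fourier_eq {δ : Parity} {s : ℂ} (hs : s.re = 0) (v : SmoothVectors δ s) :
    eLpNorm (fourier v) 2 = eLpNorm (noncompact v) 2 := by
  have hd : ∀ x, HasDerivAt (noncompact v) (deriv (noncompact v) x) x := fun x =>
    (differentiable_noncompact v x).hasDerivAt
  have hi : Integrable (deriv (noncompact v)) := by
    obtain ⟨B, hB⟩ := exists_isCircleFun v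
    rw [deriv_noncompact]
    exact hB.integrable_lineDer (by rw [hs]; norm_num)
  exact eLpNorm_fourier_deriv (memLp_noncompact hs v) hd hi (noncompact_bounded hs v)

theorem IsUnitary.re_mem {δ : Parity} {s : ℂ} (h : IsUnitary δ s) : s ∈ strip := by
  rcases h with h | ⟨-, -, h⟩
  · constructor <;> rw [h] <;> norm_num
  · exact h

theorem IsUnitary.neg {δ : Parity} {s : ℂ} (h : IsUnitary δ s) : IsUnitary δ (-s) := by
  rcases h with h | ⟨h1, h2, h3⟩
  · exact Or.inl (by simpa using h)
  · refine Or.inr ⟨h1, by simpa using h2, ?_, ?_⟩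
    · have := h3.2
      rw [Complex.neg_re]
      linarith
    · have := h3.1
      rw [Complex.neg_re]
      linarith

/-- The unitary norm on the Fourier side. -/
theorem unitaryNorm_sq {δ : Parity} {s : ℂ} (hs : s ∈ strip) (v : SmoothVectors δ s) :
    unitaryNorm v ^ 2 = ∫⁻ ξ, ENNReal.ofReal (|ξ| ^ (-s.re)) * ‖fourier v ξ‖ₑ ^ 2 := by
  have hm := measurable_fourier hs.1 v
  rw [← lintegral_unitaryMeasure (by fun_prop), ← eLpNorm_two_sq, unitaryNorm]
  by_cases h : s.re = 0
  · rw [unitaryMeasure_eq_volume h, eLpNorm_fourier_eq h, unitaryModel, if_pos h]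
  · rw [unitaryModel, if_neg h]

/-- This is why `pairIntegrand` evaluates its second factor at `-ξ`: for real `s`, pairing `f` with
its conjugate gives a squared modulus. -/
theorem lineFT_conj (s : ℂ) (f : ℝ → ℂ) (ξ : ℝ) :
    lineFT s (fun θ => starRingEnd ℂ (f θ)) (-ξ) =
      starRingEnd ℂ (lineFT (starRingEnd ℂ s) f ξ) := by
  have hd : ∀ θ, deriv (fun θ => starRingEnd ℂ (f θ)) θ = starRingEnd ℂ (deriv f θ) := fun θ =>
    deriv.star
  rw [lineFT, lineFT, map_mul, map_inv₀, Real.fourier_real_eq_integral_exp_smul,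
    Real.fourier_real_eq_integral_exp_smul, ← integral_conj]
  have h2 : starRingEnd ℂ 2 = 2 := map_ofNat _ 2
  have h3 : starRingEnd ℂ 3 = 3 := map_ofNat _ 3
  congr 1
  · simp [h2]
  · congr 1 with x
    simp only [smul_eq_mul, map_mul, lineDer, hd, map_add, map_sub, map_neg, map_one,
      Complex.conj_ofReal, Complex.conj_conj]
    congr 1
    · rw [← Complex.exp_conj]
      congr 1
      simp [h2]
    · congr 1
      rw [← Complex.conj_ofReal (1 + x ^ 2), ← Complex.cpow_conj _ _ (by
        rw [Complex.arg_ofReal_of_nonneg (one_add_sq_pos x).le]; exact Real.pi_pos.ne),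
        Complex.conj_ofReal]
      simp [h2, h3]

theorem IsCircleFun.conj {f : ℝ → ℂ} {B : ℝ} (hf : IsCircleFun f B) :
    IsCircleFun (fun θ => starRingEnd ℂ (f θ)) B := by
  refine ⟨Complex.conjCLE.contDiff.comp hf.contDiff, fun θ => ?_, fun θ => ?_⟩
  · simpa using hf.bound θ
  · have : deriv (fun θ => starRingEnd ℂ (f θ)) θ = starRingEnd ℂ (deriv f θ) := deriv.star
    rw [this]
    simpa using hf.bound_deriv θ

theorem pairIntegrand_conj {s : ℂ} (hs : s.im = 0) (f : ℝ → ℂ) (ξ : ℝ) :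
    pairIntegrand s f (fun θ => starRingEnd ℂ (f θ)) ξ =
      ((|ξ| ^ (-s.re) * ‖lineFT s f ξ‖ ^ 2 : ℝ) : ℂ) := by
  have hs' : starRingEnd ℂ s = s := Complex.conj_eq_iff_im.2 hs
  have hs2 : s = ((s.re : ℝ) : ℂ) := (Complex.conj_eq_iff_re.1 hs').symm
  rw [pairIntegrand, lineFT_conj, hs', Complex.mul_conj, Complex.normSq_eq_norm_sq,
    Complex.ofReal_mul, Complex.ofReal_cpow (abs_nonneg ξ)]
  congr 2
  rw [Complex.ofReal_neg, ← hs2]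

/-- In the complementary series the unitary norm is given by the invariant pairing. -/
theorem lintegral_fourier_eq_pairing {δ : Parity} {s : ℂ} (hs : s ∈ strip) (him : s.im = 0)
    (v : SmoothVectors δ s) :
    ∫⁻ ξ, ENNReal.ofReal (|ξ| ^ (-s.re)) * ‖fourier v ξ‖ₑ ^ 2 =
      ENNReal.ofReal (pairing s (circ v) (fun θ => starRingEnd ℂ (circ v θ))).re := by
  obtain ⟨B, hB⟩ := exists_isCircleFun v
  have hint := integrable_pairIntegrand hB hB.conj hs
  have he : pairIntegrand s (circ v) (fun θ => starRingEnd ℂ (circ v θ)) =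
      fun ξ => ((|ξ| ^ (-s.re) * ‖fourier v ξ‖ ^ 2 : ℝ) : ℂ) := funext fun ξ => by
    rw [pairIntegrand_conj him, fourier_eq_lineFT]
  rw [he] at hint
  have hint' : Integrable fun ξ => |ξ| ^ (-s.re) * ‖fourier v ξ‖ ^ 2 :=
    hint.re.congr (Eventually.of_forall fun ξ => Complex.ofReal_re _)
  rw [pairing, he, integral_complex_ofReal, Complex.ofReal_re,
    ofReal_integral_eq_lintegral_ofReal hint' (Eventually.of_forall fun ξ => by positivity)]
  refine lintegral_congr fun ξ => ?_
  rw [ENNReal.ofReal_mul (by positivity), ENNReal.ofReal_pow (norm_nonneg _), ofReal_norm]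

/-- On the imaginary axis finiteness is seen on the circle; in the complementary series it is the
convergence of the pairing. -/
theorem IsUnitary.memLp {δ : Parity} {s : ℂ} (h : IsUnitary δ s) (v : SmoothVectors δ s) :
    MemLp (unitaryModel v) 2 (unitaryMeasure s) := by
  refine ⟨?_, ?_⟩
  · unfold unitaryModel
    split_ifs
    · exact (continuous_noncompact v).aestronglyMeasurable
    · exact (measurable_fourier h.re_mem.1 v).aestronglyMeasurable
  · by_cases h0 : s.re = 0
    · rw [unitaryModel, if_pos h0, unitaryMeasure_eq_volume h0]
      exact (memLp_noncompact h0 v).2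
    · have him : s.im = 0 := (h.resolve_left h0).2.1
      have hlt : unitaryNorm v ^ 2 < ⊤ := by
        rw [unitaryNorm_sq h.re_mem, lintegral_fourier_eq_pairing h.re_mem him]
        exact ENNReal.ofReal_lt_top
      exact (ENNReal.pow_lt_top_iff.1 hlt).resolve_right two_ne_zero

theorem circ_rep_K {δ : Parity} {s : ℂ} (v : SmoothVectors δ s) (θ φ : ℝ) :
    circ (rep δ s (elemK θ)⁻¹ v) φ = circ v (φ - θ) := by
  change v.1 (((elemK θ)⁻¹)⁻¹.1.mulVec ![Real.sin φ, Real.cos φ]) = _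
  rw [inv_inv]
  refine congrArg v.1 (funext fun i => ?_)
  fin_cases i
  · simp [elemK, Matrix.mulVec, dotProduct, Fin.sum_univ_two, Real.sin_sub]
    ring
  · simp [elemK, Matrix.mulVec, dotProduct, Fin.sum_univ_two, Real.cos_sub]
    ring

theorem norm_char_neg_one (δ : Parity) : ‖δ.char (-1)‖ = 1 := by
  cases δ <;> simp [Parity.char]

/-- The unitary norm is invariant under `K`. -/
theorem IsUnitary.unitaryNorm_rep_K {δ : Parity} {s : ℂ} (h : IsUnitary δ s)
    (v : SmoothVectors δ s) (θ : ℝ) : unitaryNorm (rep δ s (elemK θ)⁻¹ v) = unitaryNorm v := by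
  obtain ⟨B, hB⟩ := exists_isCircleFun v
  have hcirc : circ (rep δ s (elemK θ)⁻¹ v) = fun φ => circ v (φ - θ) := funext (circ_rep_K v θ)
  suffices hsq : unitaryNorm (rep δ s (elemK θ)⁻¹ v) ^ 2 = unitaryNorm v ^ 2 from
    (ENNReal.pow_right_strictMono two_ne_zero).injective hsq
  by_cases h0 : s.re = 0
  · have hgen : ∀ w : SmoothVectors δ s, unitaryNorm w ^ 2 =
        ENNReal.ofReal (∫ θ in halfCircle, ‖circ w θ‖ ^ 2) := fun w => by
      obtain ⟨B, hB⟩ := exists_isCircleFun w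
      rw [← lintegral_lineFun_sq hB h0, unitaryNorm, unitaryModel, if_pos h0,
        unitaryMeasure_eq_volume h0, eLpNorm_two_sq]
      simp only [noncompact_eq_lineFun]
    rw [hgen, hgen, hcirc]
    congr 1
    refine integral_halfCircle_comp_sub (F := fun φ => ‖circ v φ‖ ^ 2) (fun φ => ?_) θ
    simp only
    rw [circ_add_pi, norm_mul, norm_char_neg_one, one_mul]
  -- The complementary series has even sign, so the function on the circle has period `π`, as the
  -- invariance of the pairing requires.
  · obtain ⟨hδ, him, -⟩ := h.resolve_left h0
    have hper : Function.Periodic (circ v) Real.pi := fun φ => by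
      have hc : δ.char (-1) = 1 := by rw [hδ, Parity.char]
      rw [circ_add_pi, hc, one_mul]
    rw [unitaryNorm_sq h.re_mem, unitaryNorm_sq h.re_mem, lintegral_fourier_eq_pairing h.re_mem him,
      lintegral_fourier_eq_pairing h.re_mem him, hcirc]
    rw [pairing_comp_sub hB hB.conj hper (fun φ => by simp only [hper φ]) θ h.re_mem]

/-! ### The Hilbert space -/

theorem integrable_deriv_noncompact {δ : Parity} {s : ℂ} (hs : -1 < s.re) (v : SmoothVectors δ s) :
    Integrable (deriv (noncompact v)) := by
  obtain ⟨B, hB⟩ := exists_isCircleFun v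
  rw [deriv_noncompact]
  exact hB.integrable_lineDer hs

theorem fourier_smul_add {δ : Parity} {s : ℂ} (hs : -1 < s.re) (c : ℂ) (v w : SmoothVectors δ s) :
    fourier (c • v + w) = c • fourier v + fourier w := by
  have hd : deriv (noncompact (c • v + w)) = c • deriv (noncompact v) + deriv (noncompact w) :=
    funext fun x => (((differentiable_noncompact v x).hasDerivAt.const_smul c).add
      (differentiable_noncompact w x).hasDerivAt).deriv
  have h1 := integrable_deriv_noncompact hs v
  have h2 := integrable_deriv_noncompact hs w
  have hF : 𝓕 (deriv (noncompact (c • v + w))) =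
      c • 𝓕 (deriv (noncompact v)) + 𝓕 (deriv (noncompact w)) := by
    rw [hd]
    have e1 := VectorFourier.fourierIntegral_add (e := Real.fourierChar) (μ := volume)
      (L := innerₗ ℝ) Real.continuous_fourierChar continuous_inner (h1.smul c) h2
    have e2 := VectorFourier.fourierIntegral_const_smul Real.fourierChar volume (innerₗ ℝ)
      (deriv (noncompact v)) c
    rw [e2] at e1
    exact e1
  funext ξ
  simp only [fourier, hF, Pi.add_apply, Pi.smul_apply, smul_eq_mul]
  ring

theorem unitaryModel_smul_add {δ : Parity} {s : ℂ} (hs : -1 < s.re) (c : ℂ)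
    (v w : SmoothVectors δ s) :
    unitaryModel (c • v + w) = c • unitaryModel v + unitaryModel w := by
  unfold unitaryModel
  split_ifs
  · rfl
  · exact fourier_smul_add hs c v w

/-- The class in `L²` of a smooth vector of a unitary representation. -/
def modelLp {δ : Parity} {s : ℂ} (h : IsUnitary δ s) :
    SmoothVectors δ s →ₗ[ℂ] Lp ℂ 2 (unitaryMeasure s) where
  toFun v := (h.memLp v).toLp
  map_add' v w := by
    rw [← MemLp.toLp_add]
    refine MemLp.toLp_congr _ _ (Eventually.of_forall fun x => ?_)
    have := unitaryModel_smul_add h.re_mem.1 1 v w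
    rw [one_smul, one_smul] at this
    rw [this]
  map_smul' c v := by
    rw [RingHom.id_apply, ← MemLp.toLp_const_smul]
    refine MemLp.toLp_congr _ _ (Eventually.of_forall fun x => ?_)
    have h0 := unitaryModel_smul_add h.re_mem.1 1 (0 : SmoothVectors δ s) 0
    have := unitaryModel_smul_add h.re_mem.1 c v 0
    rw [one_smul, one_smul, add_zero, left_eq_add] at h0
    rw [add_zero, h0, add_zero] at this
    rw [this]

theorem enorm_modelLp {δ : Parity} {s : ℂ} (h : IsUnitary δ s) (v : SmoothVectors δ s) :
    ‖modelLp h v‖ₑ = unitaryNorm v :=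
  Lp.enorm_toLp (h.memLp v)

theorem convergesTo_iff {δ : Parity} {s : ℂ} (hs : IsUnitary δ s) (w : ℕ → SmoothVectors δ s)
    (h : HilbertVectors δ s) :
    ConvergesTo w h ↔ Tendsto (fun j => modelLp hs (w j)) atTop (𝓝 h.1) := by
  rw [Lp.tendsto_Lp_iff_tendsto_eLpNorm', ConvergesTo]
  refine tendsto_congr fun j => eLpNorm_congr_ae ?_
  filter_upwards [(hs.memLp (w j)).coeFn_toLp] with x hx
  rw [Pi.sub_apply, modelLp, LinearMap.coe_mk, AddHom.coe_mk, hx]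

/-- The classes of smooth vectors already form a subspace, the range of `modelLp`, so the span in
the definition adds nothing and the closure is reached by sequences. -/
theorem exists_convergesTo {δ : Parity} {s : ℂ} (hs : IsUnitary δ s) (h : HilbertVectors δ s) :
    ∃ w : ℕ → SmoothVectors δ s, ConvergesTo w h := by
  have hset : {h : Lp ℂ 2 (unitaryMeasure s) |
      ∃ v : SmoothVectors δ s, h =ᵐ[unitaryMeasure s] unitaryModel v} =
      (LinearMap.range (modelLp hs) : Submodule ℂ _) := by
    ext g
    constructor
    · rintro ⟨v, hv⟩
      exact ⟨v, Lp.ext ((hs.memLp v).coeFn_toLp.trans hv.symm)⟩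
    · rintro ⟨v, rfl⟩
      exact ⟨v, (hs.memLp v).coeFn_toLp⟩
  have hmem : h.1 ∈ (Submodule.span ℂ {h : Lp ℂ 2 (unitaryMeasure s) |
      ∃ v : SmoothVectors δ s, h =ᵐ[unitaryMeasure s] unitaryModel v}).topologicalClosure := h.2
  have hspan : Submodule.span ℂ {h : Lp ℂ 2 (unitaryMeasure s) |
      ∃ v : SmoothVectors δ s, h =ᵐ[unitaryMeasure s] unitaryModel v} =
      LinearMap.range (modelLp hs) := by
    rw [hset, Submodule.span_eq]
  rw [hspan] at hmem
  obtain ⟨g, hg, hlim⟩ := mem_closure_iff_seq_limit.1 hmem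
  choose w hw using hg
  refine ⟨w, (convergesTo_iff hs w h).2 ?_⟩
  simpa only [hw] using hlim

/-! ### Limits in `L²_loc` -/

/-- Extension by continuity of a linear map to the functions which are square integrable on each of
the sets `Q n`. -/
theorem exists_limit_of_bounded {V E X : Type*} [AddCommGroup V] [SeminormedAddCommGroup E]
    [MeasurableSpace X] (μ : Measure X) (T : V → X → ℂ) (A : V → E)
    (hT : ∀ v w, T (v - w) = T v - T w) (hA : ∀ v w, A (v - w) = A v - A w) (Q : ℕ → Set X)
    (hm : ∀ v n, AEStronglyMeasurable (T v) (μ.restrict (Q n))) (K : ℕ → ℝ≥0∞)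
    (hK : ∀ n, K n ≠ ⊤) (hb : ∀ n v, ∫⁻ x in Q n, ‖T v x‖ₑ ^ 2 ∂μ ≤ K n * ‖A v‖ₑ ^ 2)
    {h : E} (hh : ∃ w : ℕ → V, Tendsto (fun j => A (w j)) atTop (𝓝 h)) :
    ∃ f : X → ℂ, StronglyMeasurable f ∧ ∀ w : ℕ → V, Tendsto (fun j => A (w j)) atTop (𝓝 h) →
      ∀ n, Tendsto (fun j => ∫⁻ x in Q n, ‖T (w j) x - f x‖ₑ ^ 2 ∂μ) atTop (𝓝 0) := by
  -- Weights chosen so that the countably many bounds add up to one: with `ν` the weighted sum of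
  -- the restrictions, `T` is contractive from the seminorm of `A` into `L²(ν)`. The summand `1`
  -- avoids inverting `0`.
  set c : ℕ → ℝ≥0∞ := fun n => 2⁻¹ ^ (n + 1) * (K n + 1)⁻¹ with hc
  have hc0 : ∀ n, c n ≠ 0 := fun n => by
    refine mul_ne_zero (pow_ne_zero _ (by simp)) ?_
    exact ENNReal.inv_ne_zero.2 (ENNReal.add_ne_top.2 ⟨hK n, ENNReal.one_ne_top⟩)
  have hct : ∀ n, c n ≠ ⊤ := fun n => by
    refine ENNReal.mul_ne_top (ENNReal.pow_ne_top (by simp)) (ENNReal.inv_ne_top.2 ?_)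
    exact ne_of_gt (lt_of_lt_of_le one_pos le_add_self)
  set ν : Measure X := Measure.sum fun n => c n • μ.restrict (Q n) with hν
  have hνle : ∀ n (G : X → ℝ≥0∞), c n * ∫⁻ x in Q n, G x ∂μ ≤ ∫⁻ x, G x ∂ν := fun n G => by
    rw [hν, lintegral_sum_measure]
    refine le_trans (le_of_eq ?_) (ENNReal.le_tsum n)
    rw [lintegral_smul_measure, smul_eq_mul]
  have hνm : ∀ v, AEStronglyMeasurable (T v) ν := fun v =>
    aestronglyMeasurable_sum_measure_iff.2 fun n => (hm v n).smul_measure (c n)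
  have hνb : ∀ v, eLpNorm (T v) 2 ν ≤ ‖A v‖ₑ := by
    intro v
    refine (ENNReal.pow_right_strictMono two_ne_zero).le_iff_le.1 ?_
    rw [eLpNorm_two_sq, hν, lintegral_sum_measure]
    calc ∑' n, ∫⁻ x, ‖T v x‖ₑ ^ 2 ∂(c n • μ.restrict (Q n))
        ≤ ∑' n : ℕ, 2⁻¹ ^ (n + 1) * ‖A v‖ₑ ^ 2 := by
          refine ENNReal.tsum_le_tsum fun n => ?_
          rw [lintegral_smul_measure, smul_eq_mul]
          calc c n * ∫⁻ x in Q n, ‖T v x‖ₑ ^ 2 ∂μ ≤ c n * ((K n + 1) * ‖A v‖ₑ ^ 2) := by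
                gcongr
                exact (hb n v).trans (mul_le_mul' le_self_add le_rfl)
            _ = 2⁻¹ ^ (n + 1) * ((K n + 1)⁻¹ * (K n + 1)) * ‖A v‖ₑ ^ 2 := by
                rw [hc]; ring
            _ = _ := by
                rw [ENNReal.inv_mul_cancel (by simp) (ENNReal.add_ne_top.2
                  ⟨hK n, ENNReal.one_ne_top⟩), mul_one]
      _ = ‖A v‖ₑ ^ 2 := by
          rw [ENNReal.tsum_mul_right, ENNReal.tsum_geometric_add_one]
          have h2 : (1 - 2⁻¹ : ℝ≥0∞)⁻¹ = 2 := by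
            rw [ENNReal.one_sub_inv_two, inv_inv]
          rw [h2, ENNReal.inv_mul_cancel two_ne_zero ENNReal.ofNat_ne_top, one_mul]
  have hmem : ∀ v, MemLp (T v) 2 ν := fun v => ⟨hνm v, (hνb v).trans_lt enorm_lt_top⟩
  set S : V → Lp ℂ 2 ν := fun v => (hmem v).toLp with hS
  have hSd : ∀ v w, edist (S v) (S w) ≤ edist (A v) (A w) := fun v w => by
    rw [hS, Lp.edist_toLp_toLp, ← hT, edist_eq_enorm_sub, ← hA]
    exact hνb _
  obtain ⟨w₀, hw₀⟩ := hh
  have hcau : CauchySeq fun j => S (w₀ j) := by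
    rw [EMetric.cauchySeq_iff]
    intro ε hε
    obtain ⟨N, hN⟩ := EMetric.cauchySeq_iff.1 hw₀.cauchySeq ε hε
    exact ⟨N, fun m hm n hn => (hSd _ _).trans_lt (hN m hm n hn)⟩
  obtain ⟨F, hF⟩ := cauchySeq_tendsto_of_complete hcau
  refine ⟨F, Lp.stronglyMeasurable F, fun w hw n => ?_⟩
  have h1 : Tendsto (fun j => edist (S (w j)) F) atTop (𝓝 0) := by
    have h2 : Tendsto (fun j => edist (A (w j)) (A (w₀ j)) + edist (S (w₀ j)) F) atTop (𝓝 0) := by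
      have h3 := (hw.edist hw₀).add (hF.edist (tendsto_const_nhds (x := F)))
      rwa [edist_self, edist_self, add_zero] at h3
    refine tendsto_of_tendsto_of_tendsto_of_le_of_le tendsto_const_nhds h2 (fun j => zero_le) ?_
    intro j
    exact (edist_triangle _ (S (w₀ j)) _).trans (add_le_add (hSd _ _) le_rfl)
  have h4 : ∀ j, ∫⁻ x in Q n, ‖T (w j) x - F x‖ₑ ^ 2 ∂μ ≤ (c n)⁻¹ * edist (S (w j)) F ^ 2 := by
    intro j
    have h5 : edist (S (w j)) F ^ 2 = ∫⁻ x, ‖T (w j) x - F x‖ₑ ^ 2 ∂ν := by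
      rw [Lp.edist_def, eLpNorm_two_sq]
      refine lintegral_congr_ae ?_
      filter_upwards [(hmem (w j)).coeFn_toLp] with x hx
      rw [Pi.sub_apply, hS, hx]
    rw [h5]
    refine le_trans ?_ (mul_le_mul' le_rfl (hνle n _))
    rw [← mul_assoc, ENNReal.inv_mul_cancel (hc0 n) (hct n), one_mul]
  refine tendsto_of_tendsto_of_tendsto_of_le_of_le tendsto_const_nhds ?_ (fun j => zero_le) h4
  have h6 := ENNReal.Tendsto.const_mul ((ENNReal.continuous_pow 2).tendsto 0 |>.comp h1)
    (Or.inr (ENNReal.inv_ne_top.2 (hc0 n)))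
  simpa using h6

/-- A bound for square integrals passes to limits in `L²_loc`. -/
theorem lintegral_iUnion_le_of_tendsto {X : Type*} [MeasurableSpace X] (μ : Measure X)
    (Q : ℕ → Set X) (hQ : Monotone Q) {T : ℕ → X → ℂ} {f : X → ℂ}
    (hT : ∀ n j, AEStronglyMeasurable (T j) (μ.restrict (Q n)))
    (hf : ∀ n, AEStronglyMeasurable f (μ.restrict (Q n)))
    (hlim : ∀ n, Tendsto (fun j => ∫⁻ x in Q n, ‖T j x - f x‖ₑ ^ 2 ∂μ) atTop (𝓝 0))
    {K : ℝ≥0∞} (hK : K ≠ ⊤) {N : ℕ → ℝ≥0∞} {N₀ : ℝ≥0∞} (hN : Tendsto N atTop (𝓝 N₀))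
    (hb : ∀ n j, ∫⁻ x in Q n, ‖T j x‖ₑ ^ 2 ∂μ ≤ K * N j ^ 2) :
    ∫⁻ x in ⋃ n, Q n, ‖f x‖ₑ ^ 2 ∂μ ≤ K * N₀ ^ 2 := by
  rw [setLIntegral_iUnion_of_directed _ hQ.directed_le]
  refine iSup_le fun n => ?_
  have hmono := (ENNReal.pow_right_strictMono two_ne_zero : StrictMono fun x : ℝ≥0∞ => x ^ 2)
  have hsq : ∀ x : ℝ≥0∞, (x ^ (1 / 2 : ℝ)) ^ 2 = x := fun x => by
    rw [← ENNReal.rpow_natCast, ← ENNReal.rpow_mul]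
    norm_num
  have hKs : (K ^ (1 / 2 : ℝ)) ≠ ⊤ := ENNReal.rpow_ne_top_of_nonneg (by norm_num) hK
  have h1 : ∀ j, eLpNorm f 2 (μ.restrict (Q n)) ≤
      (∫⁻ x in Q n, ‖T j x - f x‖ₑ ^ 2 ∂μ) ^ (1 / 2 : ℝ) + K ^ (1 / 2 : ℝ) * N j := by
    -- Minkowski's inequality on `Q n`; the first term vanishes in the limit.
    intro j
    have e : f = T j - (T j - f) := by rw [sub_sub_cancel]
    calc eLpNorm f 2 (μ.restrict (Q n)) = eLpNorm (T j - (T j - f)) 2 (μ.restrict (Q n)) := by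
          rw [← e]
      _ ≤ eLpNorm (T j) 2 (μ.restrict (Q n)) + eLpNorm (T j - f) 2 (μ.restrict (Q n)) :=
          eLpNorm_sub_le (hT n j) ((hT n j).sub (hf n)) (by norm_num)
      _ ≤ _ := by
          rw [add_comm]
          refine add_le_add ?_ ?_
          · refine hmono.le_iff_le.1 ?_
            rw [hsq, eLpNorm_two_sq]
            rfl
          · refine hmono.le_iff_le.1 ?_
            rw [mul_pow, hsq, eLpNorm_two_sq]
            exact hb n j
  have h2 : Tendsto (fun j => (∫⁻ x in Q n, ‖T j x - f x‖ₑ ^ 2 ∂μ) ^ (1 / 2 : ℝ) +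
      K ^ (1 / 2 : ℝ) * N j) atTop (𝓝 (0 + K ^ (1 / 2 : ℝ) * N₀)) := by
    refine Tendsto.add ?_ (ENNReal.Tendsto.const_mul hN (Or.inr hKs))
    have := ((ENNReal.continuous_rpow_const (y := 1 / 2)).tendsto 0).comp (hlim n)
    simpa [Function.comp_def] using this
  have h3 := ge_of_tendsto' h2 h1
  rw [zero_add] at h3
  have h4 := hmono.le_iff_le.2 h3
  rwa [eLpNorm_two_sq, mul_pow, hsq] at h4

/-! ### Measurability of the matrix coefficients -/

/-- A rotation on the left of `a n_t` is moved onto the vector, reducing `KAN` to `AN` for rotated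
vectors. -/
theorem coeffKAN_eq {δ : Parity} {u : ℂ} (τ : DistVectors δ u) (v : SmoothVectors δ (-u))
    (θ a t : ℝ) : coeffKAN τ v θ a t = coeffAN τ (rep δ (-u) (elemK θ)⁻¹ v) a t := by
  unfold coeffKAN coeffAN matrixCoeff
  rw [mul_assoc, mul_inv_rev, map_mul]
  rfl

theorem coeffKAN_zero {δ : Parity} {u : ℂ} (τ : DistVectors δ u) (v : SmoothVectors δ (-u))
    (a t : ℝ) : coeffKAN τ v 0 a t = coeffAN τ v a t := by
  have : elemK 0 = 1 := by
    ext i j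
    fin_cases i <;> fin_cases j <;> simp [elemK]
  rw [coeffKAN_eq, this, inv_one, map_one]
  rfl

/-- Joint measurability in the angle and the frequency: up to an explicit factor this is a parameter
integral of a jointly continuous function, because rotation just shifts the function on the circle.
-/
theorem measurable_fourier_rep_K {δ : Parity} {s : ℂ} (v : SmoothVectors δ s) :
    Measurable fun q : ℝ × ℝ => fourier (rep δ s (elemK q.1)⁻¹ v) q.2 := by
  obtain ⟨B, hB⟩ := exists_isCircleFun v
  have e : (fun q : ℝ × ℝ => fourier (rep δ s (elemK q.1)⁻¹ v) q.2) = fun q : ℝ × ℝ =>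
      (2 * Real.pi * Complex.I * q.2 : ℂ)⁻¹ * ∫ x : ℝ,
        Complex.exp (((-2 * Real.pi * x * q.2 : ℝ) : ℂ) * Complex.I) •
          (((1 + x ^ 2 : ℝ) : ℂ) ^ ((-3 - s) / 2) *
            ((-1 - s) * x * circ v (Real.arctan x - q.1) +
              deriv (circ v) (Real.arctan x - q.1))) := by
    funext q
    rw [fourier_eq_lineFT, lineFT, Real.fourier_real_eq_integral_exp_smul]
    have hc : circ (rep δ s (elemK q.1)⁻¹ v) = fun φ => circ v (φ - q.1) :=
      funext (circ_rep_K v q.1)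
    simp only [hc, lineDer, deriv_comp_sub_const]
  rw [e]
  refine Measurable.mul (by fun_prop) (StronglyMeasurable.measurable ?_)
  refine StronglyMeasurable.integral_prod_right (Continuous.stronglyMeasurable ?_)
  have h1 : Continuous fun z : (ℝ × ℝ) × ℝ => Real.arctan z.2 - z.1.1 :=
    (Real.continuous_arctan.comp continuous_snd).sub (continuous_fst.comp continuous_fst)
  have h2 := hB.contDiff.continuous.comp h1
  have h3 := hB.continuous_deriv.comp h1
  have h4 := (continuous_cpow_one_add_sq ((-3 - s) / 2)).comp
    (continuous_snd : Continuous fun z : (ℝ × ℝ) × ℝ => z.2)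
  have h5 : Continuous fun z : (ℝ × ℝ) × ℝ =>
      Complex.exp (((-2 * Real.pi * z.2 * z.1.2 : ℝ) : ℂ) * Complex.I) := by fun_prop
  have h6 : Continuous fun z : (ℝ × ℝ) × ℝ => (-1 - s) * (z.2 : ℂ) := by fun_prop
  exact h5.smul (h4.mul ((h6.mul h2).add h3))

theorem measurable_of_hasSum {X ι : Type*} [MeasurableSpace X] [Countable ι] {F : ι → X → ℂ}
    {f : X → ℂ} (hF : ∀ i, Measurable (F i)) (h : ∀ x, HasSum (fun i => F i x) (f x)) :
    Measurable f := by
  have : Tendsto (fun I : Finset ι => fun x => ∑ i ∈ I, F i x) atTop (𝓝 f) :=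
    tendsto_pi_nhds.2 h
  exact measurable_of_tendsto_metrizable' atTop
    (fun I => Finset.measurable_sum I fun i _ => hF i) this

theorem measurable_expansion_term {G : ℝ × ℝ → ℂ} (hG : Measurable G) (b z : ℂ) (r : ℝ) :
    Measurable fun x : ℝ × ℝ × ℝ => b * ((x.2.1 : ℂ) ^ z *
      Complex.exp (2 * Real.pi * Complex.I * x.2.2 * r) * G (x.1, r / x.2.1 ^ 2)) := by
  have h1 : Measurable fun x : ℝ × ℝ × ℝ => G (x.1, r / x.2.1 ^ 2) :=
    hG.comp (by fun_prop : Measurable fun x : ℝ × ℝ × ℝ => (x.1, r / x.2.1 ^ 2))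
  have h2 : Measurable fun x : ℝ × ℝ × ℝ => (x.2.1 : ℂ) ^ z :=
    (Complex.measurable_ofReal.comp (measurable_fst.comp measurable_snd)).pow_const z
  have h3 : Measurable fun x : ℝ × ℝ × ℝ =>
      Complex.exp (2 * Real.pi * Complex.I * x.2.2 * r) := by fun_prop
  exact ((h2.mul h3).mul h1).const_mul b

/-- A countable sum of measurable terms; the indicator is there because the expansion is available
only for `a > 0`. -/
theorem HasExpansion.measurable_indicator_coeffKAN {δ : Parity} {u : ℂ} {τ : DistVectors δ u}
    {p : ℕ} {b : ℤ → ℂ} (hb : HasExpansion τ p b) (v : SmoothVectors δ (-u)) :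
    Measurable ({x : ℝ × ℝ × ℝ | 0 < x.2.1}.indicator
      fun x => coeffKAN τ v x.1 x.2.1 x.2.2) := by
  have hS : MeasurableSet {x : ℝ × ℝ × ℝ | 0 < x.2.1} :=
    measurableSet_lt measurable_const (by fun_prop)
  refine measurable_of_hasSum (ι := {m : ℤ // m ≠ 0}) (fun m => (measurable_expansion_term
    (measurable_fourier_rep_K v) (b m) (-u - 1) (freq p m)).indicator hS) fun x => ?_
  by_cases hx : 0 < x.2.1
  · simp only [indicator_of_mem (show x ∈ {x : ℝ × ℝ × ℝ | 0 < x.2.1} from hx), coeffKAN_eq]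
    exact hb.hasSum_coeffAN (rep δ (-u) (elemK x.1)⁻¹ v) hx x.2.2
  · simp only [indicator_of_notMem (show x ∉ {x : ℝ × ℝ × ℝ | 0 < x.2.1} from hx)]
    exact hasSum_zero

theorem HasExpansion.aestronglyMeasurable_coeffKAN {δ : Parity} {u : ℂ} {τ : DistVectors δ u}
    {p : ℕ} {b : ℤ → ℂ} (hb : HasExpansion τ p b) (v : SmoothVectors δ (-u))
    {S : Set (ℝ × ℝ × ℝ)} (hS : S ⊆ {x : ℝ × ℝ × ℝ | 0 < x.2.1}) :
    AEStronglyMeasurable (fun x : ℝ × ℝ × ℝ => coeffKAN τ v x.1 x.2.1 x.2.2)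
      (volume.restrict S) := by
  have hA : MeasurableSet {x : ℝ × ℝ × ℝ | 0 < x.2.1} :=
    measurableSet_lt measurable_const (by fun_prop)
  have h1 := (hb.measurable_indicator_coeffKAN v).aestronglyMeasurable
    (μ := (volume : Measure (ℝ × ℝ × ℝ)))
  exact ((aestronglyMeasurable_indicator_iff hA).1 h1).mono_measure (Measure.restrict_mono hS
        le_rfl)

theorem HasExpansion.aestronglyMeasurable_coeffAN {δ : Parity} {u : ℂ} {τ : DistVectors δ u}
    {p : ℕ} {b : ℤ → ℂ} (hb : HasExpansion τ p b) (v : SmoothVectors δ (-u))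
    {S : Set (ℝ × ℝ)} (hS : S ⊆ {x : ℝ × ℝ | 0 < x.1}) :
    AEStronglyMeasurable (fun x : ℝ × ℝ => coeffAN τ v x.1 x.2) (volume.restrict S) := by
  have hA : MeasurableSet {x : ℝ × ℝ | 0 < x.1} :=
    measurableSet_lt measurable_const (by fun_prop)
  have h1 : Measurable ({x : ℝ × ℝ | 0 < x.1}.indicator fun x => coeffAN τ v x.1 x.2) := by
    have h2 := (hb.measurable_indicator_coeffKAN v).comp
      (by fun_prop : Measurable fun x : ℝ × ℝ => ((0 : ℝ), x.1, x.2))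
    convert h2 using 1
    funext x
    by_cases hx : 0 < x.1
    · rw [indicator_of_mem (by exact hx), Function.comp_apply, indicator_of_mem (by exact hx),
        coeffKAN_zero]
    · rw [indicator_of_notMem (by exact hx), Function.comp_apply,
        indicator_of_notMem (by exact hx)]
  exact ((aestronglyMeasurable_indicator_iff hA).1
    (h1.aestronglyMeasurable (μ := (volume : Measure (ℝ × ℝ))))).mono_measure
      (Measure.restrict_mono hS le_rfl)

/-! ### Bounds for smooth vectors -/

theorem IsUnitary.siegelIntegral_le {δ : Parity} {u : ℂ} (hU : IsUnitary δ (-u)) (hu : u.re < 1)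
    {τ : DistVectors δ u} {p : ℕ} (hp : 0 < p) {b : ℤ → ℂ} (hb : HasExpansion τ p b)
    {ε C : ℝ} (hC : 0 ≤ C)
    (hW : ∀ y, weight p b u.re ε y ≤ ENNReal.ofReal (C * |y| ^ (ε / 2)))
    (v : SmoothVectors δ (-u)) {a₁ : ℝ} (ha₁ : 0 < a₁) :
    siegelIntegral p ε a₁ (coeffAN τ v) ≤ ENNReal.ofReal (C * a₁ ^ ε) * unitaryNorm v ^ 2 := by
  refine (hb.siegelIntegral_le hu hp hC hW v ha₁).trans (mul_le_mul' le_rfl ?_)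
  rw [unitaryNorm_sq hU.re_mem, Complex.neg_re, neg_neg]
  exact setLIntegral_le_lintegral _ _

/-- By invariance of the norm the bound is uniform in the angle, and `K` has volume `2π`. -/
theorem IsUnitary.siegelIntegralK_le {δ : Parity} {u : ℂ} (hU : IsUnitary δ (-u))
    {τ : DistVectors δ u} {p : ℕ} {ε a₁ : ℝ} {K : ℝ≥0∞}
    (hK : ∀ v : SmoothVectors δ (-u),
      siegelIntegral p ε a₁ (coeffAN τ v) ≤ K * unitaryNorm v ^ 2)
    (v : SmoothVectors δ (-u)) :
    siegelIntegralK p ε a₁ (coeffKAN τ v) ≤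
      ENNReal.ofReal (2 * Real.pi) * (K * unitaryNorm v ^ 2) := by
  have h : ∀ θ, siegelIntegral p ε a₁ (coeffKAN τ v θ) ≤ K * unitaryNorm v ^ 2 := fun θ => by
    have e : coeffKAN τ v θ = coeffAN τ (rep δ (-u) (elemK θ)⁻¹ v) :=
      funext fun a => funext fun t => coeffKAN_eq τ v θ a t
    rw [e, ← hU.unitaryNorm_rep_K v θ]
    exact hK _
  refine (lintegral_mono h).trans (le_of_eq ?_)
  rw [setLIntegral_const, Real.volume_Ico, sub_zero, mul_comm]

/-! ### Integrals over boxes -/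

theorem HasExpansion.periodic_coeffAN {δ : Parity} {u : ℂ} {τ : DistVectors δ u} {p : ℕ}
    (hp : 0 < p) {b : ℤ → ℂ} (hb : HasExpansion τ p b) (v : SmoothVectors δ (-u)) {a : ℝ}
    (ha : 0 < a) : Function.Periodic (coeffAN τ v a) p := fun t => by
  refine (hb.hasSum_coeffAN v ha (t + p)).unique ?_
  convert hb.hasSum_coeffAN v ha t using 5 with m
  have hpC : (p : ℂ) ≠ 0 := Nat.cast_ne_zero.2 hp.ne'
  rw [Complex.exp_eq_exp_iff_exists_int]
  refine ⟨-m, ?_⟩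
  simp only [freq]
  push_cast
  field_simp
  ring

theorem setLIntegral_Ioc_add_nsmul_le {g : ℝ → ℝ≥0∞} {p : ℝ} (hp : 0 < p)
    (hg : Function.Periodic g p) (x : ℝ) (m : ℕ) :
    ∫⁻ t in Ioc x (x + m * p), g t ≤ m * ∫⁻ t in Ioc 0 p, g t := by
  have hshift : ∀ y, ∫⁻ t in Ioc y (y + p), g t = ∫⁻ t in Ioc 0 p, g t := fun y => by
    have := (isAddFundamentalDomain_Ioc hp y).setLIntegral_eq (isAddFundamentalDomain_Ioc hp 0) g
      hg.map_vadd_zmultiples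
    rwa [zero_add] at this
  induction m with
  | zero => simp
  | succ m ih =>
    have hsub : Ioc x (x + (m + 1 : ℕ) * p) ⊆
        Ioc x (x + m * p) ∪ Ioc (x + m * p) (x + m * p + p) := by
      intro t ht
      rcases le_or_gt t (x + m * p) with h | h
      · exact Or.inl ⟨ht.1, h⟩
      · refine Or.inr ⟨h, ht.2.trans (le_of_eq ?_)⟩
        push_cast
        ring
    calc _ ≤ _ := lintegral_mono_set hsub
      _ ≤ _ := lintegral_union_le _ _ _
      _ ≤ (m * ∫⁻ t in Ioc 0 p, g t) + ∫⁻ t in Ioc 0 p, g t :=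
          add_le_add ih (hshift _).le
      _ = _ := by push_cast; ring

/-- An exhaustion of `AN` by boxes. -/
def box (n : ℕ) : Set (ℝ × ℝ) := Icc (1 / ((n : ℝ) + 1)) (n + 1) ×ˢ Icc (-n : ℝ) n

theorem box_subset (n : ℕ) : box n ⊆ {x | 0 < x.1} := fun x hx =>
  lt_of_lt_of_le (by positivity) hx.1.1

theorem exists_subset_box {r : ℝ} (hr : 0 < r) (R T : ℝ) :
    ∃ n, Icc r R ×ˢ Icc (-T) T ⊆ box n := by
  obtain ⟨n, hn⟩ := exists_nat_ge (max (1 / r) (max R T))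
  have h1 : 1 / r ≤ n := (le_max_left _ _).trans hn
  have h2 : R ≤ n := (le_max_left _ _).trans ((le_max_right _ _).trans hn)
  have h3 : T ≤ n := (le_max_right _ _).trans ((le_max_right _ _).trans hn)
  refine ⟨n, Set.prod_mono (Icc_subset_Icc ?_ (by linarith)) (Icc_subset_Icc (by linarith) h3)⟩
  rw [div_le_iff₀ (by positivity)]
  rw [div_le_iff₀ hr] at h1
  linarith

/-- For `ε = 1` the weight `a^ε/a` is `1`, so the Siegel integral is a plain integral in `da dt`. -/
theorem HasExpansion.lintegral_box_le {δ : Parity} {u : ℂ} {τ : DistVectors δ u} {p : ℕ}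
    (hp : 0 < p) {b : ℤ → ℂ} (hb : HasExpansion τ p b) (v : SmoothVectors δ (-u)) (n : ℕ) :
    ∫⁻ x in box n, ‖coeffAN τ v x.1 x.2‖ₑ ^ 2 ≤
      (2 * n + 1 : ℕ) * siegelIntegral p 1 (n + 1) (coeffAN τ v) := by
  have hp' : (1 : ℝ) ≤ p := Nat.one_le_cast.2 hp
  have hm := (hb.aestronglyMeasurable_coeffAN v (box_subset n)).enorm.pow_const 2
  rw [box, Measure.volume_eq_prod, setLIntegral_prod _ hm, siegelIntegral,
    ← lintegral_const_mul' _ _ (ENNReal.natCast_ne_top _)]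
  refine (setLIntegral_mono_ae' measurableSet_Icc (Eventually.of_forall fun a ha => ?_)).trans
    (lintegral_mono_set (t := Ioc 0 ((n : ℝ) + 1)) fun a ha => ⟨?_, ha.2⟩)
  · have ha0 : 0 < a := lt_of_lt_of_le (by positivity) ha.1
    have hper : Function.Periodic (fun t => ‖coeffAN τ v a t‖ₑ ^ 2) p := fun t => by
      simp only [hb.periodic_coeffAN hp v ha0 t]
    rw [Real.rpow_one, div_self ha0.ne', ENNReal.ofReal_one, mul_one]
    refine le_trans (lintegral_mono_set fun t ht => ?_)
      -- Since `p ≥ 1`, `2n + 1` periods cover `[-n, n]`; starting at `-n - 1` keeps the endpoint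
      -- `-n` inside the half-open interval.
      (setLIntegral_Ioc_add_nsmul_le (by linarith) hper (-n - 1 : ℝ) (2 * n + 1))
    refine ⟨by linarith [ht.1], ht.2.trans ?_⟩
    push_cast
    nlinarith [(Nat.cast_nonneg n : (0 : ℝ) ≤ n)]
  · exact lt_of_lt_of_le (by positivity) ha.1

/-- The unweighted statement for the measure with density `W`: on each `Q n` the weight is bounded,
so convergence there is not lost, although `W` may be unbounded on the union. -/
theorem lintegral_weight_iUnion_le_of_tendsto {X : Type*} [MeasurableSpace X] (μ : Measure X)
    {W : X → ℝ≥0∞} (hW : Measurable W) (hWt : ∀ x, W x ≠ ⊤)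
    (Q : ℕ → Set X) (hQm : ∀ n, MeasurableSet (Q n)) (hQ : Monotone Q)
    {c : ℕ → ℝ≥0∞} (hc : ∀ n, c n ≠ ⊤) (hWc : ∀ n, ∀ x ∈ Q n, W x ≤ c n)
    {T : ℕ → X → ℂ} {f : X → ℂ}
    (hT : ∀ n j, AEStronglyMeasurable (T j) (μ.restrict (Q n)))
    (hf : ∀ n, AEStronglyMeasurable f (μ.restrict (Q n)))
    (hlim : ∀ n, Tendsto (fun j => ∫⁻ x in Q n, ‖T j x - f x‖ₑ ^ 2 ∂μ) atTop (𝓝 0))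
    {K : ℝ≥0∞} (hK : K ≠ ⊤) {N : ℕ → ℝ≥0∞} {N₀ : ℝ≥0∞} (hN : Tendsto N atTop (𝓝 N₀))
    (hb : ∀ j, ∫⁻ x in ⋃ n, Q n, ‖T j x‖ₑ ^ 2 * W x ∂μ ≤ K * N j ^ 2) :
    ∫⁻ x in ⋃ n, Q n, ‖f x‖ₑ ^ 2 * W x ∂μ ≤ K * N₀ ^ 2 := by
  have key : ∀ (S : Set X), MeasurableSet S → ∀ g : X → ℝ≥0∞,
      ∫⁻ x in S, g x ∂(μ.withDensity W) = ∫⁻ x in S, g x * W x ∂μ := fun S hS g => by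
    rw [setLIntegral_withDensity_eq_setLIntegral_mul_non_measurable _ hW _ hS
      (Eventually.of_forall fun x => (hWt x).lt_top)]
    exact lintegral_congr fun x => mul_comm _ _
  have hac : ∀ n, (μ.withDensity W).restrict (Q n) ≪ μ.restrict (Q n) := fun n =>
    (withDensity_absolutelyContinuous μ W).restrict _
  rw [← key _ (MeasurableSet.iUnion hQm)]
  refine lintegral_iUnion_le_of_tendsto _ Q hQ (fun n j => (hT n j).mono_ac (hac n))
    (fun n => (hf n).mono_ac (hac n)) (fun n => ?_) hK hN fun n j => ?_
  · have h0 := ENNReal.Tendsto.const_mul (hlim n) (Or.inr (hc n))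
    rw [mul_zero] at h0
    refine tendsto_of_tendsto_of_tendsto_of_le_of_le tendsto_const_nhds h0 (fun j => zero_le)
      fun j => ?_
    simp only
    rw [key _ (hQm n), ← lintegral_const_mul' _ _ (hc n)]
    refine setLIntegral_mono_ae' (hQm n) (Eventually.of_forall fun x hx => ?_)
    rw [mul_comm]
    exact mul_le_mul' (hWc n x hx) le_rfl
  · rw [key _ (hQm n)]
    exact (lintegral_mono_set (subset_iUnion Q n)).trans (hb j)

theorem siegelIntegral_eq_lintegral_prod {p : ℕ} {ε a₁ : ℝ} {f : ℝ → ℝ → ℂ}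
    (hf : AEStronglyMeasurable (fun x : ℝ × ℝ => f x.1 x.2)
      (volume.restrict (Ioc 0 a₁ ×ˢ Ioc 0 (p : ℝ)))) :
    siegelIntegral p ε a₁ f = ∫⁻ x in Ioc 0 a₁ ×ˢ Ioc 0 (p : ℝ),
      ‖f x.1 x.2‖ₑ ^ 2 * ENNReal.ofReal (x.1 ^ ε / x.1) := by
  have hm : Measurable fun x : ℝ × ℝ => ENNReal.ofReal (x.1 ^ ε / x.1) := by fun_prop
  rw [Measure.volume_eq_prod, setLIntegral_prod (fun x : ℝ × ℝ =>
    ‖f x.1 x.2‖ₑ ^ 2 * ENNReal.ofReal (x.1 ^ ε / x.1))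
    ((hf.enorm.pow_const 2).mul hm.aemeasurable), siegelIntegral]
  exact lintegral_congr fun a => (lintegral_mul_const' _ _ ENNReal.ofReal_ne_top).symm

theorem siegelIntegralK_eq_lintegral_prod {p : ℕ} {ε a₁ : ℝ} {f : ℝ → ℝ → ℝ → ℂ}
    (hf : AEStronglyMeasurable (fun x : ℝ × ℝ × ℝ => f x.1 x.2.1 x.2.2)
      (volume.restrict (Ico 0 (2 * Real.pi) ×ˢ Ioc 0 a₁ ×ˢ Ioc 0 (p : ℝ)))) :
    siegelIntegralK p ε a₁ f = ∫⁻ x in Ico 0 (2 * Real.pi) ×ˢ Ioc 0 a₁ ×ˢ Ioc 0 (p : ℝ),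
      ‖f x.1 x.2.1 x.2.2‖ₑ ^ 2 * ENNReal.ofReal (x.2.1 ^ ε / x.2.1) := by
  have hm : Measurable fun x : ℝ × ℝ × ℝ => ENNReal.ofReal (x.2.1 ^ ε / x.2.1) := by fun_prop
  -- Joint measurability holds only almost everywhere, so slices are controlled for almost every
  -- angle only.
  have hslice : ∀ᵐ θ ∂(volume.restrict (Ico 0 (2 * Real.pi))),
      AEStronglyMeasurable (fun y : ℝ × ℝ => f θ y.1 y.2)
        (volume.restrict (Ioc 0 a₁ ×ˢ Ioc 0 (p : ℝ))) := by
    rw [Measure.volume_eq_prod ℝ (ℝ × ℝ), ← Measure.prod_restrict] at hf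
    exact hf.prodMk_left
  rw [Measure.volume_eq_prod ℝ (ℝ × ℝ),
    setLIntegral_prod (fun x : ℝ × ℝ × ℝ =>
      ‖f x.1 x.2.1 x.2.2‖ₑ ^ 2 * ENNReal.ofReal (x.2.1 ^ ε / x.2.1))
      ((hf.enorm.pow_const 2).mul hm.aemeasurable), siegelIntegralK]
  exact lintegral_congr_ae (hslice.mono fun θ hθ => siegelIntegral_eq_lintegral_prod hθ)

/-! ### Matrix coefficients of vectors in the Hilbert space -/

theorem coeffKAN_sub {δ : Parity} {u : ℂ} (τ : DistVectors δ u) (v w : SmoothVectors δ (-u))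
    (θ a t : ℝ) : coeffKAN τ (v - w) θ a t = coeffKAN τ v θ a t - coeffKAN τ w θ a t := by
  simp only [coeffKAN, matrixCoeff, map_sub]

theorem coeffAN_sub {δ : Parity} {u : ℂ} (τ : DistVectors δ u) (v w : SmoothVectors δ (-u))
    (a t : ℝ) : coeffAN τ (v - w) a t = coeffAN τ v a t - coeffAN τ w a t := by
  simp only [coeffAN, matrixCoeff, map_sub]

theorem HasExpansion.exists_isCoeffAN {δ : Parity} {u : ℂ} {τ : DistVectors δ u} {p : ℕ}
    {b : ℤ → ℂ} (hb : HasExpansion τ p b) (hU : IsUnitary δ (-u)) {K : ℕ → ℝ≥0∞}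
    (hK : ∀ n, K n ≠ ⊤) (hbox : ∀ n (v : SmoothVectors δ (-u)),
      ∫⁻ x in box n, ‖coeffAN τ v x.1 x.2‖ₑ ^ 2 ≤ K n * unitaryNorm v ^ 2)
    (h : HilbertVectors δ (-u)) : ∃ f, IsCoeffAN τ h f := by
  obtain ⟨f, hf, hlim⟩ := exists_limit_of_bounded (volume : Measure (ℝ × ℝ))
    (fun (v : SmoothVectors δ (-u)) x => coeffAN τ v x.1 x.2) (modelLp hU)
    (fun v w => funext fun x => coeffAN_sub τ v w x.1 x.2) (map_sub _) box
    (fun v n => hb.aestronglyMeasurable_coeffAN v (box_subset n)) K hK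
    (fun n v => by rw [enorm_modelLp]; exact hbox n v)
    ((exists_convergesTo hU h).imp fun w hw => (convergesTo_iff hU w h).1 hw)
  refine ⟨fun a t => f (a, t), hf.aestronglyMeasurable, fun w hw r R T hr => ?_⟩
  obtain ⟨n, hn⟩ := exists_subset_box hr R T
  exact tendsto_of_tendsto_of_tendsto_of_le_of_le tendsto_const_nhds
    (hlim w ((convergesTo_iff hU w h).1 hw) n) (fun j => zero_le) fun j => lintegral_mono_set hn

theorem HasExpansion.exists_isCoeffKAN {δ : Parity} {u : ℂ} {τ : DistVectors δ u} {p : ℕ}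
    {b : ℤ → ℂ} (hb : HasExpansion τ p b) (hU : IsUnitary δ (-u)) {K : ℕ → ℝ≥0∞}
    (hK : ∀ n, K n ≠ ⊤) (hbox : ∀ n (v : SmoothVectors δ (-u)),
      ∫⁻ x in box n, ‖coeffAN τ v x.1 x.2‖ₑ ^ 2 ≤ K n * unitaryNorm v ^ 2)
    (h : HilbertVectors δ (-u)) : ∃ f, IsCoeffKAN τ h f := by
  have hsub : ∀ n, Ico 0 (2 * Real.pi) ×ˢ box n ⊆ {x : ℝ × ℝ × ℝ | 0 < x.2.1} := fun n x hx =>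
    box_subset n hx.2
  have hboxK : ∀ n (v : SmoothVectors δ (-u)),
      ∫⁻ x in Ico 0 (2 * Real.pi) ×ˢ box n, ‖coeffKAN τ v x.1 x.2.1 x.2.2‖ₑ ^ 2 ≤
        ENNReal.ofReal (2 * Real.pi) * K n * unitaryNorm v ^ 2 := fun n v => by
    have hm := (hb.aestronglyMeasurable_coeffKAN v (hsub n)).enorm.pow_const 2
    rw [Measure.volume_eq_prod ℝ (ℝ × ℝ), setLIntegral_prod _ hm]
    have hθ : ∀ θ, ∫⁻ x in box n, ‖coeffKAN τ v θ x.1 x.2‖ₑ ^ 2 ≤ K n * unitaryNorm v ^ 2 :=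
      fun θ => by
        simp only [coeffKAN_eq]
        rw [← hU.unitaryNorm_rep_K v θ]
        exact hbox n _
    refine (lintegral_mono hθ).trans (le_of_eq ?_)
    rw [setLIntegral_const, Real.volume_Ico, sub_zero]
    ring
  obtain ⟨f, hf, hlim⟩ := exists_limit_of_bounded (volume : Measure (ℝ × ℝ × ℝ))
    (fun (v : SmoothVectors δ (-u)) x => coeffKAN τ v x.1 x.2.1 x.2.2) (modelLp hU)
    (fun v w => funext fun x => coeffKAN_sub τ v w x.1 x.2.1 x.2.2) (map_sub _)
    (fun n => Ico 0 (2 * Real.pi) ×ˢ box n)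
    (fun v n => hb.aestronglyMeasurable_coeffKAN v (hsub n)) _
    (fun n => ENNReal.mul_ne_top ENNReal.ofReal_ne_top (hK n))
    (fun n v => by rw [enorm_modelLp]; exact hboxK n v)
    ((exists_convergesTo hU h).imp fun w hw => (convergesTo_iff hU w h).1 hw)
  refine ⟨fun θ a t => f (θ, a, t), hf.aestronglyMeasurable, fun w hw r R T hr => ?_⟩
  obtain ⟨n, hn⟩ := exists_subset_box hr R T
  exact tendsto_of_tendsto_of_tendsto_of_le_of_le tendsto_const_nhds
    (hlim w ((convergesTo_iff hU w h).1 hw) n) (fun j => zero_le)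
    fun j => lintegral_mono_set (Set.prod_mono subset_rfl hn)

theorem iUnion_Icc_one_div (a₁ : ℝ) : ⋃ n : ℕ, Icc (1 / ((n : ℝ) + 1)) a₁ = Ioc 0 a₁ := by
  ext a
  simp only [mem_iUnion, mem_Icc, mem_Ioc, exists_and_right, and_congr_left_iff]
  refine fun _ => ⟨fun ⟨n, hn⟩ => lt_of_lt_of_le (by positivity) hn, fun ha => ?_⟩
  obtain ⟨n, hn⟩ := exists_nat_one_div_lt ha
  exact ⟨n, hn.le⟩

theorem monotone_Icc_one_div (a₁ : ℝ) : Monotone fun n : ℕ => Icc (1 / ((n : ℝ) + 1)) a₁ :=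
  fun _ _ h => Icc_subset_Icc_left (Nat.one_div_le_one_div h)

theorem rpow_div_le {ε a₁ a : ℝ} {n : ℕ} (hε : 0 < ε) (ha : a ∈ Icc (1 / ((n : ℝ) + 1)) a₁) :
    a ^ ε / a ≤ a₁ ^ ε * (n + 1) := by
  have h0 : 0 < 1 / ((n : ℝ) + 1) := by positivity
  have ha0 : 0 < a := h0.trans_le ha.1
  rw [div_eq_mul_inv]
  refine mul_le_mul (Real.rpow_le_rpow ha0.le ha.2 hε.le) ?_ (by positivity)
    (Real.rpow_nonneg (ha0.le.trans ha.2) _)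
  have := inv_anti₀ h0 ha.1
  simpa using this

theorem tendsto_unitaryNorm {δ : Parity} {s : ℂ} (hs : IsUnitary δ s)
    {w : ℕ → SmoothVectors δ s} {h : HilbertVectors δ s} (hw : ConvergesTo w h) :
    Tendsto (fun j => unitaryNorm (w j)) atTop (𝓝 ‖h‖ₑ) := by
  have := ((convergesTo_iff hs w h).1 hw).enorm
  simp only [enorm_modelLp] at this
  exact this

/-- The weight `a^ε/a` may blow up at `a = 0`, where `L²_loc` convergence says nothing; hence the
exhaustion by `a ≥ 1/(n+1)`, on which the weight is at most `a₁^ε (n+1)`. -/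
theorem IsCoeffAN.siegelIntegral_le {δ : Parity} {u : ℂ} {τ : DistVectors δ u} {p : ℕ}
    {b : ℤ → ℂ} (hb : HasExpansion τ p b) (hU : IsUnitary δ (-u)) {ε a₁ : ℝ} (hε : 0 < ε)
    {K : ℝ≥0∞} (hK : K ≠ ⊤) (hv : ∀ v : SmoothVectors δ (-u),
      siegelIntegral p ε a₁ (coeffAN τ v) ≤ K * unitaryNorm v ^ 2)
    {h : HilbertVectors δ (-u)} {f : ℝ → ℝ → ℂ} (hf : IsCoeffAN τ h f) :
    siegelIntegral p ε a₁ f ≤ K * ‖h‖ₑ ^ 2 := by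
  obtain ⟨w, hw⟩ := exists_convergesTo hU h
  set Q : ℕ → Set (ℝ × ℝ) := fun n => Icc (1 / ((n : ℝ) + 1)) a₁ ×ˢ Ioc 0 (p : ℝ) with hQ
  have hUn : ⋃ n, Q n = Ioc 0 a₁ ×ˢ Ioc 0 (p : ℝ) := by
    rw [hQ, ← iUnion_prod_const, iUnion_Icc_one_div]
  have hpos : ∀ n, Q n ⊆ {x | 0 < x.1} := fun n x hx => lt_of_lt_of_le (by positivity) hx.1.1
  have hm : Measurable fun x : ℝ × ℝ => ENNReal.ofReal (x.1 ^ ε / x.1) := by fun_prop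
  rw [siegelIntegral_eq_lintegral_prod (hf.1.mono_measure
    (Measure.restrict_mono (Set.prod_mono Ioc_subset_Ioi_self (subset_univ _)) le_rfl)), ← hUn]
  refine lintegral_weight_iUnion_le_of_tendsto volume hm (fun x => ENNReal.ofReal_ne_top) Q
    (fun n => measurableSet_Icc.prod measurableSet_Ioc)
    (fun m n hmn => Set.prod_mono (monotone_Icc_one_div a₁ hmn) subset_rfl)
    (fun n => ENNReal.ofReal_ne_top)
    (fun n x hx => ENNReal.ofReal_le_ofReal (rpow_div_le hε hx.1))
    (fun n j => hb.aestronglyMeasurable_coeffAN (w j) (hpos n))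
    (fun n => hf.1.mono_measure (Measure.restrict_mono_set _
      (t := Ioi 0 ×ˢ univ) (fun x hx => ⟨hpos n hx, mem_univ _⟩)))
    (fun n => ?_) hK (tendsto_unitaryNorm hU hw) fun j => ?_
  · refine tendsto_of_tendsto_of_tendsto_of_le_of_le tendsto_const_nhds
      (hf.2 w hw (1 / (n + 1)) a₁ p (by positivity)) (fun j => zero_le)
      fun j => lintegral_mono_set (Set.prod_mono subset_rfl fun t ht => ⟨?_, ht.2⟩)
    have := ht.1.trans_le ht.2
    linarith [ht.1]
  · rw [hUn, ← siegelIntegral_eq_lintegral_prod (f := coeffAN τ (w j))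
      (hb.aestronglyMeasurable_coeffAN (w j) fun x hx => hx.1.1)]
    exact hv (w j)

theorem IsCoeffKAN.siegelIntegralK_le {δ : Parity} {u : ℂ} {τ : DistVectors δ u} {p : ℕ}
    {b : ℤ → ℂ} (hb : HasExpansion τ p b) (hU : IsUnitary δ (-u)) {ε a₁ : ℝ} (hε : 0 < ε)
    {K : ℝ≥0∞} (hK : K ≠ ⊤) (hv : ∀ v : SmoothVectors δ (-u),
      siegelIntegralK p ε a₁ (coeffKAN τ v) ≤ K * unitaryNorm v ^ 2)
    {h : HilbertVectors δ (-u)} {f : ℝ → ℝ → ℝ → ℂ} (hf : IsCoeffKAN τ h f) :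
    siegelIntegralK p ε a₁ f ≤ K * ‖h‖ₑ ^ 2 := by
  obtain ⟨w, hw⟩ := exists_convergesTo hU h
  set Q : ℕ → Set (ℝ × ℝ × ℝ) := fun n =>
    Ico 0 (2 * Real.pi) ×ˢ Icc (1 / ((n : ℝ) + 1)) a₁ ×ˢ Ioc 0 (p : ℝ) with hQ
  have hUn : ⋃ n, Q n = Ico 0 (2 * Real.pi) ×ˢ Ioc 0 a₁ ×ˢ Ioc 0 (p : ℝ) := by
    rw [hQ, ← prod_iUnion, ← iUnion_prod_const, iUnion_Icc_one_div]
  have hpos : ∀ n, Q n ⊆ {x | 0 < x.2.1} := fun n x hx =>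
    lt_of_lt_of_le (by positivity) hx.2.1.1
  have hm : Measurable fun x : ℝ × ℝ × ℝ => ENNReal.ofReal (x.2.1 ^ ε / x.2.1) := by fun_prop
  rw [siegelIntegralK_eq_lintegral_prod (hf.1.mono_measure (Measure.restrict_mono
    (Set.prod_mono subset_rfl (Set.prod_mono Ioc_subset_Ioi_self (subset_univ _))) le_rfl)), ← hUn]
  refine lintegral_weight_iUnion_le_of_tendsto volume hm (fun x => ENNReal.ofReal_ne_top) Q
    (fun n => measurableSet_Ico.prod (measurableSet_Icc.prod measurableSet_Ioc))
    (fun m n hmn => Set.prod_mono subset_rfl (Set.prod_mono (monotone_Icc_one_div a₁ hmn)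
          subset_rfl))
    (fun n => ENNReal.ofReal_ne_top)
    (fun n x hx => ENNReal.ofReal_le_ofReal (rpow_div_le hε hx.2.1))
    (fun n j => hb.aestronglyMeasurable_coeffKAN (w j) (hpos n))
    (fun n => hf.1.mono_measure (Measure.restrict_mono_set _
      (t := Ico 0 (2 * Real.pi) ×ˢ Ioi 0 ×ˢ univ) (fun x hx => ⟨hx.1, hpos n hx, mem_univ _⟩)))
    (fun n => ?_) hK (tendsto_unitaryNorm hU hw) fun j => ?_
  · refine tendsto_of_tendsto_of_tendsto_of_le_of_le tendsto_const_nhds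
      (hf.2 w hw (1 / (n + 1)) a₁ p (by positivity)) (fun j => zero_le)
      fun j => lintegral_mono_set
        (Set.prod_mono subset_rfl (Set.prod_mono subset_rfl fun t ht => ⟨?_, ht.2⟩))
    have := ht.1.trans_le ht.2
    linarith [ht.1]
  · rw [hUn, ← siegelIntegralK_eq_lintegral_prod (f := coeffKAN τ (w j))
      (hb.aestronglyMeasurable_coeffKAN (w j) fun x hx => hx.2.1.1)]
    exact hv (w j)

end PrincipalSeries

end

/-! ### Assembly of the two statements. -/

open PrincipalSeries in
theorem mainTheorem3 (δ : Parity) (u : ℂ) (hu : u.re < 1) (p : ℕ) (hp : 0 < p)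
    (τ : DistVectors δ u) (hτ : IsPeriodicNoConst τ p)
    (hφ : ∃ φ : SmoothVectors δ (-u),
      (∃ M : ℝ, ∀ a t : ℝ, 0 < a → ‖matrixCoeff τ φ (elemA a * elemN t)‖ ≤ M) ∧
      (∃ ξ : ℝ, 0 < ξ ∧ fourier φ ξ ≠ 0) ∧ (∃ ξ : ℝ, ξ < 0 ∧ fourier φ ξ ≠ 0)) :
    (∀ ε : ℝ, 0 < ε → ∃ C : ℝ, 0 < C ∧
      ∀ (a₁ : ℝ) (v : SmoothVectors δ (-u)), 0 < a₁ →
        siegelIntegral p ε a₁ (coeffAN τ v) ≤ ENNReal.ofReal (C * a₁ ^ ε) *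
          ∫⁻ ξ in {ξ : ℝ | 1 / (a₁ ^ 2 * p) ≤ |ξ|},
            ENNReal.ofReal (|ξ| ^ u.re) * ‖fourier v ξ‖ₑ ^ 2 ∧
        ∫⁻ ξ in {ξ : ℝ | 1 / (a₁ ^ 2 * p) ≤ |ξ|},
            ENNReal.ofReal (|ξ| ^ u.re) * ‖fourier v ξ‖ₑ ^ 2 < ⊤) ∧
    (IsUnitary δ u →
      (∀ v : SmoothVectors δ (-u), MemLp (unitaryModel v) 2 (unitaryMeasure (-u))) ∧
      (∀ h : HilbertVectors δ (-u), ∃ f, IsCoeffAN τ h f) ∧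
      (∀ h : HilbertVectors δ (-u), ∃ f, IsCoeffKAN τ h f) ∧
      ∀ ε : ℝ, 0 < ε → ∃ C : ℝ, 0 < C ∧ ∀ a₁ : ℝ, 0 < a₁ →
        (∀ v : SmoothVectors δ (-u),
          siegelIntegral p ε a₁ (coeffAN τ v) ≤
            ENNReal.ofReal (C * a₁ ^ ε) * unitaryNorm v ^ 2 ∧
          siegelIntegralK p ε a₁ (coeffKAN τ v) ≤
            ENNReal.ofReal (C * a₁ ^ ε) * unitaryNorm v ^ 2) ∧
        (∀ (h : HilbertVectors δ (-u)) (f : ℝ → ℝ → ℂ), IsCoeffAN τ h f →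
          siegelIntegral p ε a₁ f ≤ ENNReal.ofReal (C * a₁ ^ ε * ‖h‖ ^ 2)) ∧
        (∀ (h : HilbertVectors δ (-u)) (f : ℝ → ℝ → ℝ → ℂ), IsCoeffKAN τ h f →
          siegelIntegralK p ε a₁ f ≤ ENNReal.ofReal (C * a₁ ^ ε * ‖h‖ ^ 2))) := by
  obtain ⟨b, hb⟩ := hτ
  replace hb : HasExpansion τ p b := hb
  obtain ⟨φ, ⟨M, hM⟩, hpos, hneg⟩ := hφ
  have hp' : (0 : ℝ) < p := Nat.cast_pos.2 hp
  have hweight := fun ε (hε : 0 < ε) => hb.exists_weight_le hu hp hM hpos hneg hε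
  refine ⟨fun ε hε => ?_, fun hU => ?_⟩
  · obtain ⟨C, hC, hW⟩ := hweight ε hε
    exact ⟨C, hC, fun a₁ v ha₁ => ⟨hb.siegelIntegral_le hu hp hC.le hW v ha₁,
      lintegral_fourier_ge_lt_top hu v (by positivity)⟩⟩
  replace hU := hU.neg
  -- The existence of limits needs only the exponent `1`, which controls the unweighted integral
  -- over boxes.
  obtain ⟨C₁, hC₁, hW₁⟩ := hweight 1 one_pos
  set K : ℕ → ENNReal := fun n => (2 * n + 1 : ℕ) * ENNReal.ofReal (C₁ * (n + 1) ^ (1 : ℝ))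
  have hK : ∀ n, K n ≠ ⊤ := fun n =>
    ENNReal.mul_ne_top (ENNReal.natCast_ne_top _) ENNReal.ofReal_ne_top
  have hbox : ∀ n (v : SmoothVectors δ (-u)),
      ∫⁻ x in box n, ‖coeffAN τ v x.1 x.2‖ₑ ^ 2 ≤ K n * unitaryNorm v ^ 2 := fun n v => by
    rw [mul_assoc]
    exact (hb.lintegral_box_le hp v n).trans (mul_le_mul' le_rfl
      (hU.siegelIntegral_le hu hp hb hC₁.le hW₁ v (by positivity)))
  refine ⟨fun v => hU.memLp v, hb.exists_isCoeffAN hU hK hbox, hb.exists_isCoeffKAN hU hK hbox,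
    fun ε hε => ?_⟩
  obtain ⟨C, hC, hW⟩ := hweight ε hε
  have hpi := Real.pi_pos
  -- One constant for both inequalities: `C` suffices on `AN` and `2πC` on `KAN`.
  refine ⟨(2 * Real.pi + 1) * C, by positivity, fun a₁ ha₁ => ?_⟩
  have hAN : ∀ v : SmoothVectors δ (-u), siegelIntegral p ε a₁ (coeffAN τ v) ≤
      ENNReal.ofReal (C * a₁ ^ ε) * unitaryNorm v ^ 2 := fun v =>
    hU.siegelIntegral_le hu hp hb hC.le hW v ha₁
  have hpow : 0 < a₁ ^ ε := Real.rpow_pos_of_pos ha₁ ε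
  have hle : ENNReal.ofReal (C * a₁ ^ ε) ≤ ENNReal.ofReal ((2 * Real.pi + 1) * C * a₁ ^ ε) :=
    ENNReal.ofReal_le_ofReal (by
      gcongr
      nlinarith)
  have hAN' : ∀ v : SmoothVectors δ (-u), siegelIntegral p ε a₁ (coeffAN τ v) ≤
      ENNReal.ofReal ((2 * Real.pi + 1) * C * a₁ ^ ε) * unitaryNorm v ^ 2 := fun v =>
    (hAN v).trans (mul_le_mul' hle le_rfl)
  have hKAN : ∀ v : SmoothVectors δ (-u), siegelIntegralK p ε a₁ (coeffKAN τ v) ≤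
      ENNReal.ofReal ((2 * Real.pi + 1) * C * a₁ ^ ε) * unitaryNorm v ^ 2 := fun v => by
    refine (hU.siegelIntegralK_le hAN v).trans ?_
    rw [← mul_assoc, ← ENNReal.ofReal_mul (by positivity), ← mul_assoc]
    refine mul_le_mul' (ENNReal.ofReal_le_ofReal ?_) le_rfl
    gcongr
    linarith
  have hnorm : ∀ h : HilbertVectors δ (-u),
      ENNReal.ofReal ((2 * Real.pi + 1) * C * a₁ ^ ε) * ‖h‖ₑ ^ 2 =
        ENNReal.ofReal ((2 * Real.pi + 1) * C * a₁ ^ ε * ‖h‖ ^ 2) := fun h => by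
    rw [← ofReal_norm, ← ENNReal.ofReal_pow (norm_nonneg _), ← ENNReal.ofReal_mul (by positivity)]
  refine ⟨fun v => ⟨hAN' v, hKAN v⟩, fun h f hf => ?_, fun h f hf => ?_⟩
  · rw [← hnorm]
    exact hf.siegelIntegral_le hb hU hε ENNReal.ofReal_ne_top hAN'
  · rw [← hnorm]
    exact hf.siegelIntegralK_le hb hU hε ENNReal.ofReal_ne_top hKAN
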